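/- Let $0\le a_0<a_1<\dots<a_n$ be integers with $\gcd(a_0,\dots,a_n)=1$ and with no $a_i$ equal to $1$. Then the Frobenius number $F=F(a_0,\dots,a_n)$, the largest integer $t\ge 0$ for which $a_0x_0+\dots+a_nx_n=t$ has no solution $x\in\mathbb{Z}_{\ge 0}^{n+1}$, exists (and $n\ge 1$). Theorem. There is an algorithm (a single program on a unit-cost word RAM with word length $O(\log a_n)$ bits, whose word operations are addition, subtraction, multiplication, integer division with remainder, comparison and indirect memory access) that, given any such $n$ and $a_0,\dots,a_n$, computes $F$ in time $$O\Big(a_n\log a_n\cdot\big(1+\max\{0,\log\tfrac{F}{a_n}\}\big)\Big),$$ and this running-time bound satisfies $$a_n\log a_n\cdot\big(1+\max\{0,\log\tfrac{F}{a_n}\}\big)=O\Big(a_n\log a_n\cdot\big(1+\log\tfrac{a_n}{n}\big)\Big).$$ All implied constants, including the one in the word length, are absolute. -/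

import Mathlib

/-! A word RAM with structured control flow.

A machine for word length `w` has registers and an addressable memory, all of whose cells hold
natural numbers below `2 ^ w` (words).  A program is a fixed text (independent of the input and of
`w`).  Every constant, register read, memory read, arithmetic operation, write and branch test costs
one step.  A run in which some computed value does not fit into a word is not a legal run. -/

namespace WordRAM

/-- The word operations. Subtraction is truncated at `0`, division by `0` gives `0`, and the
comparisons return `1` (true) or `0` (false). -/
inductive Op
  | add | sub | mul | div | mod | lt | eq

def Op.eval : Op → ℕ → ℕ → ℕ
  | .add, x, y => x + y
  | .sub, x, y => x - y
  | .mul, x, y => x * y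
  | .div, x, y => x / y
  | .mod, x, y => x % y
  | .lt, x, y => if x < y then 1 else 0
  | .eq, x, y => if x = y then 1 else 0

/-- Contents of the registers and of the memory. -/
structure State where
  reg : ℕ → ℕ
  mem : ℕ → ℕ

/-- Expressions: constants, registers, indirect memory reads, and word operations. -/
inductive Expr
  | const (k : ℕ)
  | reg (r : ℕ)
  | load (addr : Expr)
  | bin (op : Op) (e₁ e₂ : Expr)

/-- The value of an expression. -/
def Expr.eval (s : State) : Expr → ℕ
  | .const k => k
  | .reg r => s.reg r
  | .load e => s.mem (e.eval s)
  | .bin op e₁ e₂ => op.eval (e₁.eval s) (e₂.eval s)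

/-- The number of steps needed to evaluate an expression: one per node. -/
def Expr.cost : Expr → ℕ
  | .const _ => 1
  | .reg _ => 1
  | .load e => e.cost + 1
  | .bin _ e₁ e₂ => e₁.cost + e₂.cost + 1

/-- All values that occur in the evaluation of the expression are words of length `w`. -/
def Expr.Fits (w : ℕ) (s : State) : Expr → Prop
  | .const k => k < 2 ^ w
  | .reg r => s.reg r < 2 ^ w
  | .load e => e.Fits w s ∧ s.mem (e.eval s) < 2 ^ w
  | .bin op e₁ e₂ => e₁.Fits w s ∧ e₂.Fits w s ∧ op.eval (e₁.eval s) (e₂.eval s) < 2 ^ w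

/-- Programs. -/
inductive Program
  | nop
  | assign (r : ℕ) (e : Expr)
  | store (addr e : Expr)
  | seq (p q : Program)
  | ite (e : Expr) (p q : Program)
  | loop (e : Expr) (p : Program)

/-- `Exec w p s t s'`: on a machine with word length `w`, the program `p` started in state `s`
halts in state `s'` after exactly `t` steps, and all values computed during the run are words of
length `w`.  Tests succeed when the tested value is nonzero. -/
inductive Exec (w : ℕ) : Program → State → ℕ → State → Prop
  | nop (s : State) : Exec w .nop s 1 s
  | assign (s : State) (r : ℕ) (e : Expr) (h : e.Fits w s) :
      Exec w (.assign r e) s (e.cost + 1) { s with reg := Function.update s.reg r (e.eval s) }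
  | store (s : State) (addr e : Expr) (ha : addr.Fits w s) (h : e.Fits w s) :
      Exec w (.store addr e) s (addr.cost + e.cost + 1)
        { s with mem := Function.update s.mem (addr.eval s) (e.eval s) }
  | seq {p q : Program} {s s' s'' : State} {t t' : ℕ}
      (hp : Exec w p s t s') (hq : Exec w q s' t' s'') : Exec w (.seq p q) s (t + t') s''
  | ite_true {e : Expr} {p q : Program} {s s' : State} {t : ℕ}
      (h : e.Fits w s) (he : e.eval s ≠ 0) (hp : Exec w p s t s') :
      Exec w (.ite e p q) s (e.cost + 1 + t) s'
  | ite_false {e : Expr} {p q : Program} {s s' : State} {t : ℕ}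
      (h : e.Fits w s) (he : e.eval s = 0) (hq : Exec w q s t s') :
      Exec w (.ite e p q) s (e.cost + 1 + t) s'
  | loop_done {e : Expr} {p : Program} {s : State} (h : e.Fits w s) (he : e.eval s = 0) :
      Exec w (.loop e p) s (e.cost + 1) s
  | loop_step {e : Expr} {p : Program} {s s' s'' : State} {t t' : ℕ}
      (h : e.Fits w s) (he : e.eval s ≠ 0)
      (hp : Exec w p s t s') (hl : Exec w (.loop e p) s' t' s'') :
      Exec w (.loop e p) s (e.cost + 1 + t + t') s''

/-- The initial state on input `a₀, …, aₙ`: register `0` holds `n`, memory cell `i` holds `aᵢ` for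
`i ≤ n`, and everything else is `0`. -/
def initState {n : ℕ} (a : Fin (n + 1) → ℕ) : State where
  reg r := if r = 0 then n else 0
  mem i := if h : i < n + 1 then a ⟨i, h⟩ else 0

end WordRAM

/-!
The Frobenius number is read off from characteristic arrays of short windows of the semigroup `S`
generated by the `a i`. Let `m` be the largest generator. Every element of `S` splits into two
elements of `S` one of which lies in a prescribed interval of length `m` (`exists_add_eq_of_le`).
Hence the part of `S` in the window of radius `2 m` around `t + u` is determined by the windows of
the same radius around `t` and around `u`, as a piece of their sumset (`mem_window_iff`).

* The initial segment of `S` up to `4 m` is computed by extending it by factors `3 / 2`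
  (`mem_closure_iff_exists_add`); the costs of the rounds form a geometric series.
* The windows around `2 m, 4 m, 8 m, …` are computed until `m` consecutive elements of `S` show that
  the Frobenius number `F` has been passed (`full_iff`). This takes about `log (F / m)` rounds.
* A binary search with the stored windows finds a window that contains `F`, again with one sumset for
  each round.

Each sumset of two subsets of an interval of length `O(m)` has to be computed in time
`O(m log m)` with words of `O(log m)` bits. The two indicator functions become the real and the
imaginary part of one complex vector of length `N = 2 ^ K`. Its convolution square is obtained by
transforming, squaring and transforming again; no inverse transform is needed, since a second
transform returns the vector in reverse order. The imaginary part of the result is `0` or at least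
`N` before rounding (`DFT.im_level_square`). All of this is done in fixed-point arithmetic with scale
`N ^ 16`: a complex number is a pair of natural numbers with a common offset `N ^ 20`, which replaces
the missing signs. The root of unity itself comes from halving the angle `π / 2` with integer square
roots (`FixedPoint.half_angle`). The errors are at most `N ^ 12` units of `N ^ (-16)`, so that a
comparison with `N / 2` recovers the sumset (`WordRAM.run_sumsetProg`).

Programs are verified with a Hoare logic for total correctness, in which `WordRAM.Run v p s T Q`
includes the time bound `T` and the bound `2 ^ v` on the contents of registers and memory. The values
occurring inside expressions then fit into words of `p.deg * v` bits, where `p.deg` depends on the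
program only.

The second inequality of the theorem is the bound `F * n ^ 2 ≤ 2 * m ^ 3`
(`frobeniusNumber_mul_sq_le`). It follows from the growth of sumsets in `ℤ / m`: a generating set `X`
that contains `0` satisfies `X + X = ℤ / m` or `|X + X| ≥ (3 / 2) |X|`
(`sumset_eq_univ_or_card_le`).
-/


/-! ### A program logic with time bounds -/

namespace WordRAM

instance (k : ℕ) : OfNat Expr k := ⟨.const k⟩
instance : Add Expr := ⟨.bin .add⟩
instance : Sub Expr := ⟨.bin .sub⟩
instance : Mul Expr := ⟨.bin .mul⟩
instance : Div Expr := ⟨.bin .div⟩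
instance : Mod Expr := ⟨.bin .mod⟩

infixr:60 " ;; " => Program.seq

@[simp] lemma Expr.eval_const (s : State) (k : ℕ) :
    Expr.eval s (no_index (OfNat.ofNat k : Expr)) = (OfNat.ofNat k : ℕ) := rfl
@[simp] lemma Expr.eval_reg (s : State) (r : ℕ) : (Expr.reg r).eval s = s.reg r := rfl
@[simp] lemma Expr.eval_load (s : State) (e : Expr) : (Expr.load e).eval s = s.mem (e.eval s) := rfl
@[simp] lemma Expr.eval_add (s : State) (e f : Expr) : (e + f).eval s = e.eval s + f.eval s := rfl
@[simp] lemma Expr.eval_sub (s : State) (e f : Expr) : (e - f).eval s = e.eval s - f.eval s := rfl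
@[simp] lemma Expr.eval_mul (s : State) (e f : Expr) : (e * f).eval s = e.eval s * f.eval s := rfl
@[simp] lemma Expr.eval_div (s : State) (e f : Expr) : (e / f).eval s = e.eval s / f.eval s := rfl
@[simp] lemma Expr.eval_mod (s : State) (e f : Expr) : (e % f).eval s = e.eval s % f.eval s := rfl
@[simp] lemma Expr.eval_lt (s : State) (e f : Expr) :
    (Expr.bin .lt e f).eval s = if e.eval s < f.eval s then 1 else 0 := rfl
@[simp] lemma Expr.eval_eq (s : State) (e f : Expr) :
    (Expr.bin .eq e f).eval s = if e.eval s = f.eval s then 1 else 0 := rfl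

/-- The state `s` with register `r` set to `x`. -/
def State.set (s : State) (r x : ℕ) : State := { s with reg := Function.update s.reg r x }

/-- The state `s` with memory cell `a` set to `x`. -/
def State.put (s : State) (a x : ℕ) : State := { s with mem := Function.update s.mem a x }

@[simp] lemma State.set_mem (s : State) (r x : ℕ) : (s.set r x).mem = s.mem := rfl
@[simp] lemma State.put_reg (s : State) (a x : ℕ) : (s.put a x).reg = s.reg := rfl
@[simp] lemma State.set_reg (s : State) (r x r' : ℕ) :
    (s.set r x).reg r' = if r' = r then x else s.reg r' := by
  simp [State.set, Function.update_apply]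
@[simp] lemma State.put_mem (s : State) (a x a' : ℕ) :
    (s.put a x).mem a' = if a' = a then x else s.mem a' := by
  simp [State.put, Function.update_apply]

/-- All registers and memory cells hold numbers below `2 ^ v`. -/
structure Bdd (v : ℕ) (s : State) : Prop where
  pos : 1 ≤ v
  reg : ∀ r, s.reg r < 2 ^ v
  mem : ∀ a, s.mem a < 2 ^ v

lemma Bdd.set {v : ℕ} {s : State} (h : Bdd v s) (r : ℕ) {x : ℕ} (hx : x < 2 ^ v) :
    Bdd v (s.set r x) := by
  refine ⟨h.pos, fun r' => ?_, h.mem⟩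
  rw [State.set_reg]
  split_ifs
  · exact hx
  · exact h.reg _

lemma Bdd.put {v : ℕ} {s : State} (h : Bdd v s) (a : ℕ) {x : ℕ} (hx : x < 2 ^ v) :
    Bdd v (s.put a x) := by
  refine ⟨h.pos, h.reg, fun a' => ?_⟩
  rw [State.put_mem]
  split_ifs
  · exact hx
  · exact h.mem _

/-- A multiplier for the word length: if registers and memory hold numbers below `2 ^ v`, then all
values occurring in the evaluation of `e` lie below `2 ^ (e.deg * v)`. -/
def Expr.deg : Expr → ℕ
  | .const k => k + 1
  | .reg _ => 1
  | .load e => e.deg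
  | .bin _ e f => e.deg + f.deg

lemma Expr.deg_pos (e : Expr) : 1 ≤ e.deg := by
  induction e <;> simp_all [Expr.deg]; omega

lemma Op.eval_lt_two_pow (op : Op) {x y a b : ℕ} (hx : x < 2 ^ a) (hy : y < 2 ^ b) (ha : 1 ≤ a)
    (hb : 1 ≤ b) : op.eval x y < 2 ^ (a + b) := by
  have h1 : 2 ^ a ≤ 2 ^ (a + b) := Nat.pow_le_pow_right (by norm_num) (by omega)
  have h2 : 2 ^ 1 ≤ 2 ^ a := Nat.pow_le_pow_right (by norm_num) ha
  have h3 : 2 ^ 1 ≤ 2 ^ b := Nat.pow_le_pow_right (by norm_num) hb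
  cases op
  · simp only [Op.eval, pow_add]; nlinarith
  · exact (Nat.sub_le _ _).trans_lt (hx.trans_le h1)
  · simp only [Op.eval, pow_add]; exact Nat.mul_lt_mul'' hx hy
  · exact (Nat.div_le_self _ _).trans_lt (hx.trans_le h1)
  · exact (Nat.mod_le _ _).trans_lt (hx.trans_le h1)
  · simp only [Op.eval]; split_ifs <;> omega
  · simp only [Op.eval]; split_ifs <;> omega

lemma Expr.eval_lt_and_fits {v : ℕ} {s : State} (h : Bdd v s) (e : Expr) :
    e.eval s < 2 ^ (e.deg * v) ∧ ∀ w, e.deg * v ≤ w → e.Fits w s := by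
  have hv := h.pos
  induction e with
  | const k =>
    have : k < 2 ^ ((k + 1) * v) :=
      (Nat.lt_two_pow_self).trans_le (Nat.pow_le_pow_right (by norm_num) (by nlinarith))
    exact ⟨this, fun w hw => this.trans_le (Nat.pow_le_pow_right (by norm_num) hw)⟩
  | reg r =>
    have : s.reg r < 2 ^ (1 * v) := by simpa using h.reg r
    exact ⟨this, fun w hw => this.trans_le (Nat.pow_le_pow_right (by norm_num) hw)⟩
  | load e ih =>
    have hm : v ≤ e.deg * v := Nat.le_mul_of_pos_left _ e.deg_pos
    have : s.mem (e.eval s) < 2 ^ (e.deg * v) :=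
      (h.mem _).trans_le (Nat.pow_le_pow_right (by norm_num) hm)
    exact ⟨this, fun w hw => ⟨ih.2 w hw, this.trans_le (Nat.pow_le_pow_right (by norm_num) hw)⟩⟩
  | bin op e f ihe ihf =>
    have he : 1 ≤ e.deg * v := Nat.mul_pos e.deg_pos hv
    have hf : 1 ≤ f.deg * v := Nat.mul_pos f.deg_pos hv
    have key := Op.eval_lt_two_pow op ihe.1 ihf.1 he hf
    rw [← add_mul] at key
    refine ⟨key, fun w hw => ?_⟩
    have hw' : (e.deg + f.deg) * v ≤ w := hw
    rw [add_mul] at hw'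
    exact ⟨ihe.2 w (by omega), ihf.2 w (by omega),
      key.trans_le (Nat.pow_le_pow_right (by norm_num) hw)⟩

lemma Bdd.fits {v w : ℕ} {s : State} (h : Bdd v s) {e : Expr} (hw : e.deg * v ≤ w) : e.Fits w s :=
  (e.eval_lt_and_fits h).2 w hw

/-- The maximum of `Expr.deg` over the expressions of a program. -/
def Program.deg : Program → ℕ
  | .nop => 0
  | .assign _ e => e.deg
  | .store a e => max a.deg e.deg
  | .seq p q => max p.deg q.deg
  | .ite e p q => max e.deg (max p.deg q.deg)
  | .loop e p => max e.deg p.deg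

/-- Total correctness with a time bound: from a state `s` bounded by `2 ^ v`, on every machine whose
words are long enough for the intermediate values of `p`, the program `p` halts within `T` steps in a
state that satisfies `Q` and is again bounded by `2 ^ v`. -/
def Run (v : ℕ) (p : Program) (s : State) (T : ℕ) (Q : State → Prop) : Prop :=
  Bdd v s → ∀ w, p.deg * v ≤ w → ∃ t s', Exec w p s t s' ∧ t ≤ T ∧ Bdd v s' ∧ Q s'

lemma Run.mono {v : ℕ} {p : Program} {s : State} {T T' : ℕ} {Q Q' : State → Prop}
    (h : Run v p s T Q) (hT : T ≤ T') (hQ : ∀ s', Bdd v s' → Q s' → Q' s') : Run v p s T' Q' := by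
  intro hB w hw
  obtain ⟨t, s', h1, h2, h3, h4⟩ := h hB w hw
  exact ⟨t, s', h1, h2.trans hT, h3, hQ _ h3 h4⟩

lemma Run.seq {v : ℕ} {p q : Program} {s : State} {T₁ T₂ T : ℕ} {R Q : State → Prop}
    (hp : Run v p s T₁ R) (hq : ∀ s', Bdd v s' → R s' → Run v q s' T₂ Q) (hT : T₁ + T₂ ≤ T) :
    Run v (p ;; q) s T Q := by
  intro hB w hw
  have hw' : max p.deg q.deg * v ≤ w := hw
  obtain ⟨t, s', h1, h2, h3, h4⟩ := hp hB w
    ((Nat.mul_le_mul_right _ (le_max_left _ _)).trans hw')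
  obtain ⟨t', s'', h1', h2', h3', h4'⟩ := hq s' h3 h4 h3 w
    ((Nat.mul_le_mul_right _ (le_max_right _ _)).trans hw')
  exact ⟨t + t', s'', .seq h1 h1', by omega, h3', h4'⟩

lemma Run.ite {v : ℕ} {e : Expr} {p q : Program} {s : State} {T T' : ℕ} {Q : State → Prop}
    (hp : e.eval s ≠ 0 → Run v p s T' Q) (hq : e.eval s = 0 → Run v q s T' Q)
    (hT : e.cost + 1 + T' ≤ T) : Run v (.ite e p q) s T Q := by
  intro hB w hw
  have hw' : max e.deg (max p.deg q.deg) * v ≤ w := hw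
  have hf : e.Fits w s := hB.fits ((Nat.mul_le_mul_right _ (by simp)).trans hw')
  by_cases he : e.eval s = 0
  · obtain ⟨t, s', h1, h2, h3, h4⟩ := hq he hB w ((Nat.mul_le_mul_right _ (by simp)).trans hw')
    exact ⟨_, s', .ite_false hf he h1, by omega, h3, h4⟩
  · obtain ⟨t, s', h1, h2, h3, h4⟩ := hp he hB w ((Nat.mul_le_mul_right _ (by simp)).trans hw')
    exact ⟨_, s', .ite_true hf he h1, by omega, h3, h4⟩

/-- The rule for loops. The ghost variable `x` describes the current state through the invariant `I`,
and `Φ x` bounds the remaining running time. -/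
lemma Run.loop {α : Type*} {v : ℕ} {e : Expr} {p : Program} {Q : State → Prop}
    (I : α → State → Prop) (Φ : α → ℕ)
    (hdone : ∀ x s, Bdd v s → I x s → e.eval s = 0 → Q s ∧ e.cost + 1 ≤ Φ x)
    (hstep : ∀ x s, Bdd v s → I x s → e.eval s ≠ 0 → ∃ Tb, Run v p s Tb
      (fun s' => ∃ x', I x' s' ∧ Tb + e.cost + 1 + Φ x' ≤ Φ x))
    (x : α) (s : State) (hI : I x s) {T : ℕ} (hT : Φ x ≤ T) : Run v (.loop e p) s T Q := by
  suffices H : ∀ k x s, Φ x = k → I x s → Run v (.loop e p) s k Q from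
    (H _ x s rfl hI).mono hT fun _ _ h => h
  intro k
  induction k using Nat.strong_induction_on with
  | _ k ih =>
    intro x s hk hI hB w hw
    have hw' : max e.deg p.deg * v ≤ w := hw
    have hf : e.Fits w s := hB.fits ((Nat.mul_le_mul_right _ (by simp)).trans hw')
    by_cases he : e.eval s = 0
    · obtain ⟨hQ, hle⟩ := hdone x s hB hI he
      exact ⟨_, s, .loop_done hf he, by omega, hB, hQ⟩
    · obtain ⟨Tb, hr⟩ := hstep x s hB hI he
      obtain ⟨t, s', h1, h2, h3, x', h4, h5⟩ :=
        hr hB w ((Nat.mul_le_mul_right _ (by simp)).trans hw')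
      obtain ⟨t', s'', g1, g2, g3, g4⟩ := ih (Φ x') (by omega) x' s' rfl h4 h3 w hw
      exact ⟨_, s'', .loop_step hf he h1 g1, by omega, g3, g4⟩

/-- The weakest precondition of a loop-free program, given that all cells stay below `2 ^ v`. -/
def Program.wp (v : ℕ) : Program → (State → Prop) → State → Prop
  | .nop, Q, s => Q s
  | .assign r e, Q, s => e.eval s < 2 ^ v ∧ Q (s.set r (e.eval s))
  | .store a e, Q, s => e.eval s < 2 ^ v ∧ Q (s.put (a.eval s) (e.eval s))
  | .seq p q, Q, s => p.wp v (q.wp v Q) s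
  | .ite e p q, Q, s => (e.eval s ≠ 0 → p.wp v Q s) ∧ (e.eval s = 0 → q.wp v Q s)
  | .loop _ _, _, _ => False

/-- An upper bound for the running time of a loop-free program. -/
def Program.flatCost : Program → ℕ
  | .nop => 1
  | .assign _ e => e.cost + 1
  | .store a e => a.cost + e.cost + 1
  | .seq p q => p.flatCost + q.flatCost
  | .ite e p q => e.cost + 1 + max p.flatCost q.flatCost
  | .loop _ _ => 0

lemma Run.flat {v : ℕ} {p : Program} {s : State} {T : ℕ} {Q : State → Prop}
    (h : Bdd v s → p.wp v Q s) (hT : p.flatCost ≤ T) : Run v p s T Q := by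
  intro hB w hw
  replace h := h hB
  suffices H : ∃ t s', Exec w p s t s' ∧ t ≤ p.flatCost ∧ Bdd v s' ∧ Q s' by
    obtain ⟨t, s', h1, h2, h3, h4⟩ := H
    exact ⟨t, s', h1, h2.trans hT, h3, h4⟩
  clear hT
  induction p generalizing s Q with
  | nop => exact ⟨1, s, .nop s, le_rfl, hB, h⟩
  | assign r e => exact ⟨_, _, .assign s r e (hB.fits hw), le_rfl, hB.set r h.1, h.2⟩
  | store a e =>
    have hw' : max a.deg e.deg * v ≤ w := hw
    exact ⟨_, _, .store s a e (hB.fits ((Nat.mul_le_mul_right _ (by simp)).trans hw'))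
      (hB.fits ((Nat.mul_le_mul_right _ (by simp)).trans hw')), le_rfl, hB.put _ h.1, h.2⟩
  | seq p q ihp ihq =>
    have hw' : max p.deg q.deg * v ≤ w := hw
    obtain ⟨t, s', h1, h2, h3, h4⟩ := ihp hB ((Nat.mul_le_mul_right _ (by simp)).trans hw') h
    obtain ⟨t', s'', g1, g2, g3, g4⟩ := ihq h3 ((Nat.mul_le_mul_right _ (by simp)).trans hw') h4
    exact ⟨_, _, .seq h1 g1, Nat.add_le_add h2 g2, g3, g4⟩
  | ite e p q ihp ihq =>
    have hw' : max e.deg (max p.deg q.deg) * v ≤ w := hw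
    have hf : e.Fits w s := hB.fits ((Nat.mul_le_mul_right _ (by simp)).trans hw')
    have hc : (Program.ite e p q).flatCost = e.cost + 1 + max p.flatCost q.flatCost := rfl
    have hl := le_max_left p.flatCost q.flatCost
    have hr := le_max_right p.flatCost q.flatCost
    by_cases he : e.eval s = 0
    · obtain ⟨t, s', h1, h2, h3, h4⟩ := ihq hB ((Nat.mul_le_mul_right _ (by simp)).trans hw')
        (h.2 he)
      exact ⟨_, s', .ite_false hf he h1, by omega, h3, h4⟩
    · obtain ⟨t, s', h1, h2, h3, h4⟩ := ihp hB ((Nat.mul_le_mul_right _ (by simp)).trans hw')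
        (h.1 he)
      exact ⟨_, s', .ite_true hf he h1, by omega, h3, h4⟩
  | loop e p => exact h.elim

/-- `for i = 0, …, e - 1 do p`, the counter being register `i`. -/
def Program.forLoop (i : ℕ) (e : Expr) (p : Program) : Program :=
  .assign i 0 ;; .loop (.bin .lt (.reg i) e) (p ;; .assign i (.reg i + 1))

lemma Run.forLoop {v i : ℕ} {e : Expr} {p : Program} {s : State} {n Tb T : ℕ} {Q : State → Prop}
    (I : ℕ → State → Prop) (hn : n < 2 ^ v) (h0 : I 0 (s.set i 0))
    (he : ∀ j s, I j s → e.eval s = n)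
    (hb : ∀ j s, Bdd v s → j < n → I j s → s.reg i = j →
      Run v p s Tb (fun s' => s'.reg i = j ∧ I (j + 1) (s'.set i (j + 1))))
    (hQ : ∀ s, I n s → s.reg i = n → Q s)
    (hT : n * (Tb + e.cost + 7) + e.cost + 5 ≤ T) : Run v (.forLoop i e p) s T Q := by
  have hc : (Expr.bin .lt (.reg i) e).cost = e.cost + 2 := by simp [Expr.cost]; ring
  refine Run.seq (T₁ := 2) (T₂ := n * (Tb + e.cost + 7) + e.cost + 3)
    (R := fun s' => I 0 s' ∧ s'.reg i = 0)
    (Run.flat (fun hB => ?_) le_rfl) ?_ (by omega)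
  · exact ⟨by simp, by simpa using h0, by simp⟩
  · rintro s' hB' ⟨hI, hi⟩
    refine Run.loop (fun j s => I j s ∧ s.reg i = j ∧ j ≤ n)
      (fun j => (n - j) * (Tb + e.cost + 7) + e.cost + 3) ?_ ?_ 0 s' ⟨hI, hi, by omega⟩ (by simp)
    · rintro j s hB ⟨hI, hi, hj⟩ h
      rw [hc]
      simp only [Expr.eval_lt, Expr.eval_reg, he j s hI, hi] at h
      have : j = n := by
        by_contra hne
        rw [if_pos (by omega)] at h
        omega
      subst this
      exact ⟨hQ s hI hi, by simp⟩
    · rintro j s hB ⟨hI, hi, hj⟩ h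
      simp only [Expr.eval_lt, Expr.eval_reg, he j s hI, hi] at h
      have hjn : j < n := by
        by_contra hne
        rw [if_neg hne] at h
        omega
      refine ⟨Tb + 4, Run.seq (T₂ := 4) (hb j s hB hjn hI hi) ?_ le_rfl⟩
      rintro s'' hB'' ⟨h1, h2⟩
      refine Run.flat (fun _ => ?_) le_rfl
      refine ⟨by simp [h1]; omega, j + 1, ⟨by simpa [h1] using h2, by simp [h1], by omega⟩, ?_⟩
      rw [hc]
      obtain ⟨d, rfl⟩ : ∃ d, n = j + 1 + d := ⟨n - (j + 1), by omega⟩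
      rw [show j + 1 + d - (j + 1) = d by omega, show j + 1 + d - j = d + 1 by omega]
      ring_nf
      omega

end WordRAM

/-! ### Numerical semigroups -/

section Semigroup

variable {A : Set ℕ} {m : ℕ}

/-- If every generator is at most `m`, an element `s` of the semigroup splits into two elements, the
first of which lies in the interval `(τ - m, τ]` for a prescribed `τ ≤ s`. -/
lemma exists_add_eq_of_le (hm : 0 < m) (hA : ∀ g ∈ A, g ≤ m) {s : ℕ}
    (hs : s ∈ AddSubmonoid.closure A) {τ : ℕ} (hτ : τ ≤ s) :
    ∃ x ∈ AddSubmonoid.closure A, ∃ y ∈ AddSubmonoid.closure A, x + y = s ∧ x ≤ τ ∧ τ < x + m := by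
  induction hs using AddSubmonoid.closure_induction_left generalizing τ with
  | zero => exact ⟨0, zero_mem _, 0, zero_mem _, rfl, by omega, by omega⟩
  | add_left g hg s hs ih =>
    have hg' := AddSubmonoid.subset_closure hg
    have hgm := hA g hg
    by_cases h : g ≤ τ
    · obtain ⟨x, hx, y, hy, h1, h2, h3⟩ := ih (τ := τ - g) (by omega)
      exact ⟨g + x, add_mem hg' hx, y, hy, by omega, by omega, by omega⟩
    · exact ⟨0, zero_mem _, g + s, add_mem hg' hs, by omega, by omega, by omega⟩

lemma exists_add_eq_of_notMem {z : ℕ} (hz : z ∈ AddSubmonoid.closure A) (h0 : z ≠ 0) (hA : z ∉ A) :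
    ∃ x ∈ AddSubmonoid.closure A, ∃ y ∈ AddSubmonoid.closure A, x ≠ 0 ∧ y ≠ 0 ∧ x + y = z := by
  induction hz using AddSubmonoid.closure_induction with
  | mem x hx => exact absurd hx hA
  | zero => exact absurd rfl h0
  | add x y hx hy ihx ihy =>
    by_cases hx0 : x = 0
    · subst hx0
      simpa using ihy (by simpa using h0) (by simpa using hA)
    by_cases hy0 : y = 0
    · subst hy0
      simpa using ihx (by simpa using h0) (by simpa using hA)
    exact ⟨x, hx, y, hy, hx0, hy0, rfl⟩

/-- The step of the initial phase: the elements of the semigroup up to `3 u / 2` are the sums of two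
numbers each of which is a generator or an element of the semigroup up to `u`. -/
lemma mem_closure_iff_exists_add {u x : ℕ} (hx : x ≤ u + u / 2) :
    x ∈ AddSubmonoid.closure A ↔
      ∃ y z, (if y ≤ u then y ∈ AddSubmonoid.closure A else y ∈ A) ∧
        (if z ≤ u then z ∈ AddSubmonoid.closure A else z ∈ A) ∧ y + z = x := by
  constructor
  · intro h
    -- Among the decompositions `x = y + z` with `y ≤ u`, descend on the larger part `z`.
    suffices H : ∀ z y, z ∈ AddSubmonoid.closure A → y ∈ AddSubmonoid.closure A → y ≤ u →
        y + z = x → ∃ y z, (if y ≤ u then y ∈ AddSubmonoid.closure A else y ∈ A) ∧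
        (if z ≤ u then z ∈ AddSubmonoid.closure A else z ∈ A) ∧ y + z = x from
      H x 0 h (zero_mem _) (by omega) (by omega)
    intro z
    induction z using Nat.strong_induction_on with
    | _ z ih =>
      intro y hz hy hyu hyz
      by_cases hzu : z ≤ u
      · exact ⟨y, z, by rwa [if_pos hyu], by rwa [if_pos hzu], hyz⟩
      by_cases hzA : z ∈ A
      · exact ⟨y, z, by rwa [if_pos hyu], by rwa [if_neg hzu], hyz⟩
      obtain ⟨p, hp, q, hq, hp0, hq0, hpq⟩ := exists_add_eq_of_notMem hz (by omega) hzA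
      have key : ∀ p q, p ∈ AddSubmonoid.closure A → q ∈ AddSubmonoid.closure A → p ≠ 0 → q ≠ 0 →
          p + q = z → q ≤ p → ∃ y z, (if y ≤ u then y ∈ AddSubmonoid.closure A else y ∈ A) ∧
          (if z ≤ u then z ∈ AddSubmonoid.closure A else z ∈ A) ∧ y + z = x := by
        intro p q hp hq hp0 hq0 hpq hle
        exact ih p (by omega) (y + q) hp (add_mem hy hq) (by omega) (by omega)
      rcases le_total q p with hle | hle
      · exact key p q hp hq hp0 hq0 hpq hle
      · exact key q p hq hp hq0 hp0 (by omega) hle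
  · have aux : ∀ y, (if y ≤ u then y ∈ AddSubmonoid.closure A else y ∈ A) →
        y ∈ AddSubmonoid.closure A := by
      intro y hy
      split_ifs at hy
      · exact hy
      · exact AddSubmonoid.subset_closure hy
    rintro ⟨y, z, hy, hz, rfl⟩
    exact add_mem (aux y hy) (aux z hz)

/-- The window step: the elements of the semigroup in the window of radius `2 m` around `t + u` are
sums of elements in the windows of the same radius around `t` and around `u`. Position `x` of the
window around `t` stands for the number `t - 2 m + x`. -/
lemma mem_window_iff (hm : 0 < m) (hA : ∀ g ∈ A, g ≤ m) {t u x : ℕ} (ht : 2 * m ≤ t)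
    (hu : 2 * m ≤ u) (hx : x ≤ 4 * m) :
    t + u - 2 * m + x ∈ AddSubmonoid.closure A ↔
      ∃ y ≤ 4 * m, ∃ z ≤ 4 * m, t - 2 * m + y ∈ AddSubmonoid.closure A ∧
        u - 2 * m + z ∈ AddSubmonoid.closure A ∧ y + z = x + 2 * m := by
  constructor
  · intro h
    obtain ⟨p, hp, q, hq, hpq, h1, h2⟩ :=
      exists_add_eq_of_le hm hA h (τ := t - m + x / 2) (by omega)
    refine ⟨p - (t - 2 * m), by omega, q - (u - 2 * m), by omega, ?_, ?_, by omega⟩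
    · rwa [show t - 2 * m + (p - (t - 2 * m)) = p by omega]
    · rwa [show u - 2 * m + (q - (u - 2 * m)) = q by omega]
  · rintro ⟨y, -, z, -, hy, hz, h⟩
    have := add_mem hy hz
    rwa [show t - 2 * m + y + (u - 2 * m + z) = t + u - 2 * m + x by omega] at this

lemma mem_of_full (hm : 0 < m) (hmA : m ∈ AddSubmonoid.closure A) {t : ℕ}
    (h : ∀ i < m, t + i ∈ AddSubmonoid.closure A) {x : ℕ} (hx : t ≤ x) :
    x ∈ AddSubmonoid.closure A := by
  have h1 := h ((x - t) % m) (Nat.mod_lt _ hm)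
  have h2 := AddSubmonoid.nsmul_mem _ hmA ((x - t) / m)
  have := add_mem h1 h2
  rw [smul_eq_mul, mul_comm, add_assoc, Nat.mod_add_div] at this
  rwa [show t + (x - t) = x by omega] at this

/-- The test for the end of the doubling phase. -/
lemma full_iff {F : ℕ} (hm : 0 < m) (hmA : m ∈ AddSubmonoid.closure A) (hF : FrobeniusNumber F A)
    (t : ℕ) : (∀ i < m, t + i ∈ AddSubmonoid.closure A) ↔ F < t := by
  constructor
  · intro h
    by_contra hlt
    exact hF.1 (mem_of_full hm hmA h (by omega))
  · intro h i _
    by_contra hi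
    have := hF.2 hi
    omega

end Semigroup

/-! ### Growth of sumsets and the size of the Frobenius number -/

section Growth

open Finset Pointwise

variable {G : Type*} [AddCommGroup G] [Fintype G] [DecidableEq G]

/-- A very short form of Freiman's `3/2`-theorem. If `|X + X| < 3/2 |X|`, then every difference of two
elements of `X` has more than `|X| / 2` representations, so `X - X` is closed under addition and hence
is the whole group; counting pairs shows that `X` has more than half of the elements of the group. -/
lemma sumset_eq_univ_or_card_le (X : Finset G) (h0 : 0 ∈ X)
    (hgen : AddSubmonoid.closure (X : Set G) = ⊤) :
    X + X = univ ∨ 3 * #X ≤ 2 * #(X + X) := by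
  by_contra! hcon
  obtain ⟨hne, hlt⟩ := hcon
  have hXpos : 0 < #X := card_pos.2 ⟨0, h0⟩
  set rep : G → Finset G := fun d => X.filter (fun v => v + d ∈ X) with hrep
  have hdiff : ∀ x ∈ X, ∀ y ∈ X, #X < 2 * #(rep (x - y)) := by
    intro x hx y hy
    have h1 : #((X.image (x + ·)) ∩ (X.image (y + ·))) ≤ #(rep (x - y)) := by
      refine card_le_card_of_injOn (fun g => g - x) ?_ ?_
      · intro g hg
        simp only [coe_inter, coe_image, Set.mem_inter_iff, Set.mem_image, SetLike.mem_coe] at hg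
        obtain ⟨⟨p, hp, rfl⟩, q, hq, hqp⟩ := hg
        simp only [hrep, coe_filter, Set.mem_ofPred_eq]
        refine ⟨by simpa using hp, ?_⟩
        have : x + p - x + (x - y) = q := by rw [← eq_sub_iff_add_eq'] at hqp; rw [hqp]; abel
        rw [this]; exact hq
      · intro a _ b _ h
        simpa using h
    have h2 : #((X.image (x + ·)) ∪ (X.image (y + ·))) ≤ #(X + X) := by
      refine card_le_card (union_subset ?_ ?_) <;>
      · intro g hg
        obtain ⟨p, hp, rfl⟩ := mem_image.1 hg
        exact add_mem_add (by assumption) hp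
    have h3 := card_union_add_card_inter (X.image (x + ·)) (X.image (y + ·))
    rw [card_image_of_injective _ (add_right_injective x),
      card_image_of_injective _ (add_right_injective y)] at h3
    omega
  have hmeet : ∀ U ⊆ X, ∀ V ⊆ X, #X < 2 * #U → #X < 2 * #V → ∃ g ∈ U, g ∈ V := by
    intro U hU V hV h1 h2
    have h3 := card_union_add_card_inter U V
    have h4 := card_le_card (union_subset hU hV)
    obtain ⟨g, hg⟩ := card_pos.1 (show 0 < #(U ∩ V) by omega)
    exact ⟨g, (mem_inter.1 hg).1, (mem_inter.1 hg).2⟩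
  have hall : ∀ d : G, ∃ x ∈ X, ∃ y ∈ X, d = x - y := by
    intro d
    have hd : d ∈ AddSubmonoid.closure (X : Set G) := by rw [hgen]; trivial
    induction hd using AddSubmonoid.closure_induction with
    | mem x hx => exact ⟨x, hx, 0, h0, by simp⟩
    | zero => exact ⟨0, h0, 0, h0, by simp⟩
    | add d e _ _ ihd ihe =>
      obtain ⟨x, hx, y, hy, rfl⟩ := ihd
      obtain ⟨x', hx', y', hy', rfl⟩ := ihe
      have h1 := hdiff x hx y hy
      have h2 := hdiff y' hy' x' hx'
      obtain ⟨g, hg1, hg2⟩ := hmeet _ (filter_subset _ _) _ (filter_subset _ _) h1 h2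
      exact ⟨_, (mem_filter.1 hg1).2, _, (mem_filter.1 hg2).2, by abel⟩
  have hcount : ∑ d : G, #(rep d) = #X * #X := by
    simp only [hrep, card_filter]
    rw [sum_comm]
    have : ∀ v : G, ∑ d : G, (if v + d ∈ X then 1 else 0) = #X := by
      intro v
      rw [← card_filter]
      refine card_bij (fun d _ => v + d) (fun d hd => (mem_filter.1 hd).2)
        (fun a _ b _ h => add_left_cancel h) (fun b hb => ⟨b - v, ?_, by abel⟩)
      simpa using hb
    simp [this]
  have hbig : Fintype.card G < 2 * #X := by
    have h1 : ∑ _d : G, #X < ∑ d : G, 2 * #(rep d) := by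
      refine sum_lt_sum_of_nonempty univ_nonempty fun d _ => ?_
      obtain ⟨x, hx, y, hy, rfl⟩ := hall d
      exact hdiff x hx y hy
    rw [← mul_sum, hcount, sum_const, card_univ, smul_eq_mul] at h1
    have : Fintype.card G * #X < (2 * #X) * #X := by linarith
    exact lt_of_mul_lt_mul_right this (Nat.zero_le _)
  refine hne (eq_univ_iff_forall.2 fun g => ?_)
  have h3 := card_union_add_card_inter X (X.image (g - ·))
  rw [card_image_of_injective _ (sub_right_injective)] at h3
  have h4 := card_le_univ (X ∪ X.image (g - ·))
  obtain ⟨x, hx⟩ := card_pos.1 (show 0 < #(X ∩ X.image (g - ·)) by omega)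
  obtain ⟨hx1, hx2⟩ := mem_inter.1 hx
  obtain ⟨y, hy, rfl⟩ := mem_image.1 hx2
  exact mem_add.2 ⟨_, hx1, y, hy, by abel⟩

end Growth

lemma StrictMono.le_apply_last {n : ℕ} {a : Fin (n + 1) → ℕ} (ha : StrictMono a) :
    n ≤ a (Fin.last n) := by
  have hi : ∀ i : Fin (n + 1), (i : ℕ) ≤ a i := by
    intro i
    induction i using Fin.induction with
    | zero => exact Nat.zero_le _
    | succ i ih =>
      have := ha i.castSucc_lt_succ
      rw [Fin.val_castSucc] at ih
      rw [Fin.val_succ]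
      omega
  exact hi (Fin.last n)

section Growth

open Finset Pointwise

/-- A bound for the Frobenius number that is polynomial in `m / n`. In `ℤ / m` the residues of the
generators form a set of at least `n` elements whose iterated doublings grow by factors `3 / 2` until
they exhaust the group. -/
lemma frobeniusNumber_mul_sq_le {n : ℕ} {a : Fin (n + 1) → ℕ} (ha : StrictMono a) (hn : 1 ≤ n) {F : ℕ}
    (hF : FrobeniusNumber F (Set.range a)) :
    F * n ^ 2 ≤ 2 * a (Fin.last n) ^ 3 := by
  set m := a (Fin.last n) with hm
  have hnm : n ≤ m := ha.le_apply_last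
  have hm0 : 0 < m := by omega
  have : NeZero m := ⟨by omega⟩
  have hle : ∀ g ∈ Set.range a, g ≤ m := by
    rintro _ ⟨i, rfl⟩
    exact ha.monotone (Fin.le_last i)
  have hmS : m ∈ AddSubmonoid.closure (Set.range a) := AddSubmonoid.subset_closure ⟨_, rfl⟩
  -- the residues reached by sums of `2 ^ j` generators
  let X : ℕ → Finset (ZMod m) := fun j =>
    Nat.rec (univ.image fun i => ((a i : ℕ) : ZMod m)) (fun _ Y => Y + Y) j
  have hX0 : X 0 = univ.image fun i => ((a i : ℕ) : ZMod m) := rfl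
  have hXs : ∀ j, X (j + 1) = X j + X j := fun _ => rfl
  have hzero : ∀ j, 0 ∈ X j := by
    intro j
    induction j with
    | zero => exact mem_image.2 ⟨Fin.last n, mem_univ _, by simp [← hm]⟩
    | succ j ih => rw [hXs]; simpa using add_mem_add ih ih
  have hsub : ∀ j, X 0 ⊆ X j := by
    intro j
    induction j with
    | zero => exact Subset.rfl
    | succ j ih =>
      intro g hg
      rw [hXs]
      simpa using add_mem_add (ih hg) (hzero j)
  have hgen : ∀ j, AddSubmonoid.closure (SetLike.coe (X j)) = (⊤ : AddSubmonoid (ZMod m)) := by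
    intro j
    rw [eq_top_iff]
    intro r _
    -- A large number in the residue class `r` lies in the semigroup.
    have hbig : r.val + (F + 1) * m ∈ AddSubmonoid.closure (Set.range a) := by
      by_contra h
      have := hF.2 h
      nlinarith
    have h1 := AddSubmonoid.mem_map_of_mem (Nat.castAddMonoidHom (ZMod m)) hbig
    rw [AddMonoidHom.map_mclosure] at h1
    have h2 : (Nat.castAddMonoidHom (ZMod m)) (r.val + (F + 1) * m) = r := by simp
    rw [h2] at h1
    refine AddSubmonoid.closure_mono ?_ h1
    rintro _ ⟨_, ⟨i, rfl⟩, rfl⟩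
    exact hsub j (mem_image_of_mem _ (mem_univ i))
  have hrep : ∀ j, ∀ r ∈ X j, ∃ s ∈ AddSubmonoid.closure (Set.range a), s ≤ 2 ^ j * m ∧
      (s : ZMod m) = r := by
    intro j
    induction j with
    | zero =>
      intro r hr
      obtain ⟨i, -, rfl⟩ := mem_image.1 hr
      exact ⟨a i, AddSubmonoid.subset_closure ⟨i, rfl⟩, by simpa using hle _ ⟨i, rfl⟩, rfl⟩
    | succ j ih =>
      intro r hr
      obtain ⟨x, hx, y, hy, rfl⟩ := mem_add.1 hr
      obtain ⟨s, hs, h1, rfl⟩ := ih x hx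
      obtain ⟨t, ht, h2, rfl⟩ := ih y hy
      exact ⟨s + t, add_mem hs ht, by rw [pow_succ]; linarith, by simp⟩
  have hFle : ∀ j, X j = univ → F ≤ 2 ^ j * m := by
    intro j hj
    by_contra! hlt
    obtain ⟨s, hs, h1, h2⟩ := hrep j (F : ZMod m) (by rw [hj]; exact mem_univ _)
    rw [ZMod.natCast_eq_natCast_iff] at h2
    obtain ⟨k, hk⟩ := (Nat.modEq_iff_dvd' (h1.trans hlt.le)).1 h2
    refine hF.1 ?_
    have h3 := add_mem hs (AddSubmonoid.nsmul_mem _ hmS k)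
    rwa [smul_eq_mul, mul_comm k m, ← hk, Nat.add_sub_cancel' (h1.trans hlt.le)] at h3
  have hcard0 : n ≤ #(X 0) := by
    have hinj : Set.InjOn (fun i : Fin n => ((a i.castSucc : ℕ) : ZMod m)) (univ : Finset (Fin n)) := by
      intro i _ j _ h
      have hlt : ∀ i : Fin n, a i.castSucc < m := fun i => ha (Fin.castSucc_lt_last i)
      have h' := (ZMod.natCast_eq_natCast_iff' _ _ _).1 h
      rw [Nat.mod_eq_of_lt (hlt i), Nat.mod_eq_of_lt (hlt j)] at h'
      exact Fin.castSucc_injective _ (ha.injective h')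
    have := card_image_of_injOn hinj
    rw [card_univ, Fintype.card_fin] at this
    rw [← this]
    refine card_le_card fun g hg => ?_
    obtain ⟨i, -, rfl⟩ := mem_image.1 hg
    exact mem_image_of_mem (fun i => ((a i : ℕ) : ZMod m)) (mem_univ i.castSucc)
  have hgrow : ∀ j, X j = univ ∨ 3 ^ j * n ≤ 2 ^ j * #(X j) := by
    intro j
    induction j with
    | zero => right; simpa using hcard0
    | succ j ih =>
      rcases sumset_eq_univ_or_card_le (X j) (hzero j) (hgen j) with h | h
      · exact .inl h
      · rcases ih with ih | ih
        · left
          rw [hXs, ih]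
          exact eq_univ_iff_forall.2 fun g => mem_add.2 ⟨g, mem_univ _, 0, mem_univ _, by simp⟩
        · right
          rw [hXs, pow_succ, pow_succ]
          calc 3 ^ j * 3 * n = 3 * (3 ^ j * n) := by ring
            _ ≤ 3 * (2 ^ j * #(X j)) := by omega
            _ = 2 ^ j * (3 * #(X j)) := by ring
            _ ≤ 2 ^ j * (2 * #(X j + X j)) := Nat.mul_le_mul_left _ h
            _ = _ := by ring
  have hgrow' : ∀ j, X j ≠ univ → 3 ^ j * n ≤ 2 ^ j * m := by
    intro j hj
    refine ((hgrow j).resolve_left hj).trans (Nat.mul_le_mul_left _ ?_)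
    simpa [ZMod.card] using card_le_univ (X j)
  have hex : ∃ j, X j = univ := by
    by_contra! hne
    obtain ⟨j, hj⟩ := pow_unbounded_of_one_lt (m : ℚ) (show (1 : ℚ) < 3 / 2 by norm_num)
    have h1 : (3 : ℚ) ^ j * n ≤ 2 ^ j * m := by exact_mod_cast hgrow' j (hne j)
    rw [div_pow, lt_div_iff₀ (by positivity)] at hj
    have h2 : (1 : ℚ) ≤ n := by exact_mod_cast hn
    have h3 : (0 : ℚ) < 3 ^ j := by positivity
    nlinarith
  obtain ⟨j, hj, hmin⟩ : ∃ j, X j = univ ∧ ∀ i < j, X i ≠ univ := by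
    obtain ⟨j, hj, h⟩ := WellFounded.has_min Nat.lt_wfRel.wf {j | X j = univ} hex
    exact ⟨j, hj, fun i hi hXi => h i hXi hi⟩
  rcases j with _ | i
  · have h1 := hFle 0 hj
    have h2 : n ^ 2 ≤ m ^ 2 := Nat.pow_le_pow_left hnm 2
    calc F * n ^ 2 ≤ (2 ^ 0 * m) * m ^ 2 := Nat.mul_le_mul h1 h2
      _ ≤ 2 * m ^ 3 := by ring_nf; omega
  · have h1 := hFle (i + 1) hj
    have h2 := hgrow' i (hmin i (by omega))
    have h3 : 2 ^ i * n ^ 2 ≤ m ^ 2 := by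
      have h4 : (3 ^ i * n) ^ 2 ≤ (2 ^ i * m) ^ 2 := Nat.pow_le_pow_left h2 2
      have h5 : (8 : ℕ) ^ i ≤ 9 ^ i := Nat.pow_le_pow_left (by norm_num) i
      have h6 : (3 ^ i * n) ^ 2 = 9 ^ i * n ^ 2 := by
        rw [mul_pow, ← pow_mul, mul_comm i 2, pow_mul]; norm_num
      have h7 : (2 ^ i * m) ^ 2 = 4 ^ i * m ^ 2 := by
        rw [mul_pow, ← pow_mul, mul_comm i 2, pow_mul]; norm_num
      have h8 : (8 : ℕ) ^ i = 4 ^ i * 2 ^ i := by rw [← mul_pow]; norm_num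
      rw [h6, h7] at h4
      refine le_of_mul_le_mul_left (a := 4 ^ i) ?_ (by positivity)
      calc 4 ^ i * (2 ^ i * n ^ 2) = 8 ^ i * n ^ 2 := by rw [h8]; ring
        _ ≤ 9 ^ i * n ^ 2 := Nat.mul_le_mul_right _ h5
        _ ≤ _ := h4
    calc F * n ^ 2 ≤ (2 ^ (i + 1) * m) * n ^ 2 := Nat.mul_le_mul_right _ h1
      _ = 2 * m * (2 ^ i * n ^ 2) := by ring
      _ ≤ 2 * m * m ^ 2 := Nat.mul_le_mul_left _ h3
      _ = 2 * m ^ 3 := by ring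

end Growth

/-! ### Fixed-point complex arithmetic -/

namespace FixedPoint

/-- The complex number (in units of `1 / D`, say) stored as the pair `X, Y` of natural numbers with
offset `B`. -/
noncomputable def val (B X Y : ℕ) : ℂ := ⟨(X : ℝ) - B, (Y : ℝ) - B⟩

/-- The pair `X, Y`, read with offset `B` and scale `D`, represents the number `z`, up to an error of
`E` units of `1 / D`. -/
def Approx (D B : ℕ) (E : ℝ) (X Y : ℕ) (z : ℂ) : Prop := ‖val B X Y - D * z‖ ≤ E

lemma abs_natSub_div_sub_le {P Q D : ℕ} (hD : 0 < D) {r : ℝ} (h : (P : ℝ) - Q = D * r) (hr : 0 ≤ r) :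
    |(((P - Q) / D : ℕ) : ℝ) - r| ≤ 1 ∧ (((P - Q) / D : ℕ) : ℝ) ≤ r := by
  have hD' : (0 : ℝ) < D := by exact_mod_cast hD
  have hQP : Q ≤ P := by
    have : (Q : ℝ) ≤ P := by nlinarith [mul_nonneg hD'.le hr]
    exact_mod_cast this
  have h1 : r = ((P - Q : ℕ) : ℝ) / D := by
    rw [Nat.cast_sub hQP, h]; field_simp
  have h2 : (((P - Q) / D : ℕ) : ℝ) ≤ r := by rw [h1]; exact Nat.cast_div_le
  have h3 : r < (((P - Q) / D : ℕ) : ℝ) + 1 := by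
    rw [h1, div_lt_iff₀ hD']
    exact_mod_cast Nat.lt_mul_of_div_lt (Nat.lt_succ_self ((P - Q) / D)) hD
  exact ⟨by rw [abs_le]; constructor <;> linarith, h2⟩

lemma val_round {D B P Q P' Q' : ℕ} (hD : 0 < D) {z : ℂ} (h : (P : ℝ) - Q = D * (z.re + B))
    (h' : (P' : ℝ) - Q' = D * (z.im + B)) (hz : ‖z‖ ≤ B) :
    ‖val B ((P - Q) / D) ((P' - Q') / D) - z‖ ≤ 2 ∧ (P - Q) / D ≤ 2 * B ∧
      (P' - Q') / D ≤ 2 * B := by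
  have hre := abs_le.1 ((Complex.abs_re_le_norm z).trans hz)
  have him := abs_le.1 ((Complex.abs_im_le_norm z).trans hz)
  obtain ⟨h1, h2⟩ := abs_natSub_div_sub_le hD h (by linarith)
  obtain ⟨h3, h4⟩ := abs_natSub_div_sub_le hD h' (by linarith)
  refine ⟨?_, ?_, ?_⟩
  · refine (Complex.norm_le_abs_re_add_abs_im _).trans ?_
    have e1 : (val B ((P - Q) / D) ((P' - Q') / D) - z).re = (((P - Q) / D : ℕ) : ℝ) - (z.re + B) := by
      simp only [val, Complex.sub_re]; ring
    have e2 : (val B ((P - Q) / D) ((P' - Q') / D) - z).im =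
        (((P' - Q') / D : ℕ) : ℝ) - (z.im + B) := by
      simp only [val, Complex.sub_im]; ring
    rw [e1, e2]; linarith
  · have : (((P - Q) / D : ℕ) : ℝ) ≤ (2 * B : ℕ) := by push_cast at *; linarith
    exact_mod_cast this
  · have : (((P' - Q') / D : ℕ) : ℝ) ≤ (2 * B : ℕ) := by push_cast at *; linarith
    exact_mod_cast this

lemma norm_mul_div_sub_le {D : ℝ} (hD : 0 < D) {u y w x : ℂ} {ε E M : ℝ} (hu : ‖u - D * w‖ ≤ ε)
    (hy : ‖y - D * x‖ ≤ E) (hw : ‖w‖ ≤ 1) (hx : ‖x‖ ≤ M) (hε : ε ≤ D) :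
    ‖u * y / D - D * (w * x)‖ ≤ ε * M + 2 * E := by
  have hDc : (D : ℂ) ≠ 0 := by exact_mod_cast hD.ne'
  have hε0 := (norm_nonneg _).trans hu
  have hE0 := (norm_nonneg _).trans hy
  have hM0 := (norm_nonneg _).trans hx
  have h1 : u * y / D - D * (w * x) =
      (u - D * w) * x + (u - D * w) * (y - D * x) / D + w * (y - D * x) := by
    field_simp; ring
  rw [h1]
  refine (norm_add₃_le).trans ?_
  rw [norm_mul, norm_div, norm_mul, norm_mul, Complex.norm_real, Real.norm_of_nonneg hD.le]
  have h2 : ‖u - D * w‖ * ‖x‖ ≤ ε * M := by gcongr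
  have h3 : ‖u - D * w‖ * ‖y - D * x‖ / D ≤ E := by
    rw [div_le_iff₀ hD]
    calc _ ≤ D * E := by gcongr; exact hu.trans hε
      _ = _ := by ring
  have h4 : ‖w‖ * ‖y - D * x‖ ≤ E := by
    calc _ ≤ 1 * E := by gcongr
      _ = _ := by ring
  linarith

lemma Approx.mono {D B X Y : ℕ} {E E' : ℝ} {z : ℂ} (h : Approx D B E X Y z) (hE : E ≤ E') :
    Approx D B E' X Y z := h.trans hE

/-- Common part of the three arithmetic operations: `z` is the exact result of the operation on the
stored numbers, and the stored result is obtained from it by rounding down. The stored result has the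
form `(P - Q) / D` with `Q ≤ P`, all negative terms being collected in `Q`, so that the truncated
subtraction of natural numbers is exact. -/
lemma approx_of_round {D B P Q P' Q' : ℕ} (hD : 0 < D) {z x : ℂ} {E E' M : ℝ}
    (h : (P : ℝ) - Q = D * (z.re + B)) (h' : (P' : ℝ) - Q' = D * (z.im + B))
    (hz : ‖z - D * x‖ ≤ E) (hx : ‖x‖ ≤ M) (hE' : E + 2 ≤ E') (hB : D * M + E ≤ B) :
    Approx D B E' ((P - Q) / D) ((P' - Q') / D) x ∧ (P - Q) / D ≤ 2 * B ∧
      (P' - Q') / D ≤ 2 * B := by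
  have hzB : ‖z‖ ≤ B := by
    have h1 : ‖z‖ ≤ ‖z - D * x‖ + ‖(D : ℂ) * x‖ := by
      simpa using norm_add_le (z - D * x) (D * x)
    rw [norm_mul, Complex.norm_natCast] at h1
    have : (D : ℝ) * ‖x‖ ≤ D * M := by gcongr
    linarith
  obtain ⟨h1, h2, h3⟩ := val_round hD h h' hzB
  refine ⟨?_, h2, h3⟩
  have : val B ((P - Q) / D) ((P' - Q') / D) - D * x =
      (val B ((P - Q) / D) ((P' - Q') / D) - z) + (z - D * x) := by ring
  unfold Approx
  rw [this]
  refine (norm_add_le _ _).trans ?_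
  linarith

/-- Multiplication by a number `ζ` that is stored without offset. -/
lemma Approx.twiddle {D B X Y c s : ℕ} (hD : 0 < D) {w ζ : ℂ} {E E' δ : ℝ}
    (h : Approx D B E X Y w) (hζ : ‖(⟨c, s⟩ : ℂ) - D * ζ‖ ≤ δ) (hw : ‖w‖ ≤ 1) (hζ1 : ‖ζ‖ ≤ 1)
    (hδ : E ≤ D) (hE' : E + 2 * δ + 2 ≤ E') (hB : D + (E + 2 * δ) ≤ B) :
    Approx D B E' ((X * c + B * s + B * D - (Y * s + B * c)) / D)
      ((X * s + Y * c + B * D - (B * s + B * c)) / D) (w * ζ) ∧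
      (X * c + B * s + B * D - (Y * s + B * c)) / D ≤ 2 * B ∧
      (X * s + Y * c + B * D - (B * s + B * c)) / D ≤ 2 * B := by
  have hD' : (0 : ℝ) < D := by exact_mod_cast hD
  refine approx_of_round hD (z := val B X Y * ⟨c, s⟩ / (D : ℝ)) (M := 1) (E := E + 2 * δ)
    ?_ ?_ ?_ ?_ hE' (by linarith)
  · rw [Complex.div_ofReal_re]
    simp only [val, Complex.mul_re]
    push_cast; field_simp; ring
  · rw [Complex.div_ofReal_im]
    simp only [val, Complex.mul_im]
    push_cast; field_simp; ring
  · have := norm_mul_div_sub_le hD' (u := val B X Y) (by simpa [Approx] using h) (by simpa using hζ)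
      hw hζ1 hδ
    rw [mul_one] at this
    simpa using this
  · rw [norm_mul]; exact mul_le_one₀ hw (norm_nonneg _) hζ1

/-- The operation `x + w * y` of the fast Fourier transform. -/
lemma Approx.butterfly {D B X X' Y Y' W W' : ℕ} (hD : 0 < D) {x y w : ℂ} {E E' ε M : ℝ}
    (hX : Approx D B E X X' x) (hY : Approx D B E Y Y' y) (hW : Approx D B ε W W' w) (hw : ‖w‖ ≤ 1)
    (hy : ‖y‖ ≤ M) (hxy : ‖x + w * y‖ ≤ M) (hε : ε ≤ D) (hE' : 3 * E + ε * M + 2 ≤ E')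
    (hB : D * M + (3 * E + ε * M) ≤ B) :
    Approx D B E' ((X * D + W * Y + B * (W' + Y') - (W' * Y' + B * (W + Y))) / D)
      ((X' * D + W * Y' + W' * Y + 2 * B * B - B * (W + W' + Y + Y')) / D) (x + w * y) ∧
      (X * D + W * Y + B * (W' + Y') - (W' * Y' + B * (W + Y))) / D ≤ 2 * B ∧
      (X' * D + W * Y' + W' * Y + 2 * B * B - B * (W + W' + Y + Y')) / D ≤ 2 * B := by
  have hD' : (0 : ℝ) < D := by exact_mod_cast hD
  refine approx_of_round hD (z := val B X X' + val B W W' * val B Y Y' / (D : ℝ)) (M := M)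
    (E := 3 * E + ε * M) ?_ ?_ ?_ hxy hE' hB
  · rw [Complex.add_re, Complex.div_ofReal_re]
    simp only [val, Complex.mul_re]
    push_cast; field_simp; ring
  · rw [Complex.add_im, Complex.div_ofReal_im]
    simp only [val, Complex.mul_im]
    push_cast; field_simp; ring
  · have h1 := norm_mul_div_sub_le hD' (u := val B W W') (by simpa [Approx] using hW)
      (y := val B Y Y') (by simpa [Approx] using hY) hw hy hε
    have h2 : val B X X' + val B W W' * val B Y Y' / (D : ℝ) - D * (x + w * y) =
        (val B X X' - D * x) + (val B W W' * val B Y Y' / (D : ℝ) - D * (w * y)) := by ring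
    rw [h2]
    refine (norm_add_le _ _).trans ?_
    have h3 : ‖val B X X' - D * x‖ ≤ E := hX
    simp only [Complex.ofReal_natCast] at h1 ⊢
    linarith

lemma Approx.square {D B X Y : ℕ} (hD : 0 < D) {x : ℂ} {E E' M : ℝ}
    (h : Approx D B E X Y x) (hx : ‖x‖ ≤ M) (hE : E ≤ D) (hE' : E * (2 * M + 1) + 2 ≤ E')
    (hB : D * M ^ 2 + E * (2 * M + 1) ≤ B) :
    Approx D B E' ((X * X + 2 * B * Y + B * D - (Y * Y + 2 * B * X)) / D)
      ((2 * X * Y + 2 * B * B + B * D - 2 * B * (X + Y)) / D) (x * x) ∧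
      (X * X + 2 * B * Y + B * D - (Y * Y + 2 * B * X)) / D ≤ 2 * B ∧
      (2 * X * Y + 2 * B * B + B * D - 2 * B * (X + Y)) / D ≤ 2 * B := by
  have hD' : (0 : ℝ) < D := by exact_mod_cast hD
  have hE0 : 0 ≤ E := (norm_nonneg _).trans h
  refine approx_of_round hD (z := val B X Y * val B X Y / (D : ℝ)) (M := M ^ 2)
    (E := E * (2 * M + 1)) ?_ ?_ ?_ ?_ hE' hB
  · rw [Complex.div_ofReal_re]
    simp only [val, Complex.mul_re]
    push_cast; field_simp; ring
  · rw [Complex.div_ofReal_im]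
    simp only [val, Complex.mul_im]
    push_cast; field_simp; ring
  · have hDc : ((D : ℝ) : ℂ) ≠ 0 := by exact_mod_cast hD'.ne'
    have h1 : val B X Y * val B X Y / (D : ℝ) - D * (x * x) = (val B X Y - D * x) * (2 * x) +
        (val B X Y - D * x) * (val B X Y - D * x) / (D : ℝ) := by
      simp only [Complex.ofReal_natCast] at *
      field_simp; ring
    have h' : ‖val B X Y - D * x‖ ≤ E := h
    rw [h1]
    refine (norm_add_le _ _).trans ?_
    rw [norm_mul, norm_div, norm_mul, norm_mul, Complex.norm_real, Real.norm_of_nonneg hD'.le]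
    have h2 : ‖val B X Y - D * x‖ * (‖(2 : ℂ)‖ * ‖x‖) ≤ E * (2 * M) := by
      rw [Complex.norm_ofNat]; gcongr
    have h3 : ‖val B X Y - D * x‖ * ‖val B X Y - D * x‖ / D ≤ E := by
      rw [div_le_iff₀ hD']
      exact mul_le_mul h' (h'.trans hE) (norm_nonneg _) hE0
    linarith
  · have := (norm_nonneg x).trans hx
    rw [norm_mul, sq]; gcongr

/-- One halving of the angle. The pair `c, s` approximates `D cos (2 θ), D sin (2 θ)`, and `c'` is the
integer square root of `D (D + c) / 2`. -/
lemma half_angle {D c s c' : ℕ} {θ e : ℝ} (hD : 2 ≤ D) (hD2 : 2 ∣ D) (h0 : 0 ≤ θ)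
    (h1 : θ ≤ Real.pi / 4) (hc : |(c : ℝ) - D * Real.cos (2 * θ)| ≤ e)
    (hs : |(s : ℝ) - D * Real.sin (2 * θ)| ≤ e) (hc' : c' * c' ≤ D * (D + c) / 2)
    (hc'' : D * (D + c) / 2 < (c' + 1) * (c' + 1)) :
    |(c' : ℝ) - D * Real.cos θ| ≤ 3 * e + 3 ∧
      |((D * s / (2 * c') : ℕ) : ℝ) - D * Real.sin θ| ≤ 3 * e + 3 := by
  obtain ⟨H, rfl⟩ := hD2
  have hH : 1 ≤ H := by omega
  have hH' : (1 : ℝ) ≤ H := by exact_mod_cast hH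
  have he : 0 ≤ e := (abs_nonneg _).trans hc
  rw [show 2 * H * (2 * H + c) / 2 = H * (2 * H + c) by
    rw [mul_assoc]; exact Nat.mul_div_cancel_left _ (by norm_num)] at hc' hc''
  have hHc : H ≤ c' := by
    by_contra! hlt
    have : (c' + 1) * (c' + 1) ≤ H * H := Nat.mul_le_mul hlt hlt
    have h2 : H * H ≤ H * (2 * H + c) := Nat.mul_le_mul_left _ (by omega)
    omega
  have hcos2 : Real.cos (2 * θ) = 2 * Real.cos θ ^ 2 - 1 := Real.cos_two_mul θ
  have hsin2 : Real.sin (2 * θ) = 2 * Real.sin θ * Real.cos θ := Real.sin_two_mul θ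
  have hcos : 1 / 2 ≤ Real.cos θ := by
    have : Real.cos (Real.pi / 3) ≤ Real.cos θ :=
      Real.cos_le_cos_of_nonneg_of_le_pi h0 (by linarith [Real.pi_pos]) (by linarith [Real.pi_pos])
    rwa [Real.cos_pi_div_three] at this
  have hsin0 : 0 ≤ Real.sin θ := Real.sin_nonneg_of_nonneg_of_le_pi h0 (by linarith [Real.pi_pos])
  have hsin1 : Real.sin θ ≤ 1 := Real.sin_le_one θ
  push_cast at hc hs ⊢
  set C := Real.cos θ
  set S := Real.sin θ
  have hc1 : ((c' : ℝ)) * c' ≤ H * (2 * H + c) := by exact_mod_cast hc'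
  have hc2 : (H : ℝ) * (2 * H + c) < (c' + 1) * (c' + 1) := by exact_mod_cast hc''
  have hHc' : (H : ℝ) ≤ c' := by exact_mod_cast hHc
  rw [hcos2] at hc
  rw [hsin2] at hs
  rw [abs_le] at hc hs
  -- `D C` is at least `H = D / 2`, so a square root of something close to `(D C)²` is close to `D C`.
  have hHC : (H : ℝ) ≤ 2 * H * C := by nlinarith
  have hk1 : (c' : ℝ) - 2 * H * C ≤ e + 1 := by
    by_contra! hlt
    have : (2 * H * C + e) * (2 * H * C + e) < c' * c' := by
      apply mul_self_lt_mul_self <;> nlinarith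
    nlinarith
  have hk2 : -(e + 1) ≤ (c' : ℝ) - 2 * H * C := by
    by_contra! hlt
    have : ((c' : ℝ) + 1) * (c' + 1) < (2 * H * C - e) * (2 * H * C - e) := by
      apply mul_self_lt_mul_self <;> linarith
    nlinarith
  refine ⟨by rw [abs_le]; constructor <;> linarith, ?_⟩
  have hc'0 : (0 : ℝ) < c' := by linarith
  have hq1 : ((2 * H * s / (2 * c') : ℕ) : ℝ) ≤ (2 * H * s) / (2 * c') := by
    have := @Nat.cast_div_le ℝ _ _ _ (2 * H * s) (2 * c')
    push_cast at this
    exact this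
  have hq2 : ((2 * H * s) / (2 * c') : ℝ) < ((2 * H * s / (2 * c') : ℕ) : ℝ) + 1 := by
    rw [div_lt_iff₀ (by positivity)]
    exact_mod_cast Nat.lt_mul_of_div_lt (Nat.lt_succ_self (2 * H * s / (2 * c'))) (by omega)
  have hr1 : ((2 * H * s) / (2 * c') : ℝ) ≤ 2 * H * S + (3 * e + 2) := by
    rw [div_le_iff₀ (by positivity)]
    nlinarith [mul_nonneg hsin0 (show (0 : ℝ) ≤ e + 1 by linarith),
      mul_nonneg (show (0 : ℝ) ≤ 1 - S by linarith) (show (0 : ℝ) ≤ e + 1 by linarith),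
      mul_nonneg (show (0 : ℝ) ≤ c' - H by linarith) (show (0 : ℝ) ≤ 3 * e + 2 by linarith),
      mul_nonneg (mul_nonneg (show (0 : ℝ) ≤ H by linarith) hsin0)
        (show (0 : ℝ) ≤ e + 1 + (c' - 2 * H * C) by linarith),
      mul_nonneg (show (0 : ℝ) ≤ H by linarith)
        (mul_nonneg (show (0 : ℝ) ≤ 1 - S by linarith) (show (0 : ℝ) ≤ e + 1 by linarith)),
      mul_nonneg (show (0 : ℝ) ≤ H by linarith)
        (show (0 : ℝ) ≤ e - (s - 2 * H * (2 * S * C)) by linarith)]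
  have hr2 : 2 * H * S - (3 * e + 2) ≤ ((2 * H * s) / (2 * c') : ℝ) := by
    rw [le_div_iff₀ (by positivity)]
    nlinarith [mul_nonneg (show (0 : ℝ) ≤ c' - H by linarith) (show (0 : ℝ) ≤ 3 * e + 2 by linarith),
      mul_nonneg (mul_nonneg (show (0 : ℝ) ≤ H by linarith) hsin0)
        (show (0 : ℝ) ≤ e + 1 - (c' - 2 * H * C) by linarith),
      mul_nonneg (show (0 : ℝ) ≤ H by linarith)
        (mul_nonneg (show (0 : ℝ) ≤ 1 - S by linarith) (show (0 : ℝ) ≤ e + 1 by linarith)),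
      mul_nonneg (show (0 : ℝ) ≤ H by linarith)
        (show (0 : ℝ) ≤ e + (s - 2 * H * (2 * S * C)) by linarith)]
  rw [abs_le]
  constructor <;> linarith

end FixedPoint

/-! ### The discrete Fourier transform -/

namespace DFT

open Finset

/-- The intermediate results of the radix-two transform of `c` of length `N`. For `H = N` this is `c`
itself, for `H = 1` it is the discrete Fourier transform; in between, position `i` holds the value at
`ω ^ (H * (i / H))` of the polynomial whose coefficients are the `c k` with `k ≡ i` modulo `H`. -/
noncomputable def level (ω : ℂ) (c : ℕ → ℂ) (N H i : ℕ) : ℂ :=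
  ∑ k ∈ range (N / H), c (k * H + i % H) * ω ^ (H * (i / H) * k)

variable {ω : ℂ} {c : ℕ → ℂ} {N : ℕ}

lemma level_self {i : ℕ} (hi : i < N) : level ω c N N i = c i := by
  simp [level, Nat.div_self (show 0 < N by omega), Nat.mod_eq_of_lt hi]

lemma level_one (i : ℕ) : level ω c N 1 i = ∑ k ∈ range N, c k * ω ^ (i * k) := by
  simp [level, Nat.mod_one]

lemma norm_level_le (hω : ‖ω‖ = 1) {M : ℝ} (hM : ∀ k < N, ‖c k‖ ≤ M) {H : ℕ} (hH : H ∣ N)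
    (hH0 : 0 < H) (i : ℕ) : ‖level ω c N H i‖ ≤ N * M := by
  rcases Nat.eq_zero_or_pos N with rfl | hN
  · simp [level]
  have hM0 : 0 ≤ M := (norm_nonneg _).trans (hM 0 hN)
  refine (norm_sum_le _ _).trans ?_
  have : ∀ k ∈ range (N / H), ‖c (k * H + i % H) * ω ^ (H * (i / H) * k)‖ ≤ M := by
    intro k hk
    rw [norm_mul, norm_pow, hω, one_pow, mul_one]
    refine hM _ ?_
    obtain ⟨q, rfl⟩ := hH
    rw [mem_range, Nat.mul_div_cancel_left _ hH0] at hk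
    have := Nat.mod_lt i hH0
    nlinarith
  refine (sum_le_sum this).trans ?_
  rw [sum_const, card_range, nsmul_eq_mul]
  gcongr
  exact Nat.div_le_self _ _

lemma sum_range_mul_two (f : ℕ → ℂ) (n : ℕ) :
    ∑ k ∈ range (n * 2), f k = ∑ k ∈ range n, (f (2 * k) + f (2 * k + 1)) := by
  induction n with
  | zero => simp
  | succ n ih =>
    rw [sum_range_succ, ← ih, add_mul, one_mul, sum_range_succ, sum_range_succ, mul_comm n 2,
      add_assoc]

/-- The butterfly: the even and the odd coefficients of a residue class modulo `H` form two residue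
classes modulo `2 H`. -/
lemma level_step (hω : ω ^ N = 1) {H i : ℕ} (hH : 2 * H ∣ N) (hH0 : 0 < H) :
    level ω c N H i = level ω c N (2 * H) ((2 * (i - i % H) + i % H) % N) +
      ω ^ (i - i % H) * level ω c N (2 * H) ((2 * (i - i % H) + i % H) % N + H) := by
  obtain ⟨q, rfl⟩ := hH
  have hr := Nat.mod_lt i hH0
  have hij : i - i % H = H * (i / H) := by
    have := Nat.mod_add_div i H
    omega
  rw [level, level, level]
  generalize i % H = r at *
  generalize i / H = j at *
  have hidx : (2 * (i - r) + r) % (2 * H * q) = 2 * H * (j % q) + r := by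
    rw [hij]
    rcases Nat.eq_zero_or_pos q with rfl | hq
    · simp; ring
    have h1 : 2 * (H * j) + r = (2 * H * (j % q) + r) + 2 * H * q * (j / q) := by
      conv_lhs => rw [← Nat.mod_add_div j q]
      ring
    rw [h1, Nat.add_mul_mod_self_left, Nat.mod_eq_of_lt]
    have := Nat.mod_lt j hq
    nlinarith
  have hpow : ∀ k, ω ^ (2 * H * (j % q) * k) = ω ^ (2 * H * j * k) := by
    intro k
    have h1 : 2 * H * j * k = 2 * H * (j % q) * k + (2 * H * q) * (j / q * k) := by
      conv_lhs => rw [← Nat.mod_add_div j q]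
      ring
    rw [h1, pow_add, pow_mul ω (2 * H * q), hω, one_pow, mul_one]
  have hd1 : (2 * H * (j % q) + r) / (2 * H) = j % q := by
    rw [Nat.mul_add_div (by omega), Nat.div_eq_of_lt (by omega), add_zero]
  have hm1 : (2 * H * (j % q) + r) % (2 * H) = r := by
    rw [Nat.mul_add_mod, Nat.mod_eq_of_lt (by omega)]
  have hd2 : (2 * H * (j % q) + r + H) / (2 * H) = j % q := by
    rw [add_assoc, Nat.mul_add_div (by omega), Nat.div_eq_of_lt (by omega), add_zero]
  have hm2 : (2 * H * (j % q) + r + H) % (2 * H) = r + H := by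
    rw [add_assoc, Nat.mul_add_mod, Nat.mod_eq_of_lt (by omega)]
  rw [hidx, hd1, hm1, hd2, hm2, hij, Nat.mul_div_cancel_left q (by omega),
    show 2 * H * q / H = q * 2 by
      rw [show 2 * H * q = H * (q * 2) by ring, Nat.mul_div_cancel_left _ hH0],
    sum_range_mul_two, sum_add_distrib, mul_sum]
  congr 1
  · refine sum_congr rfl fun k _ => ?_
    rw [hpow]
    congr 2 <;> ring
  · refine sum_congr rfl fun k _ => ?_
    rw [hpow, mul_left_comm, ← pow_add]
    congr 2 <;> ring

lemma sum_pow_mul (hω : IsPrimitiveRoot ω N) (t : ℕ) :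
    ∑ i ∈ range N, ω ^ (i * t) = if N ∣ t then (N : ℂ) else 0 := by
  have h1 : ∀ i, ω ^ (i * t) = (ω ^ t) ^ i := fun i => by rw [← pow_mul, mul_comm]
  simp only [h1]
  split_ifs with h
  · simp [(hω.pow_eq_one_iff_dvd t).2 h]
  · have hne : ω ^ t ≠ 1 := fun h' => h ((hω.pow_eq_one_iff_dvd t).1 h')
    rw [geom_sum_eq hne, ← pow_mul, mul_comm, pow_mul, hω.pow_eq_one, one_pow, sub_self, zero_div]

/-- Transforming, squaring and transforming again gives the cyclic convolution square, read
backwards and multiplied by `N`. -/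
lemma level_square (hω : IsPrimitiveRoot ω N) (l : ℕ) :
    level ω (fun i => level ω c N 1 i * level ω c N 1 i) N 1 l =
      N * ∑ p ∈ range N ×ˢ range N, if N ∣ p.1 + p.2 + l then c p.1 * c p.2 else 0 := by
  simp only [level_one]
  have h1 : ∀ k, (∑ i ∈ range N, c i * ω ^ (k * i)) * (∑ i ∈ range N, c i * ω ^ (k * i)) *
      ω ^ (l * k) = ∑ p ∈ range N ×ˢ range N, c p.1 * c p.2 * ω ^ (k * (p.1 + p.2 + l)) := by
    intro k
    rw [sum_mul_sum, sum_product, sum_mul]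
    refine sum_congr rfl fun i _ => ?_
    rw [sum_mul]
    refine sum_congr rfl fun j _ => ?_
    rw [mul_add, mul_add, pow_add, pow_add, mul_comm l k]
    ring
  simp only [h1]
  rw [sum_comm, mul_sum]
  refine sum_congr rfl fun p _ => ?_
  rw [← mul_sum, sum_pow_mul hω]
  split_ifs <;> ring

/-- If the real and imaginary parts of `c` are the indicators `x` and `y` of two sets of numbers below
`len`, the imaginary part of the convolution square of `c` shows which numbers are sums of an element
of each. -/
lemma im_level_square (hω : IsPrimitiveRoot ω N) {x y : ℕ → ℕ} {len k : ℕ}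
    (hx : ∀ i < N, len ≤ i → x i = 0) (hy : ∀ i < N, len ≤ i → y i = 0) (hlen : 2 * len ≤ N)
    (hk : k < N) (hc : c = fun i => ⟨x i, y i⟩) :
    ((∃ p q, p < len ∧ q < len ∧ x p ≠ 0 ∧ y q ≠ 0 ∧ p + q = k) →
      (N : ℝ) ≤ (level ω (fun i => level ω c N 1 i * level ω c N 1 i) N 1 ((N - k) % N)).im) ∧
    ((¬∃ p q, p < len ∧ q < len ∧ x p ≠ 0 ∧ y q ≠ 0 ∧ p + q = k) →
      (level ω (fun i => level ω c N 1 i * level ω c N 1 i) N 1 ((N - k) % N)).im = 0) := by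
  have him : (level ω (fun i => level ω c N 1 i * level ω c N 1 i) N 1 ((N - k) % N)).im =
      N * ∑ p ∈ range N ×ˢ range N, if N ∣ p.1 + p.2 + (N - k) % N then
        (x p.1 * y p.2 + y p.1 * x p.2 : ℝ) else 0 := by
    rw [level_square hω, ← Complex.ofReal_natCast, Complex.im_ofReal_mul, Complex.im_sum]
    congr 1
    refine sum_congr rfl fun p _ => ?_
    split_ifs <;> simp [hc]
  have hpos : ∀ p : ℕ × ℕ, (0 : ℝ) ≤ if N ∣ p.1 + p.2 + (N - k) % N then
      (x p.1 * y p.2 + y p.1 * x p.2 : ℝ) else 0 := by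
    intro p
    split_ifs <;> positivity
  rw [him]
  constructor
  · rintro ⟨p, q, hp, hq, hxp, hyq, hpq⟩
    have h1 := single_le_sum (f := fun p : ℕ × ℕ => if N ∣ p.1 + p.2 + (N - k) % N then
      (x p.1 * y p.2 + y p.1 * x p.2 : ℝ) else 0) (s := range N ×ˢ range N) (fun p _ => hpos p)
      (mem_product.2 ⟨mem_range.2 (show (p, q).1 < N by simp only; omega),
        mem_range.2 (show (p, q).2 < N by simp only; omega)⟩)
    have hdvd : N ∣ p + q + (N - k) % N := by
      rw [Nat.dvd_iff_mod_eq_zero, hpq, Nat.add_mod_mod, Nat.add_sub_cancel' hk.le, Nat.mod_self]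
    simp only [if_pos hdvd] at h1
    have h2 : (1 : ℝ) ≤ x p := by exact_mod_cast Nat.one_le_iff_ne_zero.2 hxp
    have h3 : (1 : ℝ) ≤ y q := by exact_mod_cast Nat.one_le_iff_ne_zero.2 hyq
    have h4 : (1 : ℝ) ≤ x p * y q := by nlinarith
    have h5 : (0 : ℝ) ≤ y p * x q := by positivity
    nlinarith [show (0 : ℝ) ≤ N from Nat.cast_nonneg N]
  · intro hne
    rw [sum_eq_zero, mul_zero]
    rintro ⟨p, q⟩ hpq
    simp only [mem_product, mem_range] at hpq
    split_ifs with hd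
    · have hk' : p < len → q < len → p + q = k := by
        intro hp hq
        rw [Nat.dvd_iff_mod_eq_zero, Nat.add_mod_mod] at hd
        obtain ⟨d, hd⟩ := Nat.dvd_of_mod_eq_zero hd
        rcases Nat.lt_or_ge d 1 with h | h
        · have : d = 0 := by omega
          subst this; omega
        rcases Nat.lt_or_ge d 2 with h | h
        · have : d = 1 := by omega
          subst this; omega
        · have := Nat.mul_le_mul_left N h
          omega
      have hz : ∀ p q, p < N → q < N → (p < len → q < len → p + q = k) → x p * y q = 0 := by
        intro p q hp hq h
        by_contra h0
        have h1 : x p ≠ 0 := fun h => h0 (by simp [h])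
        have h2 : y q ≠ 0 := fun h => h0 (by simp [h])
        have h3 : p < len := by
          by_contra h3
          exact h1 (hx p hp (by omega))
        have h4 : q < len := by
          by_contra h4
          exact h2 (hy q hq (by omega))
        exact hne ⟨p, q, h3, h4, h1, h2, h h3 h4⟩
      have h1 := hz p q hpq.1 hpq.2 hk'
      have h2 := hz q p hpq.2 hpq.1 (fun h h' => by rw [add_comm]; exact hk' h' h)
      have h3 : (x p * y q + y p * x q : ℕ) = 0 := by rw [h1, mul_comm, h2]
      exact_mod_cast h3
    · rfl

end DFT

/-! ### The fixed-point transform on the word RAM -/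

namespace WordRAM

open FixedPoint
open WordRAM.Expr (reg load)

infix:62 " ≔ " => Program.assign

/-- Registers outside `[lo, hi)` have the same contents. -/
def SameReg (lo hi : ℕ) (s s' : State) : Prop := ∀ r, r < lo ∨ hi ≤ r → s'.reg r = s.reg r

lemma SameReg.refl (lo hi : ℕ) (s : State) : SameReg lo hi s s := fun _ _ => rfl

lemma SameReg.trans {lo hi : ℕ} {s s' s'' : State} (h : SameReg lo hi s s')
    (h' : SameReg lo hi s' s'') : SameReg lo hi s s'' := fun r hr => (h' r hr).trans (h r hr)

lemma SameReg.mono {lo hi lo' hi' : ℕ} {s s' : State} (h : SameReg lo hi s s') (hlo : lo' ≤ lo)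
    (hhi : hi ≤ hi') : SameReg lo' hi' s s' := fun r hr => h r (by omega)

lemma SameReg.set {lo hi : ℕ} {s s' : State} (h : SameReg lo hi s s') {r x : ℕ} (hr : lo ≤ r)
    (hr' : r < hi) : SameReg lo hi s (s'.set r x) := fun r' hr'' => by
  rw [State.set_reg, if_neg (by omega), h r' hr'']

lemma SameReg.put {lo hi : ℕ} {s s' : State} (h : SameReg lo hi s s') {a x : ℕ} :
    SameReg lo hi s (s'.put a x) := h

/-- Register `21` becomes the integer square root of register `20`. Bits are determined from the top,
beginning with the power of two in register `10`. -/
def isqrt : Program :=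
  21 ≔ 0 ;; 22 ≔ reg 10 ;;
  .loop (reg 22)
    (.ite (.bin .lt (reg 20) ((reg 21 + reg 22) * (reg 21 + reg 22))) .nop
      (21 ≔ reg 21 + reg 22) ;;
    22 ≔ reg 22 / 2)

lemma run_isqrt {v L x : ℕ} {s : State} (hD : s.reg 10 = 2 ^ L) (hx : s.reg 20 = x)
    (hxD : x < 2 ^ (L + 1) * 2 ^ (L + 1)) (hL : 2 ^ (2 * L + 2) ≤ 2 ^ v) :
    Run v isqrt s (30 * L + 60) (fun s' => s'.mem = s.mem ∧ SameReg 20 23 s s' ∧ s'.reg 20 = x ∧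
      s'.reg 21 * s'.reg 21 ≤ x ∧ x < (s'.reg 21 + 1) * (s'.reg 21 + 1)) := by
  have hpow : 2 ^ (2 * L + 2) = 2 ^ (L + 1) * 2 ^ (L + 1) := by rw [← pow_add]; congr 1; ring
  have hp1 : 1 ≤ 2 ^ (L + 1) := Nat.one_le_two_pow
  have hsmall : ∀ y, y * y ≤ x → y < 2 ^ (L + 1) := by
    intro y hy
    by_contra! h
    have := Nat.mul_le_mul h h
    omega
  have hlt : 2 ^ (L + 1) ≤ 2 ^ v := by nlinarith
  let I : ℕ → State → Prop := fun k s' => s'.mem = s.mem ∧ SameReg 20 23 s s' ∧ s'.reg 20 = x ∧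
    s'.reg 21 * s'.reg 21 ≤ x ∧ x < (s'.reg 21 + 2 ^ k) * (s'.reg 21 + 2 ^ k) ∧
    s'.reg 22 = 2 ^ k / 2
  refine Run.seq (T₁ := 2) (T₂ := 30 * L + 58)
    (R := fun s' => s' = s.set 21 0)
    (Run.flat (fun _ => ⟨by simp, rfl⟩) le_rfl) ?_ (by omega)
  rintro s' - rfl
  refine Run.seq (T₁ := 2) (T₂ := 30 * L + 56) (R := I (L + 1))
    (Run.flat (fun hB => ⟨hB.reg 10, ?_⟩) le_rfl) ?_ (by omega)
  · refine ⟨rfl, ((SameReg.refl _ _ _).set (by omega) (by omega)).set (by omega) (by omega), ?_⟩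
    rw [pow_succ] at hxD
    simp [hx, hD, hxD, pow_succ]
  rintro s' - hI
  refine Run.loop I (fun k => 20 * k + 2) ?_ ?_ (L + 1) s' hI (by omega)
  · rintro k s1 - ⟨h1, h2, h3, h4, h5, h6⟩ h0
    have hk : k = 0 := by
      rw [Expr.eval_reg, h6] at h0
      rcases k with _ | k
      · rfl
      · rw [pow_succ, Nat.mul_div_cancel _ (by norm_num)] at h0
        exact absurd h0 (by positivity)
    subst hk
    exact ⟨⟨h1, h2, h3, h4, by simpa using h5⟩, le_rfl⟩
  · rintro k s1 hB ⟨h1, h2, h3, h4, h5, h6⟩ h0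
    refine ⟨18, Run.flat (fun _ => ?_) le_rfl⟩
    rcases k with _ | k
    · simp [h6] at h0
    rw [pow_succ, Nat.mul_div_cancel _ (by norm_num)] at h6
    have hle : s1.reg 22 / 2 < 2 ^ v := (Nat.div_le_self _ _).trans_lt (hB.reg _)
    constructor
    · intro hc
      refine ⟨by simpa using hle, k, ?_, by simp [Expr.cost]; omega⟩
      have : x < (s1.reg 21 + s1.reg 22) * (s1.reg 21 + s1.reg 22) := by
        by_contra h
        simp [h3, h] at hc
      refine ⟨h1, h2.set (by omega) (by omega), by simpa using h3, by simpa using h4, ?_, ?_⟩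
      · simpa [h6] using this
      · simp [h6]
    · intro hc
      have hle' : (s1.reg 21 + s1.reg 22) * (s1.reg 21 + s1.reg 22) ≤ x := by
        by_contra h
        simp [h3, not_le.1 h] at hc
      refine ⟨by simpa using (hsmall _ hle').trans_le hlt, by simpa using hle, k, ?_,
        by simp [Expr.cost]; omega⟩
      refine ⟨h1, (h2.set (by omega) (by omega)).set (by omega) (by omega), by simpa using h3,
        by simpa using hle', ?_, ?_⟩
      · simp only [State.set_reg]
        simp only [Expr.eval_add, Expr.eval_reg, h6]
        rw [pow_succ] at h5
        simp only [reduceIte, Nat.reduceEqDiff]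
        convert h5 using 2 <;> ring
      · simp [h6]

end WordRAM

namespace WordRAM
open FixedPoint
open WordRAM.Expr (reg load)

/-- Numerical side conditions of a transform of length `N = 2 ^ K`: the stride `M` of the memory
regions is at least `N`, and the cells are large enough for the fixed-point numbers. -/
structure Params (v M N K : ℕ) : Prop where
  N_eq : N = 2 ^ K
  three_le : 3 ≤ K
  N_le : N ≤ M
  M_lt : 8 * M < 2 ^ v
  N_pow : N ^ 40 < 2 ^ v

/-- Register `2` holds the stride of the memory regions, register `3` the length of the transform,
register `10` the scale and register `11` the offset of the fixed-point numbers. -/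
structure Consts (M N : ℕ) (s : State) : Prop where
  hM : s.reg 2 = M
  hN : s.reg 3 = N
  hD : s.reg 10 = N ^ 16
  hB : s.reg 11 = N ^ 20

lemma Consts.of_sameReg {M N lo hi : ℕ} {s s' : State} (h : Consts M N s) (hs : SameReg lo hi s s')
    (hlo : 12 ≤ lo) : Consts M N s' :=
  ⟨by rw [hs _ (by omega), h.hM], by rw [hs _ (by omega), h.hN], by rw [hs _ (by omega), h.hD],
    by rw [hs _ (by omega), h.hB]⟩

lemma Params.eight_le {v M N K : ℕ} (h : Params v M N K) : 8 ≤ N := by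
  rw [h.N_eq]
  calc 8 = 2 ^ 3 := rfl
    _ ≤ 2 ^ K := Nat.pow_le_pow_right (by norm_num) h.three_le

lemma Params.pow_lt {v M N K : ℕ} (h : Params v M N K) {k : ℕ} (hk : k ≤ 40) : N ^ k < 2 ^ v :=
  (Nat.pow_le_pow_right (by have := h.eight_le; omega) hk).trans_lt h.N_pow

/-- `exp (2 π i / N)` -/
noncomputable def root (N : ℕ) : ℂ := Complex.exp (2 * Real.pi * Complex.I / N)

lemma norm_root (N : ℕ) : ‖root N‖ = 1 := by
  have : root N = Complex.exp ((2 * Real.pi / N : ℝ) * Complex.I) := by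
    rw [root]; push_cast; congr 1; ring
  rw [this, Complex.norm_exp_ofReal_mul_I]

lemma root_eq (N : ℕ) : root N = ⟨Real.cos (2 * Real.pi / N), Real.sin (2 * Real.pi / N)⟩ := by
  have : root N = Complex.exp ((2 * Real.pi / N : ℝ) * Complex.I) := by
    rw [root]; push_cast; congr 1; ring
  rw [this, Complex.exp_mul_I, ← Complex.ofReal_cos, ← Complex.ofReal_sin]
  apply Complex.ext <;>
  · simp only [Complex.add_re, Complex.add_im, Complex.mul_re, Complex.mul_im, Complex.ofReal_re,
      Complex.ofReal_im, Complex.I_re, Complex.I_im]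
    ring

/-- Registers `12` and `13` become fixed-point approximations of the real and the imaginary part of
`root N`, by halving the angle `π / 2` repeatedly. -/
def rootProg : Program :=
  12 ≔ 0 ;; 13 ≔ reg 10 ;; 23 ≔ 4 ;;
  .loop (.bin .lt (reg 23) (reg 3))
    (20 ≔ reg 10 * (reg 10 + reg 12) / 2 ;;
    isqrt ;;
    12 ≔ reg 21 ;;
    13 ≔ reg 10 * reg 13 / (2 * reg 21) ;;
    23 ≔ 2 * reg 23)

lemma run_rootProg {v M N K : ℕ} (hp : Params v M N K) {s : State} (hc : Consts M N s) :
    Run v rootProg s (K * (480 * K + 200) + 20) (fun s' => s'.mem = s.mem ∧ SameReg 12 30 s s' ∧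
      ‖(⟨s'.reg 12, s'.reg 13⟩ : ℂ) - (N ^ 16 : ℕ) * root N‖ ≤ 2 * N ^ 2) := by
  have h8 := hp.eight_le
  have hNK := hp.N_eq
  set D := N ^ 16 with hD
  have hDK : D = 2 ^ (16 * K) := by rw [hD, hNK, ← pow_mul, mul_comm]
  have hD2 : 2 ∣ D := by
    rw [hDK]; exact dvd_pow_self 2 (by have := hp.three_le; omega)
  have hD8 : N ^ 2 + 8 ≤ D := by
    have : N ^ 3 ≤ D := Nat.pow_le_pow_right (by omega) (by norm_num)
    nlinarith
  have hDD : 2 * D * D < 2 ^ v := by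
    refine lt_of_le_of_lt ?_ (hp.pow_lt (show 33 ≤ 40 by norm_num))
    rw [hD, mul_assoc, ← pow_add, show 33 = 32 + 1 from rfl, pow_succ, mul_comm]
    exact Nat.mul_le_mul_left _ (by omega)
  have hsqrt : 2 ^ (2 * (16 * K) + 2) ≤ 2 ^ v := by
    refine le_trans ?_ (hp.pow_lt (show 33 ≤ 40 by norm_num)).le
    rw [hNK, ← pow_mul]
    exact Nat.pow_le_pow_right (by norm_num) (by have := hp.three_le; omega)
  let I : ℕ → State → Prop := fun k s' => s'.mem = s.mem ∧ SameReg 12 30 s s' ∧ 2 ≤ k ∧ k ≤ K ∧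
    s'.reg 23 = 2 ^ k ∧ s'.reg 12 ≤ D ∧
    |(s'.reg 12 : ℝ) - D * Real.cos (2 * Real.pi / 2 ^ k)| ≤ 4 ^ k ∧
    |(s'.reg 13 : ℝ) - D * Real.sin (2 * Real.pi / 2 ^ k)| ≤ 4 ^ k
  refine Run.seq (T₁ := 2) (T₂ := K * (480 * K + 200) + 18) (R := fun s' => s' = s.set 12 0)
    (Run.flat (fun _ => ⟨by simp, rfl⟩) (by decide)) ?_ (by omega)
  rintro s1 - rfl
  refine Run.seq (T₁ := 2) (T₂ := K * (480 * K + 200) + 16)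
    (R := fun s' => s' = (s.set 12 0).set 13 D)
    (Run.flat (fun hB => ⟨hB.reg 10, by simp [hc.hD, D]⟩) (by decide)) ?_ (by omega)
  rintro s1 - rfl
  refine Run.seq (T₁ := 2) (T₂ := K * (480 * K + 200) + 14) (R := I 2)
    (Run.flat (fun hB => ⟨?_, ?_⟩) (by decide)) ?_ (by omega)
  · have := hp.pow_lt (show 1 ≤ 40 by norm_num)
    rw [pow_one] at this
    simp; omega
  · refine ⟨rfl, (((SameReg.refl _ _ _).set (by omega) (by omega)).set (by omega) (by omega)).set
      (by omega) (by omega), le_rfl, by have := hp.three_le; omega, by simp, by simp, ?_, ?_⟩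
    · rw [show 2 * Real.pi / 2 ^ 2 = Real.pi / 2 by ring, Real.cos_pi_div_two]; simp
    · rw [show 2 * Real.pi / 2 ^ 2 = Real.pi / 2 by ring, Real.sin_pi_div_two]; simp
  rintro s1 - hI
  refine Run.loop I (fun k => (K - k) * (480 * K + 200) + 10) ?_ ?_ 2 s1 hI
    (by have := Nat.mul_le_mul_right (480 * K + 200) (Nat.sub_le K 2); omega)
  · rintro k s' - ⟨h1, h2, h3, h4, h5, h6, h7, h9⟩ h0
    have hk : k = K := by
      have hN' : s'.reg 3 = N := (h2 3 (by omega)).trans hc.hN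
      simp only [Expr.eval_lt, Expr.eval_reg, h5, hN', hNK] at h0
      by_contra hne
      rw [if_pos (Nat.pow_lt_pow_right (by norm_num) (by omega))] at h0
      omega
    subst hk
    refine ⟨⟨h1, h2, ?_⟩, by simp [Expr.cost]⟩
    have hNr : (N : ℝ) = 2 ^ k := by exact_mod_cast hNK
    have hN4 : (4 : ℝ) ^ k = N ^ 2 := by rw [hNr, ← pow_mul, mul_comm, pow_mul]; norm_num
    rw [root_eq, hNr]
    refine (Complex.norm_le_abs_re_add_abs_im _).trans ?_
    simp only [Complex.sub_re, Complex.sub_im, ← Complex.ofReal_natCast, Complex.re_ofReal_mul,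
      Complex.im_ofReal_mul]
    rw [← hNr]
    rw [hN4] at h7 h9
    rw [← hNr] at h7 h9
    linarith
  · rintro k s' hB' ⟨h1, h2, h3, h4, h5, h6, h7, h9⟩ h0
    have hN' : s'.reg 3 = N := (h2 3 (by omega)).trans hc.hN
    have hD' : s'.reg 10 = D := (h2 10 (by omega)).trans hc.hD
    have hk : k < K := by
      simp only [Expr.eval_lt, Expr.eval_reg, h5, hN', hNK] at h0
      by_contra hne
      exact h0 (if_neg (not_lt.2 (Nat.pow_le_pow_right (by norm_num) (by omega))))
    set c := s'.reg 12
    set q := s'.reg 13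
    have hxle : D * (D + c) / 2 ≤ D * D := by
      refine Nat.div_le_of_le_mul ?_
      nlinarith
    refine ⟨480 * K + 100, Run.seq (T₁ := 10) (T₂ := 480 * K + 90)
      (R := fun t => t = s'.set 20 (D * (D + c) / 2))
      (Run.flat (fun _ => ⟨?_, by simp [hD', c]⟩) (by decide)) ?_ (by omega)⟩
    · simp only [Expr.eval_div, Expr.eval_mul, Expr.eval_add, Expr.eval_reg, hD', Expr.eval_const]
      change D * (D + c) / 2 < 2 ^ v
      nlinarith
    rintro t - rfl
    refine Run.seq (T₂ := 30) (run_isqrt (L := 16 * K) (x := D * (D + c) / 2) ?_ (by simp) ?_ hsqrt)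
      ?_ (by omega)
    · simp [hD', hDK]
    · rw [pow_succ, ← hDK]
      nlinarith
    rintro t hBt ⟨g1, g2, g3, g4, g5⟩
    have e12 : t.reg 12 = c := by rw [g2 12 (by omega)]; simp [c]
    have e13 : t.reg 13 = q := by rw [g2 13 (by omega)]; simp [q]
    have e10 : t.reg 10 = D := by rw [g2 10 (by omega)]; simp [hD']
    have e23 : t.reg 23 = 2 ^ k := by rw [g2 23 (by omega)]; simpa using h5
    have hx' : t.reg 21 ≤ D := by
      by_contra! hlt
      have := Nat.mul_self_lt_mul_self hlt
      omega
    have hθ0 : 0 ≤ 2 * Real.pi / 2 ^ (k + 1) := by positivity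
    have hθ1 : 2 * Real.pi / 2 ^ (k + 1) ≤ Real.pi / 4 := by
      rw [div_le_div_iff₀ (by positivity) (by norm_num)]
      have : (2 : ℝ) ^ 3 ≤ 2 ^ (k + 1) := pow_le_pow_right₀ (by norm_num) (by omega)
      nlinarith [Real.pi_pos]
    have hθ2 : 2 * (2 * Real.pi / 2 ^ (k + 1)) = 2 * Real.pi / 2 ^ k := by
      rw [pow_succ]; field_simp
    obtain ⟨f1, f2⟩ := half_angle (D := D) (c := c) (s := q) (c' := t.reg 21) (e := 4 ^ k) (by omega)
      hD2 hθ0 hθ1 (by rw [hθ2]; exact h7) (by rw [hθ2]; exact h9) g4 g5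
    have hk4 : (3 : ℝ) * 4 ^ k + 3 ≤ 4 ^ (k + 1) := by
      have : (4 : ℝ) ^ 1 ≤ 4 ^ k := pow_le_pow_right₀ (by norm_num) (by omega)
      rw [pow_succ]; linarith
    have h4K : (4 : ℝ) ^ (k + 1) ≤ D := by
      have h1 : 4 ^ (k + 1) ≤ 4 ^ K := Nat.pow_le_pow_right (by norm_num) (by omega)
      have h2 : 4 ^ K = N ^ 2 := by rw [hNK, ← pow_mul, mul_comm, pow_mul]; norm_num
      have h3 : 4 ^ (k + 1) ≤ D := by omega
      exact_mod_cast h3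
    have hq' : D * q / (2 * t.reg 21) ≤ 2 * D := by
      have h1 := (abs_le.1 f2).2
      have h2 := Real.sin_le_one (2 * Real.pi / 2 ^ (k + 1))
      have h3 : (0 : ℝ) ≤ D := Nat.cast_nonneg _
      have h4 : ((D * q / (2 * t.reg 21) : ℕ) : ℝ) ≤ (2 * D : ℕ) := by
        push_cast
        nlinarith
      exact_mod_cast h4
    refine Run.flat (fun hBt => ⟨hBt.reg 21, ?_, ?_, k + 1, ⟨?_, ?_, by omega, by omega, ?_, ?_, ?_, ?_⟩,
      ?_⟩) (by decide)
    · simp [e10, e13]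
      nlinarith
    · have h1 : 2 ^ (k + 1) ≤ N := hNK ▸ Nat.pow_le_pow_right (by norm_num) (by omega)
      have h2 := hp.pow_lt (show 1 ≤ 40 by norm_num)
      rw [pow_one] at h2
      rw [pow_succ] at h1
      simp [e23]
      omega
    · exact g1.trans h1
    · have g2' : SameReg 12 30 s t :=
        (h2.set (by omega) (by omega)).trans (g2.mono (by omega) (by omega))
      exact ((g2'.set (by omega) (by omega)).set (by omega) (by omega)).set (by omega) (by omega)
    · simp [e23, pow_succ, mul_comm]
    · simpa using hx'
    · simpa using f1.trans hk4
    · simpa [e10, e13] using f2.trans hk4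
    · obtain ⟨d, rfl⟩ : ∃ d, K = k + 1 + d := ⟨K - (k + 1), by omega⟩
      rw [show k + 1 + d - (k + 1) = d by omega, show k + 1 + d - k = d + 1 by omega]
      simp only [Expr.cost]
      ring_nf
      omega

end WordRAM

namespace WordRAM
open FixedPoint
open WordRAM.Expr (reg load)

/-- The cells `base + i` and `base + M + i`, for `i < N`, hold approximations of the complex numbers
`z i`. -/
def Data (D B M N : ℕ) (E : ℝ) (mem : ℕ → ℕ) (base : ℕ) (z : ℕ → ℂ) : Prop :=
  ∀ i < N, Approx D B E (mem (base + i)) (mem (base + M + i)) (z i)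

lemma Data.congr {D B M N : ℕ} {E : ℝ} {mem mem' : ℕ → ℕ} {base : ℕ} {z : ℕ → ℂ}
    (h : Data D B M N E mem base z) (hN : N ≤ M)
    (hm : ∀ a, base ≤ a → a < base + 2 * M → mem' a = mem a) : Data D B M N E mem' base z := by
  intro i hi
  rw [hm _ (by omega) (by omega), hm _ (by omega) (by omega)]
  exact h i hi

lemma eight_mul_pow_le {N : ℕ} (h : 8 ≤ N) {k l : ℕ} (hkl : k < l) :
    (8 : ℝ) * (N : ℝ) ^ k ≤ (N : ℝ) ^ l := by
  have h8 : (8 : ℝ) ≤ N := by exact_mod_cast h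
  calc (8 : ℝ) * (N : ℝ) ^ k ≤ N * N ^ k := by gcongr
    _ = N ^ (k + 1) := by ring
    _ ≤ N ^ l := pow_le_pow_right₀ (by linarith) hkl

lemma pow_le_pow_of_eight_le {N : ℕ} (h : 8 ≤ N) {k l : ℕ} (hkl : k ≤ l) : (N : ℝ) ^ k ≤ (N : ℝ) ^ l :=
  pow_le_pow_right₀ (by have : (8 : ℝ) ≤ N := (by exact_mod_cast h); linarith) hkl

lemma Params.two_mul_B_lt {v M N K : ℕ} (hp : Params v M N K) : 2 * N ^ 20 < 2 ^ v := by
  refine lt_of_le_of_lt ?_ (hp.pow_lt (show 21 ≤ 40 by norm_num))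
  rw [pow_succ N 20, mul_comm]
  exact Nat.mul_le_mul_left _ (by have := hp.eight_le; omega)

/-- The powers of the root of unity in registers `12` and `13` are written to the memory from `M`
on. -/
def twiddleProg : Program :=
  20 ≔ reg 10 + reg 11 ;; 21 ≔ reg 11 ;;
  .forLoop 22 (reg 3)
    (.store (reg 2 + reg 22) (reg 20) ;;
    .store (reg 2 + reg 2 + reg 22) (reg 21) ;;
    23 ≔ (reg 20 * reg 12 + reg 11 * reg 13 + reg 11 * reg 10 -
      (reg 21 * reg 13 + reg 11 * reg 12)) / reg 10 ;;
    21 ≔ (reg 20 * reg 13 + reg 21 * reg 12 + reg 11 * reg 10 -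
      (reg 11 * reg 13 + reg 11 * reg 12)) / reg 10 ;;
    20 ≔ reg 23)

lemma run_twiddleProg {v M N K : ℕ} (hp : Params v M N K) {s : State} (hc : Consts M N s)
    (hζ : ‖(⟨s.reg 12, s.reg 13⟩ : ℂ) - (N ^ 16 : ℕ) * root N‖ ≤ 2 * N ^ 2) :
    Run v twiddleProg s (120 * N + 20) (fun s' => SameReg 20 30 s s' ∧
      (∀ a, a < M ∨ 3 * M ≤ a → s'.mem a = s.mem a) ∧
      Data (N ^ 16) (N ^ 20) M N (N ^ 4) s'.mem M (fun i => root N ^ i)) := by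
  have h8 := hp.eight_le
  have hNM := hp.N_le
  have h8' : (8 : ℝ) ≤ N := by exact_mod_cast h8
  have hDpos : 0 < N ^ 16 := by positivity
  have hBv := hp.two_mul_B_lt
  have hDB : N ^ 16 ≤ N ^ 20 := Nat.pow_le_pow_right (by omega) (by norm_num)
  have hNv : N < 2 ^ v := by simpa using hp.pow_lt (show 1 ≤ 40 by norm_num)
  -- the error of the `j`-th power
  let ε : ℕ → ℝ := fun j => j * (4 * N ^ 2 + 2)
  have hε : ∀ j ≤ N, ε j ≤ (N : ℝ) ^ 4 := by
    intro j hj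
    have hj' : (j : ℝ) ≤ N := by exact_mod_cast hj
    have e1 := eight_mul_pow_le h8 (show 3 < 4 by norm_num)
    have e2 := pow_le_pow_of_eight_le h8 (show 1 ≤ 3 by norm_num)
    rw [pow_one] at e2
    calc ε j ≤ N * (4 * N ^ 2 + 2) := by simp only [ε]; gcongr
      _ = 4 * N ^ 3 + 2 * N := by ring
      _ ≤ N ^ 4 := by linarith [pow_nonneg (Nat.cast_nonneg (α := ℝ) N) 3]
  let I : ℕ → State → Prop := fun j s' => SameReg 20 30 s s' ∧
    (∀ a, a < M ∨ 3 * M ≤ a → s'.mem a = s.mem a) ∧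
    (∀ i < j, Approx (N ^ 16) (N ^ 20) (N ^ 4) (s'.mem (M + i)) (s'.mem (M + M + i)) (root N ^ i)) ∧
    Approx (N ^ 16) (N ^ 20) (ε j) (s'.reg 20) (s'.reg 21) (root N ^ j) ∧
    s'.reg 20 ≤ 2 * N ^ 20 ∧ s'.reg 21 ≤ 2 * N ^ 20
  refine Run.seq (T₁ := 4) (T₂ := 120 * N + 16) (R := fun s' => s' = s.set 20 (N ^ 16 + N ^ 20))
    (Run.flat (fun _ => ⟨by simp [hc.hD, hc.hB]; omega, by simp [hc.hD, hc.hB]⟩) (by decide)) ?_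
    (by omega)
  rintro s1 - rfl
  refine Run.seq (T₁ := 2) (T₂ := 120 * N + 14)
    (R := fun s' => s' = (s.set 20 (N ^ 16 + N ^ 20)).set 21 (N ^ 20))
    (Run.flat (fun hB => ⟨hB.reg 11, by simp [hc.hB]⟩) (by decide)) ?_
    (by omega)
  rintro s1 - rfl
  refine Run.forLoop (n := N) (Tb := 80) I hNv ?_ ?_ ?_ ?_ (by simp only [Expr.cost]; omega)
  · refine ⟨(((SameReg.refl _ _ _).set (by omega) (by omega)).set (by omega) (by omega)).set (by omega)
      (by omega), fun a _ => rfl, fun i hi => absurd hi (by omega), ?_, by simp; omega, by simp; omega⟩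
    have : val (N ^ 20) (N ^ 16 + N ^ 20) (N ^ 20) - (N ^ 16 : ℕ) * root N ^ 0 = 0 := by
      apply Complex.ext <;> simp [val, ← Complex.ofReal_natCast, ← Complex.ofReal_pow]
    simp only [State.set_reg, Nat.reduceEqDiff, reduceIte, Approx, this]
    simp [ε]
  · rintro j s' ⟨h1, -⟩
    exact (h1 3 (by omega)).trans hc.hN
  · rintro j s' hB hj ⟨h1, h2, h3, h4, h5, h6⟩ hj'
    have hc' := hc.of_sameReg h1 (by omega)
    refine Run.flat (fun _ => ?_) (by decide)
    have e12 := h1 12 (by omega)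
    have e13 := h1 13 (by omega)
    have hw : ‖root N ^ j‖ ≤ 1 := by rw [norm_pow, norm_root, one_pow]
    obtain ⟨g1, g2, g3⟩ := h4.twiddle (c := s.reg 12) (s := s.reg 13) (E' := ε (j + 1)) hDpos hζ hw
      (norm_root N).le
      (by
        have := hε j hj.le
        have := pow_le_pow_of_eight_le h8 (show 4 ≤ 16 by norm_num)
        push_cast; linarith)
      (by simp only [ε]; push_cast; linarith)
      (by
        have e0 := hε j hj.le
        have e1 := pow_le_pow_of_eight_le h8 (show 4 ≤ 16 by norm_num)
        have e2 := pow_le_pow_of_eight_le h8 (show 2 ≤ 16 by norm_num)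
        have e3 := eight_mul_pow_le h8 (show 16 < 17 by norm_num)
        have e4 := pow_le_pow_of_eight_le h8 (show 17 ≤ 20 by norm_num)
        have e5 : (0 : ℝ) ≤ (N : ℝ) ^ 16 := by positivity
        push_cast; linarith)
    refine ⟨by simpa using hB.reg 20, by simpa using hB.reg 21, ?_, ?_, ?_, ?_⟩
    · simp [e12, e13, hc'.hB, hc'.hD]
      omega
    · simp [e12, e13, hc'.hB, hc'.hD]
      omega
    · simp [e12, e13, hc'.hB, hc'.hD]
      omega
    simp only [Expr.eval_add, Expr.eval_sub, Expr.eval_mul, Expr.eval_div, Expr.eval_reg,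
      State.set_reg, State.put_reg, e12, e13, hc'.hB, hc'.hD, hc'.hM, hj', reduceIte,
      Nat.reduceEqDiff]
    refine ⟨trivial, ?_, ?_, ?_, ?_, ?_, ?_⟩
    · exact ((((h1.put.put).set (by omega) (by omega)).set (by omega) (by omega)).set (by omega)
        (by omega)).set (by omega) (by omega)
    · intro a ha
      simp only [State.set_mem, State.put_mem]
      rw [if_neg (by omega), if_neg (by omega), h2 a ha]
    · intro i hi
      simp only [State.set_mem, State.put_mem]
      rw [if_neg (show M + i ≠ M + M + j by omega), if_neg (show M + M + i ≠ M + j by omega)]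
      by_cases hij : i = j
      · subst hij
        rw [if_pos rfl, if_pos rfl]
        exact h4.mono (hε i hj.le)
      · rw [if_neg (by omega), if_neg (by omega)]
        exact h3 i (by omega)
    · simpa [pow_succ] using g1
    · simpa using g2
    · simpa using g3
  · rintro s' ⟨h1, h2, h3, -⟩ -
    exact ⟨h1, h2, h3⟩

end WordRAM

namespace WordRAM
open FixedPoint
open WordRAM.Expr (reg load)

/-- One level of the transform: the array at `src` (register `14`) is combined into the array at `dst`
(register `15`). -/
def passProg : Program :=
  .forLoop 20 (reg 3)
    (21 ≔ reg 20 % reg 16 ;; 22 ≔ reg 20 - reg 21 ;; 23 ≔ (2 * reg 22 + reg 21) % reg 3 ;;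
    24 ≔ load (reg 14 + reg 23) ;; 25 ≔ load (reg 14 + reg 2 + reg 23) ;;
    26 ≔ load (reg 2 + reg 22) ;; 27 ≔ load (reg 2 + reg 2 + reg 22) ;;
    28 ≔ load (reg 14 + (reg 23 + reg 16)) ;; 29 ≔ load (reg 14 + reg 2 + (reg 23 + reg 16)) ;;
    .store (reg 15 + reg 20) ((reg 24 * reg 10 + reg 26 * reg 28 + reg 11 * (reg 27 + reg 29) -
      (reg 27 * reg 29 + reg 11 * (reg 26 + reg 28))) / reg 10) ;;
    .store (reg 15 + reg 2 + reg 20) ((reg 25 * reg 10 + reg 26 * reg 29 + reg 27 * reg 28 +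
      2 * reg 11 * reg 11 - reg 11 * (reg 26 + reg 27 + reg 28 + reg 29)) / reg 10))

lemma run_passProg {v M N K H src dst : ℕ} (hp : Params v M N K) {s : State} (hc : Consts M N s)
    (hsrc : s.reg 14 = src) (hdst : s.reg 15 = dst) (hH : s.reg 16 = H) (hHN : 2 * H ∣ N) (hH0 : 0 < H)
    (hsd : src = 3 * M ∧ dst = 5 * M ∨ src = 5 * M ∧ dst = 3 * M) {c : ℕ → ℂ} {E E' Mx : ℝ}
    (hW : Data (N ^ 16) (N ^ 20) M N (N ^ 4) s.mem M (fun i => root N ^ i))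
    (hdata : Data (N ^ 16) (N ^ 20) M N E s.mem src (DFT.level (root N) c N (2 * H)))
    (hM2 : ∀ i, ‖DFT.level (root N) c N (2 * H) i‖ ≤ Mx) (hM1 : ∀ i, ‖DFT.level (root N) c N H i‖ ≤ Mx)
    (hE' : 3 * E + N ^ 4 * Mx + 2 ≤ E') (hB : (N : ℝ) ^ 16 * Mx + (3 * E + N ^ 4 * Mx) ≤ N ^ 20) :
    Run v passProg s (200 * N + 20) (fun s' => SameReg 20 30 s s' ∧
      (∀ a, a < dst ∨ dst + 2 * M ≤ a → s'.mem a = s.mem a) ∧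
      Data (N ^ 16) (N ^ 20) M N E' s'.mem dst (DFT.level (root N) c N H)) := by
  have h8 := hp.eight_le
  have hNM := hp.N_le
  have hDpos : 0 < N ^ 16 := by positivity
  have hBv := hp.two_mul_B_lt
  have hNv : N < 2 ^ v := by simpa using hp.pow_lt (show 1 ≤ 40 by norm_num)
  have hω : root N ^ N = 1 := by
    rw [root, ← Complex.exp_nat_mul, mul_div_cancel₀ _ (by exact_mod_cast (by omega : N ≠ 0)),
      Complex.exp_two_pi_mul_I]
  let I : ℕ → State → Prop := fun j s' => SameReg 20 30 s s' ∧
    (∀ a, a < dst ∨ dst + 2 * M ≤ a → s'.mem a = s.mem a) ∧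
    (∀ i < j, Approx (N ^ 16) (N ^ 20) E' (s'.mem (dst + i)) (s'.mem (dst + M + i))
      (DFT.level (root N) c N H i))
  refine Run.forLoop (n := N) (Tb := 150) I hNv ?_ ?_ ?_ ?_ (by simp only [Expr.cost]; omega)
  · exact ⟨(SameReg.refl _ _ _).set (by omega) (by omega), fun a _ => rfl,
      fun i hi => absurd hi (by omega)⟩
  · rintro j s' ⟨h1, -⟩
    exact (h1 3 (by omega)).trans hc.hN
  · rintro j s' hBd hj ⟨h1, h2, h3⟩ hj'
    have hc' := hc.of_sameReg h1 (by omega)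
    have e14 : s'.reg 14 = src := (h1 14 (by omega)).trans hsrc
    have e15 : s'.reg 15 = dst := (h1 15 (by omega)).trans hdst
    have e16 : s'.reg 16 = H := (h1 16 (by omega)).trans hH
    have hr : j % H < H := Nat.mod_lt _ hH0
    have hrj : j % H ≤ j := Nat.mod_le _ _
    have hstep := DFT.level_step (c := c) (i := j) hω hHN hH0
    have hqN : (2 * (j - j % H) + j % H) % N < N := Nat.mod_lt _ (by omega)
    have hqH : (2 * (j - j % H) + j % H) % N + H < N := by
      have h1 : (2 * (j - j % H) + j % H) % N % (2 * H) = j % H := by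
        rw [Nat.mod_mod_of_dvd _ hHN]
        have : 2 * (j - j % H) + j % H = j % H + 2 * H * (j / H) := by
          have := Nat.mod_add_div j H
          rw [mul_assoc]
          omega
        rw [this, Nat.add_mul_mod_self_left, Nat.mod_eq_of_lt (by omega)]
      obtain ⟨t, ht⟩ := hHN
      generalize (2 * (j - j % H) + j % H) % N = q at *
      have h2 := Nat.mod_add_div q (2 * H)
      have h3 : q / (2 * H) < t := by
        rw [Nat.div_lt_iff_lt_mul (by omega)]
        rw [mul_comm]; omega
      have h4 : 2 * H * (q / (2 * H) + 1) ≤ 2 * H * t := Nat.mul_le_mul_left _ h3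
      rw [mul_add] at h4
      omega
    have hmem : ∀ a, M ≤ a → a < 3 * M ∨ (src ≤ a ∧ a < src + 2 * M) → s'.mem a = s.mem a :=
      fun a ha ha' => h2 a (by omega)
    have hX := hdata _ hqN
    have hY := hdata _ hqH
    have hw := hW (j - j % H) (by omega)
    have hq1 : (2 * (j - j % H) + j % H) < 2 ^ v := by
      have := hp.two_mul_B_lt
      have : N ^ 2 ≤ N ^ 20 := Nat.pow_le_pow_right (by omega) (by norm_num)
      nlinarith [Nat.sub_le j (j % H)]
    have hpN : j - j % H < N := by omega
    generalize hq : (2 * (j - j % H) + j % H) % N = q at *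
    generalize hp' : j - j % H = p at *
    rw [← hmem (src + q) (by omega) (by omega), ← hmem (src + M + q) (by omega) (by omega)] at hX
    rw [← hmem (src + (q + H)) (by omega) (by omega),
      ← hmem (src + M + (q + H)) (by omega) (by omega)] at hY
    rw [← hmem (M + p) (by omega) (by omega), ← hmem (M + M + p) (by omega) (by omega)] at hw
    obtain ⟨g1, g2, g3⟩ := hX.butterfly (E' := E') (M := Mx) hDpos hY hw
      (by rw [norm_pow, norm_root, one_pow]) (hM2 _) (by rw [← hstep]; exact hM1 _)
      (by have := pow_le_pow_of_eight_le h8 (show 4 ≤ 16 by norm_num); push_cast; linarith)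
      hE' (by push_cast; linarith)
    rw [← hstep] at g1
    refine Run.flat (fun _ => ?_) (by decide)
    simp only [Program.wp, Expr.eval_add, Expr.eval_sub, Expr.eval_mul, Expr.eval_div, Expr.eval_mod,
      Expr.eval_reg, Expr.eval_load, Expr.eval_const, State.set_reg, State.put_reg, State.set_mem,
      hc'.hB, hc'.hD, hc'.hM, hc'.hN, hj', e14, e15, e16, reduceIte, Nat.reduceEqDiff, hp', hq]
    refine ⟨by omega, by omega, by omega, hBd.mem _, hBd.mem _, hBd.mem _, hBd.mem _, hBd.mem _,
      hBd.mem _, by omega, by omega, trivial, ?_, ?_, ?_⟩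
    · intro r hr
      simp only [State.set_reg, State.put_reg]
      iterate 10 rw [if_neg (by omega)]
      exact h1 r hr
    · intro a ha
      simp only [State.set_mem, State.put_mem]
      rw [if_neg (by omega), if_neg (by omega), h2 a ha]
    · intro i hi
      simp only [State.set_mem, State.put_mem]
      rw [if_neg (show dst + i ≠ dst + M + j by omega),
        if_neg (show dst + M + i ≠ dst + j by omega)]
      by_cases hij : i = j
      · subst hij
        rw [if_pos rfl, if_pos rfl]
        exact g1
      · rw [if_neg (by omega), if_neg (by omega)]
        exact h3 i (by omega)
  · rintro s' ⟨h1, h2, h3⟩ -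
    exact ⟨h1, h2, h3⟩

/-- The complete transform: the passes for `H = N / 2, N / 4, …, 1`, alternating between two arrays. -/
def fftProg : Program :=
  16 ≔ reg 3 / 2 ;;
  .loop (reg 16)
    (passProg ;; 16 ≔ reg 16 / 2 ;; 20 ≔ reg 14 ;; 14 ≔ reg 15 ;; 15 ≔ reg 20)

lemma run_fftProg {v M N K : ℕ} (hp : Params v M N K) {s : State} (hc : Consts M N s)
    (hsd : s.reg 14 = 3 * M ∧ s.reg 15 = 5 * M ∨ s.reg 14 = 5 * M ∧ s.reg 15 = 3 * M)
    {c : ℕ → ℂ} {G M₀ : ℝ} (hM₀ : ∀ k < N, ‖c k‖ ≤ M₀)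
    (hW : Data (N ^ 16) (N ^ 20) M N (N ^ 4) s.mem M (fun i => root N ^ i))
    (hdata : Data (N ^ 16) (N ^ 20) M N G s.mem (s.reg 14) c)
    (hG : (N : ℝ) ^ 4 * (N * M₀) + 2 ≤ G) (hB : (N : ℝ) ^ 16 * (N * M₀) + N ^ 2 * G ≤ N ^ 20) :
    Run v fftProg s (K * (200 * N + 50) + 20) (fun s' => SameReg 14 30 s s' ∧
      (s'.reg 14 = 3 * M ∧ s'.reg 15 = 5 * M ∨ s'.reg 14 = 5 * M ∧ s'.reg 15 = 3 * M) ∧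
      (∀ a, a < 3 * M ∨ 7 * M ≤ a → s'.mem a = s.mem a) ∧
      Data (N ^ 16) (N ^ 20) M N (N ^ 2 * G) s'.mem (s'.reg 14) (DFT.level (root N) c N 1)) := by
  have h8 := hp.eight_le
  have hNM := hp.N_le
  have hNK := hp.N_eq
  have hM₀0 : 0 ≤ M₀ := (norm_nonneg _).trans (hM₀ 0 (by omega))
  have hG0 : 0 ≤ G := by
    have : (0 : ℝ) ≤ (N : ℝ) ^ 4 * (N * M₀) := by positivity
    linarith
  have hNv : N < 2 ^ v := by simpa using hp.pow_lt (show 1 ≤ 40 by norm_num)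
  have hlevel : ∀ k ≤ K, ∀ i, ‖DFT.level (root N) c N (2 ^ k) i‖ ≤ N * M₀ := fun k hk =>
    DFT.norm_level_le (norm_root N) hM₀ (hNK ▸ pow_dvd_pow 2 hk) (by positivity)
  -- `k` passes remain to be done
  let I : ℕ → State → Prop := fun k s' => SameReg 14 30 s s' ∧ k ≤ K ∧ s'.reg 16 = 2 ^ k / 2 ∧
    (s'.reg 14 = 3 * M ∧ s'.reg 15 = 5 * M ∨ s'.reg 14 = 5 * M ∧ s'.reg 15 = 3 * M) ∧
    (∀ a, a < 3 * M ∨ 7 * M ≤ a → s'.mem a = s.mem a) ∧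
    Data (N ^ 16) (N ^ 20) M N (4 ^ (K - k) * G) s'.mem (s'.reg 14)
      (DFT.level (root N) c N (2 ^ k))
  refine Run.seq (T₁ := 4) (T₂ := K * (200 * N + 50) + 16) (R := I K)
    (Run.flat (fun _ => ⟨?_, ?_⟩) (by decide)) ?_ (by omega)
  · simp [hc.hN]
    omega
  · refine ⟨(SameReg.refl _ _ _).set (by omega) (by omega), le_rfl, by simp [hc.hN, hNK],
      by simpa using hsd, fun _ _ => rfl, ?_⟩
    intro i hi
    simp only [State.set_reg, State.set_mem, Nat.reduceEqDiff, reduceIte]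
    rw [← hNK, DFT.level_self hi]
    simpa using hdata i hi
  rintro s1 - hI
  refine Run.loop I (fun k => k * (200 * N + 50) + 10) ?_ ?_ K s1 hI (by omega)
  · rintro k s' - ⟨h1, h2, h3, h4, h5, h6⟩ h0
    have hk : k = 0 := by
      rw [Expr.eval_reg, h3] at h0
      rcases k with _ | k
      · rfl
      · rw [pow_succ, Nat.mul_div_cancel _ (by norm_num)] at h0
        exact absurd h0 (by positivity)
    subst hk
    have h4K : (4 : ℝ) ^ K = N ^ 2 := by
      rw [show (N : ℝ) = 2 ^ K by exact_mod_cast hNK, ← pow_mul, mul_comm, pow_mul]; norm_num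
    refine ⟨⟨h1, h4, h5, ?_⟩, by simp [Expr.cost]⟩
    simpa [h4K] using h6
  · rintro k s' hBd ⟨h1, h2, h3, h4, h5, h6⟩ h0
    rcases k with _ | k
    · simp [h3] at h0
    rw [pow_succ, Nat.mul_div_cancel _ (by norm_num)] at h3
    have hc' := hc.of_sameReg h1 (by omega)
    have hW' : Data (N ^ 16) (N ^ 20) M N (N ^ 4) s'.mem M (fun i => root N ^ i) :=
      hW.congr hNM fun a _ ha => h5 a (by omega)
    have hGk : (4 : ℝ) ^ (K - (k + 1)) * G * 4 = 4 ^ (K - k) * G := by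
      rw [show K - k = K - (k + 1) + 1 by omega, pow_succ]; ring
    have hGle : (4 : ℝ) ^ (K - k) * G ≤ N ^ 2 * G := by
      have h4K : (4 : ℝ) ^ K = N ^ 2 := by
        rw [show (N : ℝ) = 2 ^ K by exact_mod_cast hNK, ← pow_mul, mul_comm, pow_mul]; norm_num
      rw [← h4K]
      gcongr
      · norm_num
      · omega
    have hGge : G ≤ (4 : ℝ) ^ (K - (k + 1)) * G :=
      le_mul_of_one_le_left hG0 (one_le_pow₀ (by norm_num))
    refine ⟨200 * N + 40, Run.seq (T₂ := 20) (run_passProg hp hc' (H := 2 ^ k) rfl rfl h3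
      (by rw [← pow_succ', hNK]; exact pow_dvd_pow 2 h2) (by positivity) h4 hW'
      (E := 4 ^ (K - (k + 1)) * G) (E' := 4 ^ (K - k) * G) (Mx := N * M₀)
      (by rw [← pow_succ']; exact h6) (by rw [← pow_succ']; exact hlevel _ h2)
      (hlevel _ (by omega)) (by linarith) (by linarith)) ?_ (by omega)⟩
    rintro t - ⟨g1, g2, g3⟩
    have e14 := g1 14 (by omega)
    have e15 := g1 15 (by omega)
    have e16 := g1 16 (by omega)
    refine Run.flat (fun hBt => ⟨?_, ?_, ?_, ?_, k, ⟨?_, by omega, ?_, ?_, ?_, ?_⟩, ?_⟩) (by decide)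
    · exact (Nat.div_le_self _ _).trans_lt (hBt.reg 16)
    · simpa using hBt.reg 14
    · simpa using hBt.reg 15
    · simpa using hBt.reg 14
    · exact ((((h1.trans (g1.mono (by omega) (by omega))).set (by omega) (by omega)).set (by omega)
        (by omega)).set (by omega) (by omega)).set (by omega) (by omega)
    · simp [e16, h3]
    · simp [e14, e15]
      omega
    · intro a ha
      rw [← h5 a ha, ← g2 a (by omega)]
      rfl
    · simpa [e15] using g3
    · simp only [Expr.cost]
      ring_nf
      omega

end WordRAM

/-! ### Sumsets on the word RAM -/

namespace WordRAM
open FixedPoint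
open WordRAM.Expr (reg load)

/-- Scale and offset are put into registers `10` and `11`. -/
def scaleProg : Program :=
  10 ≔ reg 3 * reg 3 ;; 10 ≔ reg 10 * reg 10 ;; 10 ≔ reg 10 * reg 10 ;; 10 ≔ reg 10 * reg 10 ;;
  11 ≔ reg 10 * (reg 3 * reg 3 * (reg 3 * reg 3))

lemma run_scaleProg {v M N K : ℕ} (hp : Params v M N K) {s : State} (hM : s.reg 2 = M)
    (hN : s.reg 3 = N) : Run v scaleProg s 40 (fun s' => s'.mem = s.mem ∧ SameReg 10 12 s s' ∧
      Consts M N s') := by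
  have h2 : N * N = N ^ 2 := by ring
  have h4 : N ^ 2 * N ^ 2 = N ^ 4 := by ring
  have h8 : N ^ 4 * N ^ 4 = N ^ 8 := by ring
  have h16 : N ^ 8 * N ^ 8 = N ^ 16 := by ring
  have h20 : N ^ 16 * N ^ 4 = N ^ 20 := by ring
  refine Run.flat (fun _ => ?_) (by decide)
  simp only [scaleProg, Program.wp, Expr.eval_mul, Expr.eval_reg, State.set_reg, State.set_mem, hN,
    reduceIte, Nat.reduceEqDiff, h2, h4, h8, h16, h20]
  refine ⟨hp.pow_lt (by norm_num), hp.pow_lt (by norm_num), hp.pow_lt (by norm_num),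
    hp.pow_lt (by norm_num), hp.pow_lt (by norm_num), trivial, ?_, ?_⟩
  · exact (((((SameReg.refl _ _ _).set (by omega) (by omega)).set (by omega) (by omega)).set (by omega)
      (by omega)).set (by omega) (by omega)).set (by omega) (by omega)
  · constructor <;> simp [hM, hN]

/-- The 0-1-arrays at the addresses in registers `4` and `5`, of the length in register `7`, become
the real and the imaginary part of the array to be transformed. -/
def loadProg : Program :=
  14 ≔ 3 * reg 2 ;; 15 ≔ 5 * reg 2 ;;
  .forLoop 20 (reg 3)
    (.store (reg 14 + reg 20) (.bin .lt (reg 20) (reg 7) * load (reg 4 + reg 20) * reg 10 + reg 11) ;;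
    .store (reg 14 + reg 2 + reg 20)
      (.bin .lt (reg 20) (reg 7) * load (reg 5 + reg 20) * reg 10 + reg 11))

/-- The entries `mem (p + i)` for `i < len`, continued by zeros. -/
def segment (mem : ℕ → ℕ) (p len i : ℕ) : ℕ := if i < len then mem (p + i) else 0

lemma run_loadProg {v M N K p₁ p₂ len : ℕ} (hp : Params v M N K) {s : State} (hc : Consts M N s)
    (h4 : s.reg 4 = p₁) (h5 : s.reg 5 = p₂) (h7 : s.reg 7 = len) (hp₁ : 7 * M ≤ p₁) (hp₂ : 7 * M ≤ p₂)
    (hb₁ : ∀ i < len, s.mem (p₁ + i) ≤ 1) (hb₂ : ∀ i < len, s.mem (p₂ + i) ≤ 1) :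
    Run v loadProg s (100 * N + 30) (fun s' => SameReg 14 30 s s' ∧
      (∀ a, a < 3 * M ∨ 7 * M ≤ a → s'.mem a = s.mem a) ∧ s'.reg 14 = 3 * M ∧ s'.reg 15 = 5 * M ∧
      Data (N ^ 16) (N ^ 20) M N 0 s'.mem (3 * M)
        (fun i => ⟨segment s.mem p₁ len i, segment s.mem p₂ len i⟩)) := by
  have h8 := hp.eight_le
  have hNM := hp.N_le
  have hMv := hp.M_lt
  have hBv := hp.two_mul_B_lt
  have hDB : N ^ 16 ≤ N ^ 20 := Nat.pow_le_pow_right (by omega) (by norm_num)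
  have hNv : N < 2 ^ v := by simpa using hp.pow_lt (show 1 ≤ 40 by norm_num)
  have hcell : ∀ x y : ℕ, Approx (N ^ 16) (N ^ 20) 0 (x * N ^ 16 + N ^ 20) (y * N ^ 16 + N ^ 20)
      ⟨x, y⟩ := by
    intro x y
    have : val (N ^ 20) (x * N ^ 16 + N ^ 20) (y * N ^ 16 + N ^ 20) - (N ^ 16 : ℕ) * ⟨x, y⟩ = 0 := by
      apply Complex.ext
      · rw [Complex.sub_re, ← Complex.ofReal_natCast, Complex.re_ofReal_mul]
        simp only [val]; push_cast; simp; ring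
      · rw [Complex.sub_im, ← Complex.ofReal_natCast, Complex.im_ofReal_mul]
        simp only [val]; push_cast; simp; ring
    simp only [Approx, this, norm_zero, le_refl]
  have hseg : ∀ p, (∀ i < len, s.mem (p + i) ≤ 1) → ∀ i, segment s.mem p len i ≤ 1 := by
    intro p h i
    unfold segment
    split_ifs with hi
    · exact h i hi
    · omega
  let I : ℕ → State → Prop := fun j s' => SameReg 14 30 s s' ∧ s'.reg 14 = 3 * M ∧
    s'.reg 15 = 5 * M ∧ (∀ a, a < 3 * M ∨ 7 * M ≤ a → s'.mem a = s.mem a) ∧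
    (∀ i < j, Approx (N ^ 16) (N ^ 20) 0 (s'.mem (3 * M + i)) (s'.mem (3 * M + M + i))
      ⟨segment s.mem p₁ len i, segment s.mem p₂ len i⟩)
  refine Run.seq (T₁ := 10) (T₂ := 100 * N + 20)
    (R := fun s' => s' = s.set 14 (3 * M))
    (Run.flat (fun _ => ⟨by simp [hc.hM]; omega, by simp [hc.hM]⟩) (by decide)) ?_ (by omega)
  rintro s1 - rfl
  refine Run.seq (T₁ := 10) (T₂ := 100 * N + 10)
    (R := fun s' => s' = (s.set 14 (3 * M)).set 15 (5 * M))
    (Run.flat (fun _ => ⟨by simp [hc.hM]; omega, by simp [hc.hM]⟩) (by decide)) ?_ (by omega)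
  rintro s1 - rfl
  refine Run.forLoop (n := N) (Tb := 60) I hNv ?_ ?_ ?_ ?_ (by simp only [Expr.cost]; omega)
  · exact ⟨(((SameReg.refl _ _ _).set (by omega) (by omega)).set (by omega) (by omega)).set (by omega)
      (by omega), by simp, by simp, fun a _ => rfl, fun i hi => absurd hi (by omega)⟩
  · rintro j s' ⟨h1, -⟩
    exact (h1 3 (by omega)).trans hc.hN
  · rintro j s' hBd hj ⟨h1, h14, h15, h2, h3⟩ hj'
    have hc' := hc.of_sameReg h1 (by omega)
    have e4 : s'.reg 4 = p₁ := (h1 4 (by omega)).trans h4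
    have e5 : s'.reg 5 = p₂ := (h1 5 (by omega)).trans h5
    have e7 : s'.reg 7 = len := (h1 7 (by omega)).trans h7
    have hs₁ : (if j < len then 1 else 0) * s'.mem (p₁ + j) = segment s.mem p₁ len j := by
      rw [h2 _ (by omega), segment]; split_ifs <;> simp
    have hs₂ : (if j < len then 1 else 0) * s'.mem (p₂ + j) = segment s.mem p₂ len j := by
      rw [h2 _ (by omega), segment]; split_ifs <;> simp
    have b₁ := Nat.mul_le_mul_right (N ^ 16) (hseg p₁ hb₁ j)
    have b₂ := Nat.mul_le_mul_right (N ^ 16) (hseg p₂ hb₂ j)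
    refine Run.flat (fun _ => ?_) (by decide)
    simp only [Program.wp, Expr.eval_add, Expr.eval_mul, Expr.eval_lt, Expr.eval_reg, Expr.eval_load,
      State.put_reg, State.put_mem, hc'.hB, hc'.hD, hc'.hM, hj', e4, e5, e7, h14,
      if_neg (show p₂ + j ≠ 3 * M + j by omega), hs₁, hs₂]
    refine ⟨by omega, by omega, trivial, ?_, by simpa using h14, by simpa using h15, ?_, ?_⟩
    · exact (h1.put.put).set (by omega) (by omega)
    · intro a ha
      simp only [State.set_mem, State.put_mem]
      rw [if_neg (by omega), if_neg (by omega), h2 a ha]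
    · intro i hi
      simp only [State.set_mem, State.put_mem]
      rw [if_neg (show 3 * M + i ≠ 3 * M + M + j by omega),
        if_neg (show 3 * M + M + i ≠ 3 * M + j by omega)]
      by_cases hij : i = j
      · subst hij
        rw [if_pos rfl, if_pos rfl]
        exact hcell _ _
      · rw [if_neg (by omega), if_neg (by omega)]
        exact h3 i (by omega)
  · rintro s' ⟨h1, h14, h15, h2, h3⟩ -
    exact ⟨h1, h2, h14, h15, h3⟩

/-- The transformed array at `reg 14` is squared pointwise. -/
def squareProg : Program :=
  .forLoop 20 (reg 3)
    (21 ≔ load (reg 14 + reg 20) ;; 22 ≔ load (reg 14 + reg 2 + reg 20) ;;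
    .store (reg 14 + reg 20) ((reg 21 * reg 21 + 2 * reg 11 * reg 22 + reg 11 * reg 10 -
      (reg 22 * reg 22 + 2 * reg 11 * reg 21)) / reg 10) ;;
    .store (reg 14 + reg 2 + reg 20) ((2 * reg 21 * reg 22 + 2 * reg 11 * reg 11 + reg 11 * reg 10 -
      2 * reg 11 * (reg 21 + reg 22)) / reg 10))

lemma run_squareProg {v M N K src : ℕ} (hp : Params v M N K) {s : State} (hc : Consts M N s)
    (hsrc : s.reg 14 = src) {z : ℕ → ℂ} {E E' Mx : ℝ} (hz : ∀ i, ‖z i‖ ≤ Mx)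
    (hdata : Data (N ^ 16) (N ^ 20) M N E s.mem src z) (hE : E ≤ N ^ 16)
    (hE' : E * (2 * Mx + 1) + 2 ≤ E') (hB : (N : ℝ) ^ 16 * Mx ^ 2 + E * (2 * Mx + 1) ≤ N ^ 20) :
    Run v squareProg s (100 * N + 10) (fun s' => SameReg 20 30 s s' ∧
      (∀ a, a < src ∨ src + 2 * M ≤ a → s'.mem a = s.mem a) ∧
      Data (N ^ 16) (N ^ 20) M N E' s'.mem src (fun i => z i * z i)) := by
  have h8 := hp.eight_le
  have hNM := hp.N_le
  have hBv := hp.two_mul_B_lt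
  have hNv : N < 2 ^ v := by simpa using hp.pow_lt (show 1 ≤ 40 by norm_num)
  let I : ℕ → State → Prop := fun j s' => SameReg 20 30 s s' ∧
    (∀ a, a < src ∨ src + 2 * M ≤ a → s'.mem a = s.mem a) ∧
    (∀ i < N, j ≤ i → s'.mem (src + i) = s.mem (src + i) ∧
      s'.mem (src + M + i) = s.mem (src + M + i)) ∧
    (∀ i < j, Approx (N ^ 16) (N ^ 20) E' (s'.mem (src + i)) (s'.mem (src + M + i)) (z i * z i))
  refine Run.forLoop (n := N) (Tb := 80) I hNv ?_ ?_ ?_ ?_ (by simp only [Expr.cost]; omega)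
  · exact ⟨(SameReg.refl _ _ _).set (by omega) (by omega), fun a _ => rfl, fun i _ _ => ⟨rfl, rfl⟩,
      fun i hi => absurd hi (by omega)⟩
  · rintro j s' ⟨h1, -⟩
    exact (h1 3 (by omega)).trans hc.hN
  · rintro j s' hBd hj ⟨h1, h2, h3, h4⟩ hj'
    have hc' := hc.of_sameReg h1 (by omega)
    have e14 : s'.reg 14 = src := (h1 14 (by omega)).trans hsrc
    have hX := hdata j hj
    rw [← (h3 j hj le_rfl).1, ← (h3 j hj le_rfl).2] at hX
    obtain ⟨g1, g2, g3⟩ := hX.square (E' := E') (by positivity) (hz j) (by push_cast; exact hE) hE'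
      (by push_cast; exact hB)
    refine Run.flat (fun _ => ?_) (by decide)
    simp only [Program.wp, Expr.eval_add, Expr.eval_sub, Expr.eval_mul, Expr.eval_div,
      Expr.eval_reg, Expr.eval_load, Expr.eval_const, State.set_reg, State.put_reg, State.set_mem,
      hc'.hB, hc'.hD, hc'.hM, hj', e14, reduceIte, Nat.reduceEqDiff]
    refine ⟨hBd.mem _, hBd.mem _, by omega, by omega, trivial, ?_, ?_, ?_, ?_⟩
    · exact (((h1.set (by omega) (by omega)).set (by omega) (by omega)).put.put).set (by omega)
        (by omega)
    · intro a ha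
      simp only [State.set_mem, State.put_mem]
      rw [if_neg (by omega), if_neg (by omega), h2 a ha]
    · intro i hi hji
      simp only [State.set_mem, State.put_mem]
      rw [if_neg (by omega), if_neg (by omega), if_neg (by omega), if_neg (by omega)]
      exact h3 i hi (by omega)
    · intro i hi
      simp only [State.set_mem, State.put_mem]
      rw [if_neg (show src + i ≠ src + M + j by omega),
        if_neg (show src + M + i ≠ src + j by omega)]
      by_cases hij : i = j
      · subst hij
        rw [if_pos rfl, if_pos rfl]
        exact g1
      · rw [if_neg (by omega), if_neg (by omega)]
        exact h4 i (by omega)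
  · rintro s' ⟨h1, h2, -, h4⟩ -
    exact ⟨h1, h2, h4⟩

/-- The imaginary parts of the array at `reg 14`, read backwards from position `- reg 8`, are compared
with `N / 2`; the results form an array of length `reg 7` at address `reg 6`. -/
def thresholdProg : Program :=
  .forLoop 20 (reg 7)
    (.store (reg 6 + reg 20) (.bin .lt (reg 3 / 2 * reg 10 + reg 11)
      (load (reg 14 + reg 2 + (reg 3 - (reg 20 + reg 8)) % reg 3))))

lemma run_thresholdProg {v M N K src out len off : ℕ} (hp : Params v M N K) {s : State}
    (hc : Consts M N s) (hsrc : s.reg 14 = src) (h6 : s.reg 6 = out) (h7 : s.reg 7 = len)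
    (h8 : s.reg 8 = off) (hlen : len ≤ N) (hout : src + 2 * M ≤ out) {z : ℕ → ℂ} {P : ℕ → Prop}
    [DecidablePred P] (hdata : Data (N ^ 16) (N ^ 20) M N (N ^ 12) s.mem src z)
    (hz : ∀ x < len, (P (x + off) → (N : ℝ) ≤ (z ((N - (x + off)) % N)).im) ∧
      (¬P (x + off) → (z ((N - (x + off)) % N)).im = 0)) :
    Run v thresholdProg s (40 * N + 10) (fun s' => SameReg 20 30 s s' ∧
      (∀ a, a < out ∨ out + len ≤ a → s'.mem a = s.mem a) ∧
      ∀ x < len, s'.mem (out + x) = if P (x + off) then 1 else 0) := by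
  have h8N := hp.eight_le
  have hNM := hp.N_le
  have hNv : N < 2 ^ v := by simpa using hp.pow_lt (show 1 ≤ 40 by norm_num)
  let I : ℕ → State → Prop := fun j s' => SameReg 20 30 s s' ∧
    (∀ a, a < out ∨ out + len ≤ a → s'.mem a = s.mem a) ∧
    ∀ x < j, s'.mem (out + x) = if P (x + off) then 1 else 0
  refine Run.forLoop (n := len) (Tb := 30) I (by omega) ?_ ?_ ?_ ?_
    (by simp only [Expr.cost]; nlinarith)
  · exact ⟨(SameReg.refl _ _ _).set (by omega) (by omega), fun a _ => rfl,
      fun i hi => absurd hi (by omega)⟩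
  · rintro j s' ⟨h1, -⟩
    exact (h1 7 (by omega)).trans h7
  · rintro j s' hBd hj ⟨h1, h2, h3⟩ hj'
    have hc' := hc.of_sameReg h1 (by omega)
    have e14 : s'.reg 14 = src := (h1 14 (by omega)).trans hsrc
    have e6 : s'.reg 6 = out := (h1 6 (by omega)).trans h6
    have e8 : s'.reg 8 = off := (h1 8 (by omega)).trans h8
    have hidx : (N - (j + off)) % N < N := Nat.mod_lt _ (by omega)
    have hX := hdata _ hidx
    have hzj := hz j hj
    generalize hq : (N - (j + off)) % N = q at *
    rw [← h2 (src + M + q) (by omega)] at hX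
    have him := (Complex.abs_im_le_norm _).trans hX
    rw [Complex.sub_im, ← Complex.ofReal_natCast, Complex.im_ofReal_mul] at him
    simp only [val] at him
    push_cast at him
    have hhalf : 2 * (N / 2) ≤ N := Nat.mul_div_le N 2
    have hhalf1 : 1 ≤ N / 2 := by omega
    have hhalf' : (2 : ℝ) * (N / 2 : ℕ) ≤ N := by exact_mod_cast hhalf
    have hhalf1' : (1 : ℝ) ≤ (N / 2 : ℕ) := by exact_mod_cast hhalf1
    have hpow := eight_mul_pow_le h8N (show 12 < 16 by norm_num)
    have hpos : (0 : ℝ) < (N : ℝ) ^ 12 := by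
      have : (0 : ℝ) < N := by exact_mod_cast (by omega : 0 < N)
      positivity
    have key : (N / 2 * N ^ 16 + N ^ 20 < s'.mem (src + M + q)) ↔ P (j + off) := by
      rw [abs_le] at him
      constructor
      · intro h
        by_contra hP
        rw [hzj.2 hP] at him
        have h' : ((N / 2 : ℕ) : ℝ) * N ^ 16 + N ^ 20 < s'.mem (src + M + q) := by exact_mod_cast h
        nlinarith
      · intro hP
        have h1 := hzj.1 hP
        have h' : ((N / 2 : ℕ) : ℝ) * N ^ 16 + N ^ 20 < s'.mem (src + M + q) := by nlinarith
        exact_mod_cast h'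
    refine Run.flat (fun _ => ?_) (by decide)
    simp only [Program.wp, Expr.eval_add, Expr.eval_sub, Expr.eval_mul, Expr.eval_div, Expr.eval_mod,
      Expr.eval_lt, Expr.eval_reg, Expr.eval_load, Expr.eval_const, State.put_reg, hc'.hB, hc'.hD,
      hc'.hM, hc'.hN, hj', e14, e6, e8, hq, key]
    refine ⟨by split_ifs <;> omega, trivial, ?_, ?_, ?_⟩
    · exact (h1.put).set (by omega) (by omega)
    · intro a ha
      simp only [State.set_mem, State.put_mem]
      rw [if_neg (by omega), h2 a ha]
    · intro x hx
      simp only [State.set_mem, State.put_mem]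
      by_cases hij : x = j
      · subst hij
        rw [if_pos rfl]
      · rw [if_neg (by omega)]
        exact h3 x (by omega)
  · rintro s' ⟨h1, h2, h3⟩ -
    exact ⟨h1, h2, h3⟩

/-- The sumset of two sets of numbers below `reg 7`, given as 0-1-arrays at the addresses in registers
`4` and `5`. The result, shifted down by `reg 8` and cut off at the length `reg 7`, is written to the
address in register `6`. The memory from `M = reg 2` up to `7 M` is work space: one pair of regions for
the powers of the root of unity and two pairs for the arrays of the transform. -/
def sumsetProg : Program :=
  scaleProg ;; rootProg ;; twiddleProg ;; loadProg ;; fftProg ;; squareProg ;; fftProg ;;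
    thresholdProg

lemma run_sumsetProg {v M N K p₁ p₂ out len off : ℕ} (hp : Params v M N K) {s : State}
    (h2 : s.reg 2 = M) (h3 : s.reg 3 = N) (h4 : s.reg 4 = p₁) (h5 : s.reg 5 = p₂)
    (h6 : s.reg 6 = out) (h7 : s.reg 7 = len) (h8 : s.reg 8 = off)
    (hp₁ : 7 * M ≤ p₁) (hp₂ : 7 * M ≤ p₂) (hout : 7 * M ≤ out) (hlen : 2 * len ≤ N)
    (hoff : len + off ≤ N)
    (hb₁ : ∀ i < len, s.mem (p₁ + i) ≤ 1) (hb₂ : ∀ i < len, s.mem (p₂ + i) ≤ 1) :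
    Run v sumsetProg s (2000 * N * K) (fun s' => SameReg 10 30 s s' ∧
      (∀ a, 7 * M ≤ a → a < out ∨ out + len ≤ a → s'.mem a = s.mem a) ∧
      (∀ x < len, s'.mem (out + x) ≤ 1) ∧
      ∀ x < len, s'.mem (out + x) ≠ 0 ↔ ∃ p q, p < len ∧ q < len ∧ s.mem (p₁ + p) ≠ 0 ∧
        s.mem (p₂ + q) ≠ 0 ∧ p + q = x + off) := by
  classical
  have hN8 := hp.eight_le
  have hN8' : (8 : ℝ) ≤ N := by exact_mod_cast hN8
  have hNM := hp.N_le
  have hK := hp.three_le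
  have hKN : K ≤ N := by rw [hp.N_eq]; exact Nat.lt_two_pow_self.le
  have hKK : K * K ≤ N * K := Nat.mul_le_mul_right _ hKN
  have hNK : N * 3 ≤ N * K := Nat.mul_le_mul_left _ hK
  have hN0 : (0 : ℝ) ≤ N := by linarith
  have hpow : ∀ {k l : ℕ}, k < l → (8 : ℝ) * (N : ℝ) ^ k ≤ (N : ℝ) ^ l := eight_mul_pow_le hN8
  have hpos : ∀ k : ℕ, (1 : ℝ) ≤ (N : ℝ) ^ k := fun k => one_le_pow₀ (by linarith)
  -- The errors, in units of `N ^ (-16)`: `N ^ 4` for the roots of unity, `N ^ 8` after the first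
  -- transform, `N ^ 10` after squaring, and `N ^ 12` after the second transform.
  refine Run.seq (run_scaleProg hp h2 h3) (T₂ := 1990 * N * K) ?_
    (by ring_nf at hNK ⊢; omega)
  rintro s1 - ⟨m1, r1, c1⟩
  refine Run.seq (run_rootProg hp c1) (T₂ := 1300 * N * K) ?_ (by
    ring_nf at hKK hNK ⊢; omega)
  rintro s2 - ⟨m2, r2, hζ⟩
  have c2 := c1.of_sameReg r2 (by omega)
  refine Run.seq (run_twiddleProg hp c2 hζ) (T₂ := 1200 * N * K) ?_ (by ring_nf at hNK ⊢; omega)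
  rintro s3 - ⟨r3, m3, hW⟩
  have c3 := c2.of_sameReg r3 (by omega)
  have r13 : SameReg 10 30 s s3 := ((r1.mono (by omega) (by omega)).trans
    (r2.mono (by omega) (by omega))).trans (r3.mono (by omega) (by omega))
  have m13 : ∀ a, 7 * M ≤ a → s3.mem a = s.mem a := by
    intro a ha
    rw [m3 a (by omega), m2, m1]
  refine Run.seq (run_loadProg hp c3 ((r13 4 (by omega)).trans h4) ((r13 5 (by omega)).trans h5)
    ((r13 7 (by omega)).trans h7) hp₁ hp₂ ?_ ?_) (T₂ := 1100 * N * K) ?_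
    (by ring_nf at hNK ⊢; omega)
  · intro i hi
    rw [m13 _ (by omega)]
    exact hb₁ i hi
  · intro i hi
    rw [m13 _ (by omega)]
    exact hb₂ i hi
  rintro s4 - ⟨r4, m4, e14, e15, hdata⟩
  have c4 := c3.of_sameReg r4 (by omega)
  have hx : segment s3.mem p₁ len = segment s.mem p₁ len := by
    funext i; unfold segment; rw [m13 _ (by omega)]
  have hy : segment s3.mem p₂ len = segment s.mem p₂ len := by
    funext i; unfold segment; rw [m13 _ (by omega)]
  rw [hx, hy] at hdata
  set x := segment s.mem p₁ len with hxdef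
  set y := segment s.mem p₂ len with hydef
  have hx1 : ∀ i, x i ≤ 1 := by
    intro i; rw [hxdef, segment]
    split_ifs with h
    · exact hb₁ i h
    · omega
  have hy1 : ∀ i, y i ≤ 1 := by
    intro i; rw [hydef, segment]
    split_ifs with h
    · exact hb₂ i h
    · omega
  set c : ℕ → ℂ := fun i => ⟨x i, y i⟩ with hcdef
  have hcnorm : ∀ i, ‖c i‖ ≤ 2 := by
    intro i
    refine (Complex.norm_le_abs_re_add_abs_im _).trans ?_
    have e1 : (x i : ℝ) ≤ 1 := by exact_mod_cast hx1 i
    have e2 : (y i : ℝ) ≤ 1 := by exact_mod_cast hy1 i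
    simp only [hcdef, Nat.abs_cast]
    linarith
  have hdata0 : Data (N ^ 16) (N ^ 20) M N (N ^ 6) s4.mem (s4.reg 14) c := by
    rw [e14]
    exact fun i hi => (hdata i hi).mono (by positivity)
  have hWs4 : Data (N ^ 16) (N ^ 20) M N (N ^ 4) s4.mem M (fun i => root N ^ i) :=
    hW.congr hNM fun a _ ha => m4 a (by omega)
  refine Run.seq (run_fftProg hp c4 (.inl ⟨e14, e15⟩) (G := N ^ 6) (M₀ := 2) (fun k _ => hcnorm k)
    hWs4 hdata0 ?_ ?_) (T₂ := 700 * N * K) ?_ (by ring_nf at hNK ⊢; omega)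
  · have := hpow (show 5 < 6 by norm_num)
    have := hpos 5
    rw [show (N : ℝ) ^ 4 * (N * 2) = 2 * N ^ 5 by ring]
    linarith
  · have := hpow (show 17 < 20 by norm_num)
    have := hpow (show 8 < 17 by norm_num)
    have := hpos 8
    rw [show (N : ℝ) ^ 16 * (N * 2) = 2 * N ^ 17 by ring, show (N : ℝ) ^ 2 * N ^ 6 = N ^ 8 by ring]
    linarith
  rintro s5 - ⟨r5, hsd5, m5, hdata5⟩
  have c5 := c4.of_sameReg r5 (by omega)
  set z := DFT.level (root N) c N 1 with hzdef
  have hz : ∀ i, ‖z i‖ ≤ N * 2 :=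
    DFT.norm_level_le (norm_root N) (fun k _ => hcnorm k) (one_dvd _) one_pos
  have hsrc5 : 3 * M ≤ s5.reg 14 ∧ s5.reg 14 + 2 * M ≤ 7 * M := by omega
  refine Run.seq (run_squareProg hp c5 rfl hz hdata5 (E' := N ^ 10) ?_ ?_ ?_) (T₂ := 600 * N * K) ?_
    (by ring_nf at hNK ⊢; omega)
  · have := hpow (show 8 < 16 by norm_num)
    have := hpos 8
    rw [show (N : ℝ) ^ 2 * N ^ 6 = N ^ 8 by ring]
    linarith
  · have := hpow (show 9 < 10 by norm_num)
    have := hpow (show 8 < 9 by norm_num)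
    have := hpos 8
    rw [show (N : ℝ) ^ 2 * N ^ 6 * (2 * (N * 2) + 1) = 4 * N ^ 9 + N ^ 8 by ring]
    linarith
  · have := hpow (show 9 < 20 by norm_num)
    have := hpow (show 8 < 9 by norm_num)
    have := hpow (show 18 < 20 by norm_num)
    have := hpow (show 9 < 18 by norm_num)
    have := hpos 8
    rw [show (N : ℝ) ^ 2 * N ^ 6 * (2 * (N * 2) + 1) = 4 * N ^ 9 + N ^ 8 by ring,
      show (N : ℝ) ^ 16 * (N * 2) ^ 2 = 4 * N ^ 18 by ring]
    linarith
  rintro s6 - ⟨r6, m6, hdata6⟩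
  have c6 := c5.of_sameReg r6 (by omega)
  have f14 := r6 14 (by omega)
  have f15 := r6 15 (by omega)
  have hz2 : ∀ i, ‖z i * z i‖ ≤ 4 * N ^ 2 := by
    intro i
    rw [norm_mul]
    calc ‖z i‖ * ‖z i‖ ≤ (N * 2) * (N * 2) := by gcongr <;> exact hz i
      _ = 4 * N ^ 2 := by ring
  have hWs6 : Data (N ^ 16) (N ^ 20) M N (N ^ 4) s6.mem M (fun i => root N ^ i) :=
    hWs4.congr hNM fun a _ ha => by rw [m6 a (by omega), m5 a (by omega)]
  refine Run.seq (run_fftProg hp c6 (by omega) (G := N ^ 10) (M₀ := 4 * N ^ 2) (fun k _ => hz2 k)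
    hWs6 (by rw [f14]; exact hdata6) ?_ ?_) (T₂ := 100 * N * K) ?_ (by ring_nf at hNK ⊢; omega)
  · have := hpow (show 7 < 10 by norm_num)
    have := hpos 7
    rw [show (N : ℝ) ^ 4 * (N * (4 * N ^ 2)) = 4 * N ^ 7 by ring]
    linarith
  · have := hpow (show 19 < 20 by norm_num)
    have := hpow (show 12 < 19 by norm_num)
    have := hpos 12
    rw [show (N : ℝ) ^ 16 * (N * (4 * N ^ 2)) = 4 * N ^ 19 by ring,
      show (N : ℝ) ^ 2 * N ^ 10 = N ^ 12 by ring]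
    linarith
  rintro s7 - ⟨r7, hsd7, m7, hdata7⟩
  have c7 := c6.of_sameReg r7 (by omega)
  have r17 : SameReg 10 30 s s7 := (((r13.trans (r4.mono (by omega) (by omega))).trans
    (r5.mono (by omega) (by omega))).trans (r6.mono (by omega) (by omega))).trans
    (r7.mono (by omega) (by omega))
  have m17 : ∀ a, 7 * M ≤ a → s7.mem a = s.mem a := by
    intro a ha
    rw [m7 a (by omega), m6 a (by omega), m5 a (by omega), m4 a (by omega), m13 a ha]
  rw [show (N : ℝ) ^ 2 * N ^ 10 = N ^ 12 by ring] at hdata7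
  have hroot : IsPrimitiveRoot (root N) N := Complex.isPrimitiveRoot_exp N (by omega)
  have hiff : ∀ k, (∃ p q, p < len ∧ q < len ∧ x p ≠ 0 ∧ y q ≠ 0 ∧ p + q = k) ↔
      ∃ p q, p < len ∧ q < len ∧ s.mem (p₁ + p) ≠ 0 ∧ s.mem (p₂ + q) ≠ 0 ∧ p + q = k := by
    intro k
    refine exists_congr fun p => exists_congr fun q => and_congr_right fun hpl =>
      and_congr_right fun hql => ?_
    simp only [hxdef, hydef, segment, if_pos hpl, if_pos hql]
  refine (run_thresholdProg hp c7 rfl ((r17 6 (by omega)).trans h6) ((r17 7 (by omega)).trans h7)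
    ((r17 8 (by omega)).trans h8) (by omega) (by omega) hdata7
    (P := fun k => ∃ p q, p < len ∧ q < len ∧ x p ≠ 0 ∧ y q ≠ 0 ∧ p + q = k) ?_).mono
    (by ring_nf at hNK ⊢; omega) ?_
  · intro k hk
    refine DFT.im_level_square hroot ?_ ?_ hlen (by omega) hcdef
    · intro i _ hi
      simp only [hxdef, segment, if_neg (not_lt.2 hi)]
    · intro i _ hi
      simp only [hydef, segment, if_neg (not_lt.2 hi)]
  · rintro s8 - ⟨r8, m8, hres⟩
    refine ⟨r17.trans (r8.mono (by omega) (by omega)), ?_, ?_, ?_⟩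
    · intro a ha ha'
      rw [m8 a ha', m17 a ha]
    · intro k hk
      rw [hres k hk]
      split_ifs <;> omega
    · intro k hk
      rw [hres k hk, ← hiff]
      split_ifs with h
      · exact iff_of_true one_ne_zero h
      · exact iff_of_false (by simp) h

end WordRAM

/-! ### Windows and the doubling phase -/

namespace WordRAM
open WordRAM.Expr (reg load)

/-- The array at address `p` describes the window of radius `2 m` around `t` of the semigroup generated
by `A`: entry `x` is `1` or `0` according to whether `t - 2 m + x` is an element. -/
def Win (A : Set ℕ) (m : ℕ) (mem : ℕ → ℕ) (p t : ℕ) : Prop :=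
  ∀ x ≤ 4 * m, mem (p + x) ≤ 1 ∧ (mem (p + x) ≠ 0 ↔ t - 2 * m + x ∈ AddSubmonoid.closure A)

lemma Win.congr {A : Set ℕ} {m p t : ℕ} {mem mem' : ℕ → ℕ} (h : Win A m mem p t)
    (hm : ∀ a, p ≤ a → a ≤ p + 4 * m → mem' a = mem a) : Win A m mem' p t := by
  intro x hx
  rw [hm _ (by omega) (by omega)]
  exact h x hx

/-- The registers that stay fixed while windows are computed. -/
structure Base (m N : ℕ) (s : State) : Prop where
  h1 : s.reg 1 = m
  h2 : s.reg 2 = 32 * m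
  h3 : s.reg 3 = N
  h7 : s.reg 7 = 4 * m + 1
  h8 : s.reg 8 = 2 * m

lemma Base.of_eq {m N : ℕ} {s s' : State} (h : Base m N s)
    (hs : ∀ r, r = 1 ∨ r = 2 ∨ r = 3 ∨ r = 7 ∨ r = 8 → s'.reg r = s.reg r) : Base m N s' :=
  ⟨by rw [hs _ (by omega), h.h1], by rw [hs _ (by omega), h.h2], by rw [hs _ (by omega), h.h3],
    by rw [hs _ (by omega), h.h7], by rw [hs _ (by omega), h.h8]⟩

lemma Base.of_sameReg {m N lo hi : ℕ} {s s' : State} (h : Base m N s) (hs : SameReg lo hi s s')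
    (hlo : 9 ≤ lo) : Base m N s' :=
  h.of_eq fun r hr => hs r (by omega)

section

variable {A : Set ℕ} {v m N K F : ℕ}

lemma run_windowSum (hm : 0 < m) (hA : ∀ g ∈ A, g ≤ m) (hp : Params v (32 * m) N K)
    (hN : 2 * (4 * m + 1) ≤ N) {s : State} (hb : Base m N s) {p q out t u : ℕ} (h4 : s.reg 4 = p)
    (h5 : s.reg 5 = q) (h6 : s.reg 6 = out) (h4' : 7 * (32 * m) ≤ p) (h5' : 7 * (32 * m) ≤ q)
    (h6' : 7 * (32 * m) ≤ out) (ht : 2 * m ≤ t) (hu : 2 * m ≤ u) (hwp : Win A m s.mem p t)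
    (hwq : Win A m s.mem q u) :
    Run v sumsetProg s (2000 * N * K) (fun s' => SameReg 10 30 s s' ∧
      (∀ a, 7 * (32 * m) ≤ a → a < out ∨ out + 32 * m ≤ a → s'.mem a = s.mem a) ∧
      Win A m s'.mem out (t + u)) := by
  refine (run_sumsetProg hp hb.h2 hb.h3 h4 h5 h6 hb.h7 hb.h8 h4' h5' h6' hN (by omega)
    (fun i hi => (hwp i (by omega)).1) (fun i hi => (hwq i (by omega)).1)).mono le_rfl ?_
  rintro s' - ⟨g1, g2, g3, g4⟩
  refine ⟨g1, fun a ha ha' => g2 a ha (by omega), fun x hx => ⟨g3 x (by omega), ?_⟩⟩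
  rw [g4 x (by omega), mem_window_iff hm hA ht hu hx]
  constructor
  · rintro ⟨y, z, hy, hz, hy', hz', h⟩
    exact ⟨y, by omega, z, by omega, (hwp y (by omega)).2.1 hy', (hwq z (by omega)).2.1 hz', h⟩
  · rintro ⟨y, hy, z, hz, hy', hz', h⟩
    exact ⟨y, z, by omega, by omega, (hwp y hy).2.2 hy', (hwq z hz).2.2 hz', h⟩

/-- Register `35` shows whether the upper half of the window at `reg 38` is full. -/
def fullProg : Program :=
  35 ≔ 1 ;; .forLoop 36 (reg 1) (35 ≔ reg 35 * load (reg 38 + 2 * reg 1 + reg 36))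

lemma run_fullProg (hm : 0 < m) (hmA : m ∈ A) (hF : FrobeniusNumber F A) (hv : m < 2 ^ v)
    {s : State} (hb : Base m N s) {p t : ℕ} (h38 : s.reg 38 = p) (ht : 2 * m ≤ t)
    (hw : Win A m s.mem p t) :
    Run v fullProg s (30 * m + 20) (fun s' => s'.mem = s.mem ∧ SameReg 35 37 s s' ∧
      (s'.reg 35 ≠ 0 ↔ F < t)) := by
  let I : ℕ → State → Prop := fun j s' => s'.mem = s.mem ∧ SameReg 35 37 s s' ∧ s'.reg 35 ≤ 1 ∧
    (s'.reg 35 ≠ 0 ↔ ∀ i < j, t + i ∈ AddSubmonoid.closure A)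
  have h1v : 1 < 2 ^ v := by omega
  refine Run.seq (T₁ := 2) (T₂ := 30 * m + 10) (R := fun s' => s' = s.set 35 1)
    (Run.flat (fun _ => ⟨by simpa using h1v, rfl⟩) (by decide)) ?_ (by omega)
  rintro s1 - rfl
  refine Run.forLoop (n := m) (Tb := 20) I hv ?_ ?_ ?_ ?_ (by simp only [Expr.cost]; omega)
  · exact ⟨rfl, ((SameReg.refl _ _ _).set (by omega) (by omega)).set (by omega) (by omega), by simp,
      by simp⟩
  · rintro j s' ⟨-, h2, -⟩
    exact (h2 1 (by omega)).trans hb.h1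
  · rintro j s' hBd hj ⟨g1, g2, g3, g4⟩ hj'
    have e1 : s'.reg 1 = m := (g2 1 (by omega)).trans hb.h1
    have e38 : s'.reg 38 = p := (g2 38 (by omega)).trans h38
    obtain ⟨w1, w2⟩ := hw (2 * m + j) (by omega)
    rw [← add_assoc, ← g1] at w1 w2
    rw [show t - 2 * m + (2 * m + j) = t + j by omega] at w2
    have hle : s'.reg 35 * s'.mem (p + 2 * m + j) ≤ 1 := by
      calc _ ≤ 1 * 1 := Nat.mul_le_mul g3 w1
        _ = 1 := rfl
    refine Run.flat (fun _ => ?_) (by decide)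
    simp only [Program.wp, Expr.eval_mul, Expr.eval_add, Expr.eval_reg, Expr.eval_load,
      Expr.eval_const, e1, e38, hj', State.set_reg, Nat.reduceEqDiff, reduceIte]
    refine ⟨by omega, trivial, g1, (g2.set (by omega) (by omega)).set (by omega) (by omega),
      by simpa using hle, ?_⟩
    simp only [State.set_reg, Nat.reduceEqDiff, reduceIte]
    rw [mul_ne_zero_iff, g4, w2]
    constructor
    · rintro ⟨h1, h2⟩ i hi
      rcases Nat.lt_succ_iff_lt_or_eq.1 hi with h | rfl
      · exact h1 i h
      · exact h2
    · exact fun h => ⟨fun i hi => h i (by omega), h j (by omega)⟩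
  · rintro s' ⟨g1, g2, -, g4⟩ -
    exact ⟨g1, g2, g4.trans (full_iff hm (AddSubmonoid.subset_closure hmA) hF t)⟩

/-- The doubling phase: windows around `2 m, 4 m, 8 m, …` are computed until one of them has a full
upper half. Register `30` holds the address of the current window, register `31` its centre. -/
def doublingProg : Program :=
  (30 ≔ 7 * reg 2 ;; 31 ≔ 2 * reg 1 ;; 7 ≔ 4 * reg 1 + 1 ;; 8 ≔ 2 * reg 1 ;; 38 ≔ reg 30) ;;
  fullProg ;;
  .loop (.bin .eq (reg 35) 0)
    ((4 ≔ reg 30 ;; 5 ≔ reg 30 ;; 30 ≔ reg 30 + reg 2 ;; 6 ≔ reg 30 ;; 31 ≔ 2 * reg 31 ;;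
      38 ≔ reg 30) ;; sumsetProg ;; fullProg)

/-- The windows around `2 ^ j * (2 * m)` for `j ≤ i` lie in consecutive memory regions. -/
def Windows (A : Set ℕ) (m i : ℕ) (mem : ℕ → ℕ) : Prop :=
  ∀ j ≤ i, Win A m mem ((7 + j) * (32 * m)) (2 ^ j * (2 * m))

lemma run_doublingProg (hm : 0 < m) (hA : ∀ g ∈ A, g ≤ m) (hmA : m ∈ A) (hF : FrobeniusNumber F A)
    (hp : Params v (32 * m) N K) (hN : 2 * (4 * m + 1) ≤ N) {k : ℕ} (hk : F < 2 ^ k * (2 * m))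
    (hk' : ∀ j < k, 2 ^ j * (2 * m) ≤ F) (hkv : (8 + k) * (32 * m) < 2 ^ v)
    (hkv' : 2 ^ k * (2 * m) < 2 ^ v) {s : State} (h1 : s.reg 1 = m) (h2 : s.reg 2 = 32 * m)
    (h3 : s.reg 3 = N) (hw : Win A m s.mem (7 * (32 * m)) (2 * m)) :
    Run v doublingProg s ((k + 1) * (2000 * N * K + 30 * m + 100)) (fun s' =>
      Base m N s' ∧ Windows A m k s'.mem ∧ s'.reg 30 = (7 + k) * (32 * m) ∧
      s'.reg 31 = 2 ^ k * (2 * m)) := by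
  have hMv := hp.M_lt
  have hpow : ∀ i ≤ k, 2 ^ i * (2 * m) ≤ 2 ^ k * (2 * m) := fun i hi =>
    Nat.mul_le_mul_right _ (Nat.pow_le_pow_right (by norm_num) hi)
  have hslot : ∀ i ≤ k, (7 + i) * (32 * m) + 32 * m ≤ (8 + k) * (32 * m) := by
    intro i hi
    calc _ = (8 + i) * (32 * m) := by ring
      _ ≤ _ := Nat.mul_le_mul_right _ (by omega)
  let J : ℕ → State → Prop := fun i s' => Base m N s' ∧ Windows A m i s'.mem ∧
    s'.reg 30 = (7 + i) * (32 * m) ∧ s'.reg 31 = 2 ^ i * (2 * m) ∧ i ≤ k ∧ s'.reg 38 = s'.reg 30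
  let I : ℕ → State → Prop := fun i s' => J i s' ∧ (s'.reg 35 ≠ 0 ↔ F < 2 ^ i * (2 * m))
  -- the test at the end of each round
  have hfull : ∀ i s', J i s' → Run v fullProg s' (30 * m + 20) (I i) := by
    rintro i s' ⟨g1, g2, g3, g4, g5, g6⟩
    refine (run_fullProg hm hmA hF (by omega) g1 (g6.trans g3)
      (Nat.le_mul_of_pos_left _ (by positivity)) (g2 i le_rfl)).mono le_rfl ?_
    rintro s'' - ⟨f1, f2, f3⟩
    exact ⟨⟨g1.of_sameReg f2 (by omega), by rw [f1]; exact g2, by rw [f2 30 (by omega), g3],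
      by rw [f2 31 (by omega), g4], g5, by rw [f2 38 (by omega), f2 30 (by omega), g6]⟩, f3⟩
  set T := 2000 * N * K + 30 * m + 100 with hT
  refine Run.seq (T₁ := 30) (T₂ := k * T + 30 * m + 70) (R := J 0)
    (Run.flat (fun _ => ?_) (by decide)) ?_ (by rw [add_mul]; omega)
  · simp only [Program.wp, Expr.eval_mul, Expr.eval_add, Expr.eval_reg, Expr.eval_const, State.set_reg,
      Nat.reduceEqDiff, reduceIte, h1, h2]
    refine ⟨by omega, by omega, by omega, by omega, by omega, ⟨?_, ?_, ?_, ?_, ?_⟩, ?_, ?_, ?_,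
      Nat.zero_le _, ?_⟩
    · simp [h1]
    · simp [h2]
    · simp [h3]
    · simp
    · simp
    · intro j hj
      obtain rfl : j = 0 := by omega
      simpa using hw
    · simp
    · simp
    · simp
  rintro s1 - hJ
  refine Run.seq (T₂ := k * T + 10) (hfull 0 s1 hJ) ?_ (by omega)
  rintro s2 - hI
  refine Run.loop I (fun i => (k - i) * T + 10) ?_ ?_ 0 s2 hI (by simp)
  · rintro i s' - ⟨⟨g1, g2, g3, g4, g5, g6⟩, g7⟩ h0
    have h35 : s'.reg 35 ≠ 0 := by
      intro h
      simp [h] at h0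
    obtain rfl : i = k := by
      by_contra hne
      have := hk' i (by omega)
      have := g7.1 h35
      omega
    exact ⟨⟨g1, g2, g3, g4⟩, by simp [Expr.cost]⟩
  · rintro i s' hBd ⟨⟨g1, g2, g3, g4, g5, g6⟩, g7⟩ h0
    have h35 : s'.reg 35 = 0 := by
      by_contra h
      simp [h] at h0
    have hik : i < k := by
      by_contra hne
      obtain rfl : i = k := by omega
      exact g7.2 hk h35
    have hs := hslot i hik.le
    have ht : 2 * m ≤ 2 ^ i * (2 * m) := Nat.le_mul_of_pos_left _ (by positivity)
    have hpp : 2 * (2 ^ i * (2 * m)) = 2 ^ (i + 1) * (2 * m) := by rw [pow_succ]; ring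
    have hsl : (7 + i) * (32 * m) + 32 * m = (7 + (i + 1)) * (32 * m) := by ring
    have h7 : 7 * (32 * m) ≤ (7 + i) * (32 * m) := Nat.mul_le_mul_right _ (by omega)
    have hb30 := hBd.reg 30
    have hpk := hpow (i + 1) hik
    refine ⟨T - 10, Run.seq (T₁ := 30) (T₂ := 2000 * N * K + 30 * m + 30)
      (R := fun t => Base m N t ∧ t.mem = s'.mem ∧ t.reg 4 = (7 + i) * (32 * m) ∧
        t.reg 5 = (7 + i) * (32 * m) ∧ t.reg 6 = (7 + (i + 1)) * (32 * m) ∧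
        t.reg 30 = (7 + (i + 1)) * (32 * m) ∧ t.reg 31 = 2 ^ (i + 1) * (2 * m) ∧
        t.reg 38 = (7 + (i + 1)) * (32 * m))
      (Run.flat (fun _ => ?_) (by decide)) ?_ (by omega)⟩
    · simp only [Program.wp, Expr.eval_mul, Expr.eval_add, Expr.eval_reg, Expr.eval_const,
        State.set_reg, Nat.reduceEqDiff, reduceIte, g3, g4, g1.h2, hsl, hpp]
      refine ⟨by omega, by omega, by omega, by omega, by omega, by omega, ?_, rfl, ?_⟩
      · refine g1.of_eq fun r hr => ?_
        simp only [State.set_reg]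
        iterate 6 rw [if_neg (by omega)]
      · simp
    rintro t - ⟨b1, b2, b4, b5, b6, b30, b31, b38⟩
    refine Run.seq (T₂ := 30 * m + 20) (run_windowSum hm hA hp hN b1 b4 b5 b6 h7 h7 (by omega) ht ht
      (by rw [b2]; exact g2 i le_rfl) (by rw [b2]; exact g2 i le_rfl)) ?_ (by omega)
    rintro t' - ⟨c1, c2, c3⟩
    refine (hfull (i + 1) t' ⟨b1.of_eq fun r hr => c1 r (by omega), ?_, by rw [c1 30 (by omega), b30],
      by rw [c1 31 (by omega), b31], hik, by rw [c1 38 (by omega), c1 30 (by omega), b38, b30]⟩).mono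
      le_rfl ?_
    · intro j hj
      rcases Nat.lt_or_ge i j with h | h
      · obtain rfl : j = i + 1 := by omega
        rwa [← two_mul, hpp] at c3
      · have hj7 : 7 * (32 * m) ≤ (7 + j) * (32 * m) := Nat.mul_le_mul_right _ (by omega)
        have hji : (7 + j) * (32 * m) ≤ (7 + i) * (32 * m) := Nat.mul_le_mul_right _ (by omega)
        refine (g2 j h).congr fun a ha ha' => ?_
        rw [c2 a (by omega) (by omega), b2]
    · intro t'' _ hI'
      refine ⟨i + 1, hI', ?_⟩
      have : (k - i) * T = T + (k - (i + 1)) * T := by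
        rw [show k - i = (k - (i + 1)) + 1 by omega]; ring
      simp only [Expr.cost]
      show T - 10 + 3 + 1 + ((k - (i + 1)) * T + 10) ≤ (k - i) * T + 10
      omega

end

end WordRAM

/-! ### The binary search -/

namespace WordRAM
open WordRAM.Expr (reg load)

section

variable {A : Set ℕ} {v m N K F : ℕ}

/-- The binary search: starting from the last window whose upper half is not full, the centre (register
`33`) is moved upwards by the radii `2 ^ j * (2 * m)` with decreasing `j`, as long as the Frobenius
number is not passed. Register `30` holds the address of the current window, register `32` that of the
next window to be added, and register `34` that of the next free memory region. -/
def searchProg : Program :=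
  (34 ≔ reg 30 + reg 2 ;;
    .ite (.bin .lt (7 * reg 2) (reg 30)) (30 ≔ reg 30 - reg 2 ;; 31 ≔ reg 31 / 2) .nop ;;
    32 ≔ reg 30 ;; 33 ≔ reg 31) ;;
  .loop (.bin .lt (7 * reg 2) (reg 32))
    ((32 ≔ reg 32 - reg 2 ;; 31 ≔ reg 31 / 2 ;; 4 ≔ reg 30 ;; 5 ≔ reg 32 ;; 6 ≔ reg 34 ;;
      38 ≔ reg 34) ;; sumsetProg ;; fullProg ;;
      (.ite (reg 35) .nop (30 ≔ reg 34 ;; 33 ≔ reg 33 + reg 31) ;; 34 ≔ reg 34 + reg 2))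

/-- The state of the binary search when the Frobenius number is known to be less than
`2 ^ j * (2 * m)` above the current centre. -/
structure Search (A : Set ℕ) (m N F k j : ℕ) (s : State) : Prop where
  base : Base m N s
  windows : Windows A m k s.mem
  h32 : s.reg 32 = (7 + j) * (32 * m)
  h31 : s.reg 31 = 2 ^ j * (2 * m)
  win : Win A m s.mem (s.reg 30) (s.reg 33)
  le_cur : 7 * (32 * m) ≤ s.reg 30
  cur_lt : s.reg 30 + 32 * m ≤ s.reg 34
  le_next : (8 + k) * (32 * m) ≤ s.reg 34
  next_le : s.reg 34 + j * (32 * m) ≤ (8 + 2 * k) * (32 * m)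
  two_mul_le : 2 * m ≤ s.reg 33
  le_F : s.reg 33 - 2 * m ≤ F
  F_lt : F < s.reg 33 + 2 ^ j * (2 * m)

lemma run_searchProg (hm : 0 < m) (hA : ∀ g ∈ A, g ≤ m) (hmA : m ∈ A) (hF : FrobeniusNumber F A)
    (hp : Params v (32 * m) N K) (hN : 2 * (4 * m + 1) ≤ N) {k : ℕ} (hk : F < 2 ^ k * (2 * m))
    (hk' : ∀ j < k, 2 ^ j * (2 * m) ≤ F) (hkv : (9 + 2 * k) * (32 * m) < 2 ^ v)
    (hFv : F + 2 * m < 2 ^ v) {s : State} (hb : Base m N s) (hw : Windows A m k s.mem)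
    (h30 : s.reg 30 = (7 + k) * (32 * m)) (h31 : s.reg 31 = 2 ^ k * (2 * m)) :
    Run v searchProg s ((k + 1) * (2000 * N * K + 30 * m + 100)) (Search A m N F k 0) := by
  have hMv := hp.M_lt
  have e8 : (8 + k) * (32 * m) = 8 * (32 * m) + k * (32 * m) := by ring
  have e7 : (7 + k) * (32 * m) = 7 * (32 * m) + k * (32 * m) := by ring
  have e82 : (8 + 2 * k) * (32 * m) = 8 * (32 * m) + k * (32 * m) + k * (32 * m) := by ring
  have e92 : (9 + 2 * k) * (32 * m) = 9 * (32 * m) + k * (32 * m) + k * (32 * m) := by ring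
  set T := 2000 * N * K + 30 * m + 100 with hT
  refine Run.seq (T₁ := 60) (T₂ := k * T + 10) (R := Search A m N F k (k - 1))
    (Run.flat (fun hB => ?_) (by decide)) ?_ (by rw [add_mul]; omega)
  · have hb31 := hB.reg 31
    simp only [Program.wp, Expr.eval_mul, Expr.eval_add, Expr.eval_sub, Expr.eval_div, Expr.eval_lt,
      Expr.eval_reg, Expr.eval_const, State.set_reg, Nat.reduceEqDiff, reduceIte, hb.h2, h30, h31]
    refine ⟨by omega, fun h0 => ?_, fun h0 => ?_⟩
    · have hk0 : 0 < k := by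
        rcases Nat.eq_zero_or_pos k with rfl | h
        · simp at h0
        · exact h
      obtain ⟨i, rfl⟩ : ∃ i, k = i + 1 := ⟨k - 1, by omega⟩
      have hi := hk' i (by omega)
      have hpp : 2 ^ (i + 1) * (2 * m) / 2 = 2 ^ i * (2 * m) := by
        rw [pow_succ, show 2 ^ i * 2 * (2 * m) = 2 ^ i * (2 * m) * 2 by ring,
          Nat.mul_div_cancel _ (by norm_num)]
      have hcc : (7 + (i + 1)) * (32 * m) - 32 * m = (7 + i) * (32 * m) := by
        rw [Nat.sub_eq_iff_eq_add (by omega)]; ring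
      have e7' : (7 + i) * (32 * m) = 7 * (32 * m) + i * (32 * m) := by ring
      have ek : (i + 1) * (32 * m) = i * (32 * m) + 32 * m := by ring
      have ht : 2 * m ≤ 2 ^ i * (2 * m) := Nat.le_mul_of_pos_left _ (by positivity)
      have hpp2 : 2 ^ (i + 1) * (2 * m) = 2 ^ i * (2 * m) + 2 ^ i * (2 * m) := by
        rw [pow_succ]; ring
      rw [hpp, hcc]
      refine ⟨by omega, by omega, by omega, by omega, ⟨?_, hw, ?_, ?_, ?_, ?_, ?_, ?_, ?_, ?_, ?_, ?_⟩⟩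
      · refine hb.of_eq fun r hr => ?_
        simp only [State.set_reg]
        iterate 5 rw [if_neg (by omega)]
      all_goals
        simp only [State.set_reg, State.set_mem, Nat.reduceEqDiff, reduceIte, Nat.add_sub_cancel]
      · exact hw i (by omega)
      all_goals omega
    · have hk0 : k = 0 := by
        by_contra h
        have : 1 * (32 * m) ≤ k * (32 * m) := Nat.mul_le_mul_right _ (by omega)
        rw [if_pos (by omega)] at h0
        omega
      subst hk0
      refine ⟨by omega, by omega, ⟨?_, hw, ?_, ?_, ?_, ?_, ?_, ?_, ?_, ?_, ?_, ?_⟩⟩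
      · refine hb.of_eq fun r hr => ?_
        simp only [State.set_reg]
        iterate 3 rw [if_neg (by omega)]
      all_goals
        simp only [State.set_reg, State.set_mem, Nat.reduceEqDiff, reduceIte, h30, h31]
      · exact hw 0 le_rfl
      all_goals simp only [pow_zero, one_mul] at *
      all_goals omega
  rintro s1 - hS
  refine Run.loop (Search A m N F k) (fun i => i * T + 10) ?_ ?_ (k - 1) s1 hS
    (by have := Nat.mul_le_mul_right T (Nat.sub_le k 1); omega)
  · rintro i s' - hS h0
    obtain rfl : i = 0 := by
      by_contra h
      have : (7 + i) * (32 * m) = 7 * (32 * m) + i * (32 * m) := by ring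
      have : 1 * (32 * m) ≤ i * (32 * m) := Nat.mul_le_mul_right _ (by omega)
      simp only [Expr.eval_mul, Expr.eval_lt, Expr.eval_reg, Expr.eval_const, hS.base.h2, hS.h32] at h0
      rw [if_pos (by omega)] at h0
      omega
    exact ⟨hS, by simp [Expr.cost]⟩
  · rintro i s' hBd hS h0
    have hi0 : i ≠ 0 := by
      rintro rfl
      simp [hS.base.h2, hS.h32] at h0
    obtain ⟨j, rfl⟩ : ∃ j, i = j + 1 := ⟨i - 1, by omega⟩
    have hpp : 2 ^ (j + 1) * (2 * m) / 2 = 2 ^ j * (2 * m) := by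
      rw [pow_succ, show 2 ^ j * 2 * (2 * m) = 2 ^ j * (2 * m) * 2 by ring,
        Nat.mul_div_cancel _ (by norm_num)]
    have hpp2 : 2 ^ (j + 1) * (2 * m) = 2 ^ j * (2 * m) + 2 ^ j * (2 * m) := by
      rw [pow_succ]; ring
    have e7i : (7 + (j + 1)) * (32 * m) = 7 * (32 * m) + j * (32 * m) + 32 * m := by ring
    have e7j : (7 + j) * (32 * m) = 7 * (32 * m) + j * (32 * m) := by ring
    have hcc : (7 + (j + 1)) * (32 * m) - 32 * m = (7 + j) * (32 * m) := by omega
    have ej : (j + 1) * (32 * m) = j * (32 * m) + 32 * m := by ring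
    have hu : 2 * m ≤ 2 ^ j * (2 * m) := Nat.le_mul_of_pos_left _ (by positivity)
    have hb30 := hBd.reg 30
    have hb31 := hBd.reg 31
    have hb32 := hBd.reg 32
    have hb34 := hBd.reg 34
    obtain ⟨base, windows, h32, h31, win, le_cur, cur_lt, le_next, next_le, tml, le_F, F_lt⟩ := hS
    rw [h31] at hb31
    rw [h32] at hb32
    have hjk : j < k := by
      by_contra h
      have : k * (32 * m) ≤ j * (32 * m) := Nat.mul_le_mul_right _ (by omega)
      omega
    have hjk' : (j + 1) * (32 * m) ≤ k * (32 * m) := Nat.mul_le_mul_right _ (by omega)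
    set cur := s'.reg 30 with hcur
    set nxt := s'.reg 34 with hnxt
    set lo := s'.reg 33 with hlo
    refine ⟨T - 10, Run.seq (T₁ := 22) (T₂ := 2000 * N * K + 30 * m + 40)
      (R := fun t => Base m N t ∧ t.mem = s'.mem ∧ t.reg 4 = cur ∧
        t.reg 5 = (7 + j) * (32 * m) ∧ t.reg 6 = nxt ∧ t.reg 30 = cur ∧
        t.reg 31 = 2 ^ j * (2 * m) ∧ t.reg 32 = (7 + j) * (32 * m) ∧ t.reg 33 = lo ∧
        t.reg 34 = nxt ∧ t.reg 38 = nxt)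
      (Run.flat (fun _ => ?_) (by decide)) ?_ (by omega)⟩
    · simp only [Program.wp, Expr.eval_sub, Expr.eval_div, Expr.eval_reg, Expr.eval_const,
        State.set_reg, Nat.reduceEqDiff, reduceIte, base.h2, h31, h32, hcc, hpp]
      refine ⟨by omega, by omega, by omega, by omega, by omega, by omega, ?_, rfl, ?_⟩
      · refine base.of_eq fun r hr => ?_
        simp only [State.set_reg]
        iterate 6 rw [if_neg (by omega)]
      · simp [← hcur, ← hnxt, ← hlo]
    rintro t - ⟨b1, b2, b4, b5, b6, b30, b31, b32, b33, b34, b38⟩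
    refine Run.seq (T₂ := 30 * m + 40) (run_windowSum hm hA hp hN b1 b4 b5 b6 le_cur (by omega)
      (by omega) tml hu (by rw [b2]; exact win) (by rw [b2]; exact windows j hjk.le)) ?_ (by omega)
    rintro t' - ⟨c1, c2, c3⟩
    have d1 : Base m N t' := b1.of_eq fun r hr => c1 r (by omega)
    refine Run.seq (T₂ := 20) (run_fullProg hm hmA hF (by omega) d1
      ((c1 38 (by omega)).trans b38) (by omega) c3) ?_ (by omega)
    rintro t'' - ⟨f1, f2, f3⟩
    have e1 : Base m N t'' := d1.of_sameReg f2 (by omega)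
    have reg_eq : ∀ r, 30 ≤ r → r < 35 → t''.reg r = t.reg r := fun r h h' => by
      rw [f2 r (by omega), c1 r (by omega)]
    have e30 := (reg_eq 30 (by omega) (by omega)).trans b30
    have e31 := (reg_eq 31 (by omega) (by omega)).trans b31
    have e32 := (reg_eq 32 (by omega) (by omega)).trans b32
    have e33 := (reg_eq 33 (by omega) (by omega)).trans b33
    have e34 := (reg_eq 34 (by omega) (by omega)).trans b34
    have hwin : Windows A m k t''.mem := by
      intro l hl
      have e7l : (7 + l) * (32 * m) = 7 * (32 * m) + l * (32 * m) := by ring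
      have hlk : l * (32 * m) ≤ k * (32 * m) := Nat.mul_le_mul_right _ hl
      refine (windows l hl).congr fun a ha ha' => ?_
      rw [f1, c2 a (by omega) (by omega), b2]
    have hcurw : Win A m t''.mem cur lo := win.congr fun a ha ha' => by
      rw [f1, c2 a (by omega) (by omega), b2]
    rw [← f1] at c3
    have hΦ : T - 10 + (Expr.bin .lt (7 * reg 2) (reg 32)).cost + 1 + (j * T + 10) ≤
        (j + 1) * T + 10 := by
      rw [add_mul]
      simp only [Expr.cost]
      show T - 10 + (1 + 1 + 1 + 1 + 1) + 1 + (j * T + 10) ≤ _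
      omega
    refine Run.flat (fun _ => ?_) (by decide)
    simp only [Program.wp, Expr.eval_add, Expr.eval_reg, State.set_reg, Nat.reduceEqDiff, reduceIte,
      e31, e33, e34, e1.h2, f3]
    constructor
    · refine fun hlt => ⟨by omega, j, ⟨?_, hwin, ?_, ?_, ?_, ?_, ?_, ?_, ?_, ?_, ?_, ?_⟩, hΦ⟩
      · refine e1.of_eq fun r hr => ?_
        simp only [State.set_reg]
        rw [if_neg (by omega)]
      all_goals
        simp only [State.set_reg, State.set_mem, Nat.reduceEqDiff, reduceIte, e30, e31, e32, e33]
      · exact hcurw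
      all_goals omega
    · intro h35
      have hge : lo + 2 ^ j * (2 * m) ≤ F := by
        by_contra h
        exact f3.2 (by omega) h35
      refine ⟨by omega, by omega, by omega, j, ⟨?_, hwin, ?_, ?_, ?_, ?_, ?_, ?_, ?_, ?_, ?_, ?_⟩, hΦ⟩
      · refine e1.of_eq fun r hr => ?_
        simp only [State.set_reg]
        iterate 3 rw [if_neg (by omega)]
      all_goals
        simp only [State.set_reg, State.set_mem, Nat.reduceEqDiff, reduceIte, e31, e32]
      · exact c3
      all_goals omega

/-- Register `0` becomes the last non-element of the current window. -/
def scanProg : Program :=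
  .forLoop 36 (reg 7) (.ite (load (reg 30 + reg 36)) .nop (0 ≔ reg 33 + reg 36 - 2 * reg 1))

lemma run_scanProg (hF : FrobeniusNumber F A) (hv : 4 * m + 1 < 2 ^ v) (hFv : F < 2 ^ v) {k : ℕ}
    {s : State} (hS : Search A m N F k 0 s) :
    Run v scanProg s (200 * m + 100) (fun s' => s'.reg 0 = F) := by
  have hlt := hS.F_lt
  have hle := hS.le_F
  have h2 := hS.two_mul_le
  let I : ℕ → State → Prop := fun j s' => s'.mem = s.mem ∧ (∀ r, r ≠ 0 → r ≠ 36 → s'.reg r = s.reg r) ∧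
    (F < s.reg 33 - 2 * m + j → s'.reg 0 = F)
  refine Run.forLoop (n := 4 * m + 1) (Tb := 20) I hv ?_ ?_ ?_ ?_ (by simp only [Expr.cost]; omega)
  · exact ⟨rfl, fun r _ hr => by simp [hr], by intro h; omega⟩
  · rintro j s' ⟨-, g, -⟩
    exact (g 7 (by omega) (by omega)).trans hS.base.h7
  · rintro j s' - hj ⟨g1, g2, g3⟩ hj'
    obtain ⟨-, w⟩ := hS.win j (by omega)
    have e1 := (g2 1 (by omega) (by omega)).trans hS.base.h1
    have e30 := g2 30 (by omega) (by omega)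
    have e33 := g2 33 (by omega) (by omega)
    refine Run.flat (fun _ => ?_) (by decide)
    simp only [Program.wp, Expr.eval_mul, Expr.eval_add, Expr.eval_sub, Expr.eval_reg, Expr.eval_load,
      Expr.eval_const, e1, e30, e33, hj', g1]
    constructor
    · intro h
      have hne : F ≠ s.reg 33 - 2 * m + j := fun h' => hF.1 (h' ▸ w.1 h)
      refine ⟨trivial, g1, fun r hr hr' => ?_, fun h' => ?_⟩
      · rw [State.set_reg, if_neg hr', g2 r hr hr']
      · rw [State.set_reg, if_neg (by omega), g3 (by omega)]
    · intro h
      have hn : s.reg 33 - 2 * m + j ≤ F := hF.2 (fun h' => w.2 h' h)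
      refine ⟨by omega, by simp [hj'], g1, fun r hr hr' => ?_, fun h' => ?_⟩
      · rw [State.set_reg, if_neg hr', State.set_reg, if_neg hr, g2 r hr hr']
      · simp only [State.set_reg, Nat.reduceEqDiff, reduceIte]
        omega
  · rintro s' ⟨-, -, g⟩ -
    exact g (by simp only [pow_zero, one_mul] at hlt; omega)

end

end WordRAM

/-! ### The initial segment of the semigroup -/

namespace WordRAM
open WordRAM.Expr (reg load)

/-- The array of the semigroup is set up: entry `x` of region `7` becomes `1` if `x` is `0` or a
generator. Register `1` receives the largest generator and register `2` the length of the memory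
regions. -/
def initProg : Program :=
  (1 ≔ load (reg 0) ;; 2 ≔ 32 * reg 1) ;;
  .forLoop 36 (reg 0 + 1) (.store (7 * reg 2 + load (reg 36)) 1) ;;
  (.store (7 * reg 2) 1 ;; 9 ≔ 2 ;; 3 ≔ 8)

/-- The array at address `p` has length `len` and describes the semigroup generated by `A` up to `u`
and the set `A` above `u`. -/
def Init (A : Set ℕ) (len : ℕ) (mem : ℕ → ℕ) (p u : ℕ) : Prop :=
  ∀ x < len, mem (p + x) ≤ 1 ∧
    (mem (p + x) ≠ 0 ↔ if x ≤ u then x ∈ AddSubmonoid.closure A else x ∈ A)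

lemma mem_closure_iff_of_le_two {A : Set ℕ} (h1 : 1 ∉ A) {x : ℕ} (hx : x ≤ 2) :
    x ∈ AddSubmonoid.closure A ↔ x = 0 ∨ x ∈ A := by
  constructor
  · intro h
    by_contra! hne
    obtain ⟨y, hy, z, hz, hy0, hz0, hyz⟩ := exists_add_eq_of_notMem h hne.1 hne.2
    obtain rfl : y = 1 := by omega
    obtain ⟨y, hy, z, hz, hy0, hz0, hyz⟩ := exists_add_eq_of_notMem hy one_ne_zero h1
    omega
  · rintro (rfl | h)
    · exact zero_mem _
    · exact AddSubmonoid.subset_closure h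

lemma run_initProg {v m n : ℕ} {a : Fin (n + 1) → ℕ} (ha : StrictMono a) (hm : a (Fin.last n) = m)
    (h1 : 1 ∉ Set.range a) (hv : 8 * (32 * m) < 2 ^ v) (hm3 : 3 ≤ m) :
    Run v initProg (initState a) (100 * m + 100) (fun s => s.reg 1 = m ∧ s.reg 2 = 32 * m ∧
      s.reg 3 = 8 ∧ s.reg 9 = 2 ∧ Init (Set.range a) (32 * m) s.mem (7 * (32 * m)) 2) := by
  have hnm : n ≤ m := hm ▸ ha.le_apply_last
  let I : ℕ → State → Prop := fun j s => s.reg 0 = n ∧ s.reg 1 = m ∧ s.reg 2 = 32 * m ∧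
    (∀ (i : ℕ) (h : i < n + 1), s.mem i = a ⟨i, h⟩) ∧
    ∀ x, s.mem (7 * (32 * m) + x) ≤ 1 ∧
      (s.mem (7 * (32 * m) + x) ≠ 0 ↔ ∃ i : Fin (n + 1), i.val < j ∧ a i = x)
  refine Run.seq (T₁ := 20) (T₂ := 100 * m + 80)
    (R := fun s => s = ((initState a).set 1 m).set 2 (32 * m))
    (Run.flat (fun _ => ?_) (by decide)) ?_ (by omega)
  · have hload : (initState a).mem ((initState a).reg 0) = m := by
      simp only [initState, reduceIte]
      rw [dif_pos (by omega), ← hm]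
      rfl
    simp only [Program.wp, Expr.eval_mul, Expr.eval_reg, Expr.eval_load, Expr.eval_const,
      State.set_reg, reduceIte, hload]
    exact ⟨by omega, by omega, trivial⟩
  rintro s1 - rfl
  refine Run.seq (T₁ := 100 * m + 60) (T₂ := 20) (R := I (n + 1)) ?_ ?_ (by omega)
  · refine Run.forLoop (n := n + 1) (Tb := 20) I (by omega) ?_ ?_ ?_ (fun s h _ => h)
      (by simp only [Expr.cost]; omega)
    · refine ⟨by simp [initState], by simp, by simp, fun i h => dif_pos h, fun x => ?_⟩
      have h0 : (initState a).mem (7 * (32 * m) + x) = 0 := dif_neg (by omega)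
      simp [h0]
    · rintro j s ⟨h, -⟩
      simp [h]
    · rintro j s - hj ⟨g0, g1, g2, g3, g4⟩ hj'
      refine Run.flat (fun _ => ?_) (by decide)
      simp only [Program.wp, Expr.eval_mul, Expr.eval_add, Expr.eval_reg, Expr.eval_load,
        Expr.eval_const, g2, hj', g3 j hj]
      refine ⟨by omega, by simpa using hj', by simpa using g0, by simpa using g1, by simpa using g2,
        fun i h => ?_, fun x => ?_⟩
      · simp only [State.set_mem, State.put_mem]
        rw [if_neg (by omega), g3 i h]
      · simp only [State.set_mem, State.put_mem, Nat.add_left_cancel_iff]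
        by_cases hx : x = a ⟨j, hj⟩
        · rw [if_pos hx]
          exact ⟨le_rfl, fun _ => ⟨⟨j, hj⟩, by simp, hx.symm⟩, fun _ => one_ne_zero⟩
        · rw [if_neg hx]
          refine ⟨(g4 x).1, (g4 x).2.trans ?_⟩
          constructor
          · rintro ⟨i, hi, hi'⟩
            exact ⟨i, by omega, hi'⟩
          · rintro ⟨i, hi, hi'⟩
            refine ⟨i, ?_, hi'⟩
            rcases Nat.lt_succ_iff_lt_or_eq.1 hi with h | h
            · exact h
            · exact absurd (by rw [← hi']; congr 1; exact Fin.ext h) hx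
  · rintro s2 - ⟨g0, g1, g2, g3, g4⟩
    refine Run.flat (fun _ => ?_) (by decide)
    simp only [Program.wp, Expr.eval_mul, Expr.eval_reg, Expr.eval_const, g2]
    refine ⟨by omega, by omega, by omega, by simpa using g1, by simpa using g2, by simp, by simp,
      fun x _ => ?_⟩
    simp only [State.set_mem, State.put_mem, Nat.add_eq_left]
    have hrange : (∃ i : Fin (n + 1), i.val < n + 1 ∧ a i = x) ↔ x ∈ Set.range a :=
      ⟨fun ⟨i, _, hi⟩ => ⟨i, hi⟩, fun ⟨i, hi⟩ => ⟨i, i.2, hi⟩⟩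
    have hiff : (x = 0 ∨ x ∈ Set.range a) ↔
        if x ≤ 2 then x ∈ AddSubmonoid.closure (Set.range a) else x ∈ Set.range a := by
      split_ifs with h
      · exact (mem_closure_iff_of_le_two h1 h).symm
      · exact ⟨fun h' => h'.resolve_left (by omega), Or.inr⟩
    rw [← hiff]
    by_cases hx : x = 0
    · simp [hx]
    · rw [if_neg hx, (g4 x).2, hrange]
      exact ⟨(g4 x).1, Or.inr, fun h => h.resolve_left hx⟩

/-- The initial segment of the semigroup is extended geometrically, each time by a factor `3 / 2`, until
it covers the window around `2 m`. -/
def growProg : Program :=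
  (4 ≔ 7 * reg 2 ;; 5 ≔ 7 * reg 2 ;; 6 ≔ 7 * reg 2 ;; 8 ≔ 0) ;;
  .loop (.bin .lt (reg 9) (4 * reg 1))
    ((9 ≔ reg 9 + reg 9 / 2 ;; .ite (.bin .lt (reg 3) (2 * (reg 9 + 1))) (3 ≔ 2 * reg 3) .nop ;;
      7 ≔ reg 9 + 1) ;; sumsetProg)

/-- The state of the first phase when the semigroup is known up to `u`. -/
structure Grow (A : Set ℕ) (m u : ℕ) (s : State) : Prop where
  h1 : s.reg 1 = m
  h2 : s.reg 2 = 32 * m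
  h4 : s.reg 4 = 7 * (32 * m)
  h5 : s.reg 5 = 7 * (32 * m)
  h6 : s.reg 6 = 7 * (32 * m)
  h8 : s.reg 8 = 0
  h9 : s.reg 9 = u
  init : Init A (32 * m) s.mem (7 * (32 * m)) u
  two_le : 2 ≤ u
  u_le : u ≤ 6 * m
  le_N : 2 * (u + 1) ≤ s.reg 3
  N_le : s.reg 3 ≤ 4 * (u + 1)
  N_eq : ∃ K, 3 ≤ K ∧ s.reg 3 = 2 ^ K

lemma run_growProg {A : Set ℕ} {v m : ℕ} (hm : 3 ≤ m) (hv : (32 * m) ^ 40 < 2 ^ v) {s : State}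
    (h1 : s.reg 1 = m) (h2 : s.reg 2 = 32 * m) (h3 : s.reg 3 = 8) (h9 : s.reg 9 = 2)
    (hI : Init A (32 * m) s.mem (7 * (32 * m)) 2) :
    Run v growProg s (400000 * m * Nat.log 2 (32 * m)) (fun s' => ∃ N K, Params v (32 * m) N K ∧
      K ≤ Nat.log 2 (32 * m) ∧ N ≤ 32 * m ∧ 2 * (4 * m + 1) ≤ N ∧ s'.reg 1 = m ∧
      s'.reg 2 = 32 * m ∧ s'.reg 3 = N ∧ Win A m s'.mem (7 * (32 * m)) (2 * m)) := by
  have h8v : 8 * (32 * m) < 2 ^ v := by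
    refine lt_of_le_of_lt ?_ hv
    calc 8 * (32 * m) ≤ 32 * m * (32 * m) := Nat.mul_le_mul_right _ (by omega)
      _ = (32 * m) ^ 2 := by ring
      _ ≤ _ := Nat.pow_le_pow_right (by omega) (by norm_num)
  have hlog : ∀ {N K : ℕ}, N = 2 ^ K → N ≤ 32 * m → K ≤ Nat.log 2 (32 * m) := fun h h' =>
    (Nat.le_log_iff_pow_le (by norm_num) (by omega)).2 (h ▸ h')
  have hpar : ∀ {N K : ℕ}, N = 2 ^ K → 3 ≤ K → N ≤ 32 * m → Params v (32 * m) N K := fun h h' h'' =>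
    ⟨h, h', h'', h8v, (Nat.pow_le_pow_left h'' 40).trans_lt hv⟩
  set L := Nat.log 2 (32 * m) with hL
  have hL1 : 1 ≤ L := hL ▸ Nat.log_pos (by norm_num) (by omega)
  have hmL : 3 * 1 ≤ m * L := Nat.mul_le_mul hm hL1
  refine Run.seq (T₁ := 30) (T₂ := 57000 * (6 * m) * L + 10) (R := Grow A m 2)
    (Run.flat (fun _ => ?_) (by decide)) ?_ (by nlinarith)
  · simp only [Program.wp, Expr.eval_mul, Expr.eval_reg, Expr.eval_const, State.set_reg,
      Nat.reduceEqDiff, reduceIte, h2]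
    refine ⟨by omega, by omega, by omega, by omega, ?_⟩
    constructor
    case N_eq => exact ⟨3, le_rfl, by simpa using h3⟩
    case init => simpa using hI
    all_goals first | omega | simp [h1, h2, h3, h9]
  rintro s1 - hG
  refine Run.loop (Grow A m) (fun u => 57000 * (6 * m - u) * L + 10) ?_ ?_ 2 s1 hG
    (by have := Nat.mul_le_mul_right L (Nat.mul_le_mul_left 57000 (Nat.sub_le (6 * m) 2)); omega)
  · rintro u s' - hG h0
    have hu : 4 * m ≤ u := by
      by_contra h
      simp only [Expr.eval_mul, Expr.eval_lt, Expr.eval_reg, Expr.eval_const, hG.h1, hG.h9] at h0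
      rw [if_pos (by omega)] at h0
      omega
    obtain ⟨K, hK, hNK⟩ := hG.N_eq
    have hN1 := hG.le_N
    have hN2 := hG.N_le
    have hN3 := hG.u_le
    refine ⟨⟨s'.reg 3, K, hpar hNK hK (by omega), hlog hNK (by omega), by omega, by omega, hG.h1,
      hG.h2, rfl, fun x hx => ?_⟩, by simp [Expr.cost]⟩
    obtain ⟨w1, w2⟩ := hG.init x (by omega)
    rw [if_pos (by omega)] at w2
    exact ⟨w1, by rw [w2, Nat.sub_self, zero_add]⟩
  · rintro u s' hBd ⟨h1, h2, h4, h5, h6, h8, h9, init, two_le, u_le, le_N, N_le, K, hK, hNK⟩ h0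
    have hu : u < 4 * m := by
      by_contra h
      simp only [Expr.eval_mul, Expr.eval_lt, Expr.eval_reg, Expr.eval_const, h1, h9] at h0
      rw [if_neg (by omega)] at h0
      exact h0 rfl
    set u' := u + u / 2 with hu'
    have hd : u' ≤ 6 * (u' - u) := by omega
    have hb3 := hBd.reg 3
    -- a common description of the state in front of the convolution
    let R : State → Prop := fun t => t.mem = s'.mem ∧
      (∀ r, r ≠ 3 → r ≠ 7 → r ≠ 9 → t.reg r = s'.reg r) ∧ t.reg 7 = u' + 1 ∧ t.reg 9 = u' ∧
      2 * (u' + 1) ≤ t.reg 3 ∧ t.reg 3 ≤ 4 * (u' + 1) ∧ ∃ K, 3 ≤ K ∧ t.reg 3 = 2 ^ K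
    refine ⟨57000 * (u' - u) * L - 10, Run.seq (T₁ := 40) (T₂ := 56000 * (u' - u) * L) (R := R)
      (Run.flat (fun _ => ?_) (by decide)) ?_ ?_⟩
    · simp only [Program.wp, Expr.eval_mul, Expr.eval_add, Expr.eval_div, Expr.eval_lt, Expr.eval_reg,
        Expr.eval_const, State.set_reg, Nat.reduceEqDiff, reduceIte, h9, ← hu']
      refine ⟨by omega, fun hc => ?_, fun hc => ?_⟩
      · have hlt : s'.reg 3 < 2 * (u' + 1) := by
          by_contra h
          exact hc (if_neg h)
        refine ⟨by omega, by omega, rfl, fun r hr hr' hr'' => ?_, by simp, by simp, ?_, ?_, K + 1,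
          by omega, ?_⟩
        · simp only [State.set_reg]
          rw [if_neg hr', if_neg hr, if_neg hr'']
        all_goals simp only [State.set_reg, Nat.reduceEqDiff, reduceIte]
        · omega
        · omega
        · rw [hNK, pow_succ]; ring
      · have hge : 2 * (u' + 1) ≤ s'.reg 3 := by
          by_contra h
          rw [if_pos (by omega)] at hc
          omega
        refine ⟨by omega, rfl, fun r hr hr' hr'' => ?_, by simp, by simp, ?_, ?_, K, hK, ?_⟩
        · simp only [State.set_reg]
          rw [if_neg hr', if_neg hr'']
        all_goals simp only [State.set_reg, Nat.reduceEqDiff, reduceIte]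
        · omega
        · omega
        · exact hNK
    · rintro t - ⟨b1, b2, b7, b9, b3, b3', K', hK', hN'⟩
      have c1 := (b2 1 (by omega) (by omega) (by omega)).trans h1
      have c2 := (b2 2 (by omega) (by omega) (by omega)).trans h2
      have c4 := (b2 4 (by omega) (by omega) (by omega)).trans h4
      have c5 := (b2 5 (by omega) (by omega) (by omega)).trans h5
      have c6 := (b2 6 (by omega) (by omega) (by omega)).trans h6
      have c8 := (b2 8 (by omega) (by omega) (by omega)).trans h8
      have hT : 2000 * t.reg 3 * K' ≤ 56000 * (u' - u) * L :=
        Nat.mul_le_mul (by omega) (hlog hN' (by omega))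
      rw [← b1] at init
      refine (run_sumsetProg (hpar hN' hK' (by omega)) c2 rfl c4 c5 c6 b7 c8 le_rfl le_rfl le_rfl b3
        (by omega) (fun i hi => (init i (by omega)).1) (fun i hi => (init i (by omega)).1)).mono hT ?_
      rintro t' - ⟨d1, d2, d3, d4⟩
      refine ⟨u', ⟨(d1 1 (by omega)).trans c1, (d1 2 (by omega)).trans c2, (d1 4 (by omega)).trans c4,
        (d1 5 (by omega)).trans c5, (d1 6 (by omega)).trans c6, (d1 8 (by omega)).trans c8,
        (d1 9 (by omega)).trans b9, fun x hx => ?_, by omega, by omega, ?_, ?_, K', hK', ?_⟩, ?_⟩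
      · rcases Nat.lt_or_ge x (u' + 1) with h | h
        · refine ⟨d3 x h, ?_⟩
          rw [if_pos (by omega), d4 x h, mem_closure_iff_exists_add (u := u) (by omega)]
          constructor
          · rintro ⟨p, q, hp, hq, hp', hq', hpq⟩
            exact ⟨p, q, (init p (by omega)).2.1 hp', (init q (by omega)).2.1 hq', hpq⟩
          · rintro ⟨p, q, hp, hq, hpq⟩
            exact ⟨p, q, by omega, by omega, (init p (by omega)).2.2 hp, (init q (by omega)).2.2 hq,
              hpq⟩
        · rw [d2 _ (by omega) (by omega), if_neg (by omega)]
          have := init x hx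
          rwa [if_neg (by omega)] at this
      · rw [d1 3 (by omega)]; exact b3
      · rw [d1 3 (by omega)]; exact b3'
      · rw [d1 3 (by omega)]; exact hN'
      · have h1 : 1 * 1 ≤ (u' - u) * L := Nat.mul_le_mul (by omega) hL1
        have h2 : 57000 * (6 * m - u) * L = 57000 * (u' - u) * L + 57000 * (6 * m - u') * L := by
          rw [← add_mul, ← mul_add]
          congr 2
          omega
        have h3 : 57000 * (u' - u) * L = 57000 * ((u' - u) * L) := by ring
        simp only [Expr.cost]
        omega
    · have h1 : 1 * 1 ≤ (u' - u) * L := Nat.mul_le_mul (by omega) hL1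
      have h3 : 57000 * (u' - u) * L = 57000 * ((u' - u) * L) := by ring
      have h4 : 56000 * (u' - u) * L = 56000 * ((u' - u) * L) := by ring
      omega

end WordRAM

/-! ### The complete algorithm and its running time -/

namespace WordRAM

/-- The program that computes the Frobenius number. -/
def frobeniusProg : Program := initProg ;; growProg ;; doublingProg ;; searchProg ;; scanProg

lemma run_frobeniusProg {v m n F k : ℕ} {a : Fin (n + 1) → ℕ} (ha : StrictMono a)
    (hm : a (Fin.last n) = m) (hm3 : 3 ≤ m) (h1 : 1 ∉ Set.range a)
    (hF : FrobeniusNumber F (Set.range a)) (hk : F < 2 ^ k * (2 * m))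
    (hk' : ∀ j < k, 2 ^ j * (2 * m) ≤ F) (hv : (32 * m) ^ 40 < 2 ^ v)
    (hv1 : (9 + 2 * k) * (32 * m) < 2 ^ v) (hv2 : 2 ^ k * (2 * m) < 2 ^ v) (hv3 : F + 2 * m < 2 ^ v) :
    Run v frobeniusProg (initState a) (600000 * (m * Nat.log 2 (32 * m) * (k + 1)))
      (fun s => s.reg 0 = F) := by
  have hA : ∀ g ∈ Set.range a, g ≤ m := by
    rintro _ ⟨i, rfl⟩
    exact hm ▸ ha.monotone (Fin.le_last i)
  have hmA : m ∈ Set.range a := ⟨_, hm⟩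
  have e9 : (9 + 2 * k) * (32 * m) = (8 + k) * (32 * m) + (1 + k) * (32 * m) := by ring
  have e9' : (9 + 2 * k) * (32 * m) = 9 * (32 * m) + 2 * k * (32 * m) := by ring
  set L := Nat.log 2 (32 * m) with hL
  have hL1 : 1 ≤ L := hL ▸ Nat.log_pos (by norm_num) (by omega)
  have hmL : m * 1 ≤ m * L := Nat.mul_le_mul_left _ hL1
  have hD : m * L * (k + 1) = m * L * k + m * L := by ring
  have hD' : (k + 1) * (64100 * (m * L)) = 64100 * (m * L * (k + 1)) := by ring
  refine Run.seq (T₂ := 400000 * (m * L) + 2 * (64100 * (m * L * (k + 1))) + 300 * (m * L))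
    (run_initProg ha hm h1 (by omega) hm3) ?_ (by omega)
  rintro s1 - ⟨a1, a2, a3, a9, aI⟩
  refine Run.seq (T₂ := 2 * (64100 * (m * L * (k + 1))) + 300 * (m * L))
    (run_growProg hm3 hv a1 a2 a3 a9 aI) ?_ (by rw [← hL, mul_assoc 400000 m]; omega)
  rintro s2 - ⟨N, K, hp, hK, hNM, hN, b1, b2, b3, bw⟩
  have hT : 2000 * N * K + 30 * m + 100 ≤ 64100 * (m * L) := by
    have : 2000 * N * K ≤ 64000 * (m * L) := by
      calc 2000 * N * K ≤ 2000 * (32 * m) * L :=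
            Nat.mul_le_mul (Nat.mul_le_mul_left _ hNM) hK
        _ = _ := by ring
    omega
  have hT' : (k + 1) * (2000 * N * K + 30 * m + 100) ≤ 64100 * (m * L * (k + 1)) :=
    hD' ▸ Nat.mul_le_mul_left _ hT
  refine Run.seq (T₂ := 64100 * (m * L * (k + 1)) + 300 * (m * L))
    (run_doublingProg (by omega) hA hmA hF hp hN hk hk' (by omega) hv2 b1 b2 b3 bw) ?_ (by omega)
  rintro s3 - ⟨c1, c2, c3, c4⟩
  refine Run.seq (T₂ := 300 * (m * L))
    (run_searchProg (by omega) hA hmA hF hp hN hk hk' hv1 hv3 c1 c2 c3 c4) ?_ (by omega)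
  rintro s4 - hS
  exact (run_scanProg hF (by omega) (by omega) hS).mono (by omega) fun _ _ h => h

lemma bdd_initState {v n : ℕ} {a : Fin (n + 1) → ℕ} (ha : StrictMono a)
    (hn : n < 2 ^ v) (hm : a (Fin.last n) < 2 ^ v) (hv : 1 ≤ v) : Bdd v (initState a) := by
  refine ⟨hv, fun r => ?_, fun i => ?_⟩
  · simp only [initState]
    split_ifs
    · exact hn
    · positivity
  · simp only [initState]
    split_ifs
    · exact (ha.monotone (Fin.le_last _)).trans_lt hm
    · positivity

end WordRAM

lemma exists_frobeniusNumber_range {n : ℕ} {a : Fin (n + 1) → ℕ} (hgcd : Finset.univ.gcd a = 1)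
    (h1 : ∀ i, a i ≠ 1) : ∃ F, FrobeniusNumber F (Set.range a) := by
  have hdvd : Nat.setGcd (Set.range a) ∣ Finset.univ.gcd a :=
    Finset.dvd_gcd fun i _ => Nat.setGcd_dvd_of_mem ⟨i, rfl⟩
  refine exists_frobeniusNumber_iff.2 ⟨Nat.dvd_one.1 (hdvd.trans hgcd.dvd), ?_⟩
  rintro ⟨i, hi⟩
  exact h1 i hi

/-- The largest generator is at least `3`, and there are at least two generators. -/
lemma one_le_and_three_le_last {n : ℕ} {a : Fin (n + 1) → ℕ} (ha : StrictMono a)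
    (hgcd : Finset.univ.gcd a = 1) (h1 : ∀ i, a i ≠ 1) : 1 ≤ n ∧ 3 ≤ a (Fin.last n) := by
  have hdvd : ∀ d, (∀ i, d ∣ a i) → d = 1 := fun d hd =>
    Nat.dvd_one.1 (hgcd ▸ Finset.dvd_gcd fun i _ => hd i)
  have hn : 1 ≤ n := by
    by_contra h
    obtain rfl : n = 0 := by omega
    refine h1 0 (hdvd _ fun i => ?_)
    rw [show i = 0 from Fin.ext (by omega)]
  refine ⟨hn, ?_⟩
  by_contra h
  refine absurd (hdvd 2 fun i => ?_) (by norm_num)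
  have h2 : a i ≤ a (Fin.last n) := ha.monotone (Fin.le_last i)
  have := h1 i
  have : a i = 0 ∨ a i = 2 := by omega
  rcases this with h | h <;> simp [h]

/-- The number `k` of doublings is the least one with `F < 2 ^ k * (2 * m)`. -/
lemma exists_doublings {m : ℕ} (hm : 0 < m) (F : ℕ) :
    ∃ k, F < 2 ^ k * (2 * m) ∧ (∀ j < k, 2 ^ j * (2 * m) ≤ F) ∧ (k = 0 ∨ 2 ^ k * m ≤ F) := by
  have hex : ∃ k, F < 2 ^ k * (2 * m) :=
    ⟨F, Nat.lt_two_pow_self.trans_le (Nat.le_mul_of_pos_right _ (by omega))⟩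
  classical
  refine ⟨Nat.find hex, Nat.find_spec hex, fun j hj => not_lt.1 (Nat.find_min hex hj), ?_⟩
  rcases Nat.eq_zero_or_pos (Nat.find hex) with h | h
  · exact Or.inl h
  · refine Or.inr ?_
    obtain ⟨j, hj⟩ : ∃ j, Nat.find hex = j + 1 := ⟨Nat.find hex - 1, by omega⟩
    have := not_lt.1 (Nat.find_min hex (show j < Nat.find hex by omega))
    rw [hj, pow_succ]
    linarith

lemma log_frobeniusNumber_le {m n F : ℕ} (hn : 1 ≤ n) (hnm : n ≤ m) (h : F * n ^ 2 ≤ 2 * m ^ 3) :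
    1 + max 0 (Real.log ((F : ℝ) / m)) ≤ 2 * (1 + Real.log ((m : ℝ) / n)) := by
  have hn0 : (0 : ℝ) < n := by exact_mod_cast hn
  have hm0 : (0 : ℝ) < m := by exact_mod_cast (show 0 < m by omega)
  have h0 : 0 ≤ Real.log ((m : ℝ) / n) :=
    Real.log_nonneg ((one_le_div hn0).2 (by exact_mod_cast hnm))
  suffices Real.log ((F : ℝ) / m) ≤ 1 + 2 * Real.log ((m : ℝ) / n) by
    rcases max_cases (0 : ℝ) (Real.log ((F : ℝ) / m)) with h | h <;> linarith
  rcases Nat.eq_zero_or_pos F with rfl | hF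
  · simp; linarith
  have hF0 : (0 : ℝ) < F := by exact_mod_cast hF
  have hle : (F : ℝ) / m ≤ 2 * ((m : ℝ) / n) ^ 2 := by
    rw [div_pow, mul_div_assoc', div_le_div_iff₀ hm0 (by positivity)]
    have : (F : ℝ) * n ^ 2 ≤ 2 * m ^ 3 := by exact_mod_cast h
    linarith
  calc Real.log ((F : ℝ) / m) ≤ Real.log (2 * ((m : ℝ) / n) ^ 2) :=
        Real.log_le_log (by positivity) hle
    _ = Real.log 2 + 2 * Real.log ((m : ℝ) / n) := by
        rw [Real.log_mul (by norm_num) (by positivity), Real.log_pow]; norm_num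
    _ ≤ _ := by linarith [Real.log_two_lt_d9]

lemma natLog_le_log {m : ℕ} (hm : 3 ≤ m) : (Nat.log 2 (32 * m) : ℝ) ≤ 7 * Real.log m := by
  have hm0 : (0 : ℝ) < m := by exact_mod_cast (show 0 < m by omega)
  have h1 : ((2 : ℝ) ^ Nat.log 2 (32 * m)) ≤ 2 ^ 5 * m := by
    exact_mod_cast Nat.pow_log_le_self 2 (show 32 * m ≠ 0 by omega)
  have h2 := Real.log_le_log (by positivity) h1
  rw [Real.log_mul (by norm_num) hm0.ne', Real.log_pow, Real.log_pow] at h2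
  have h3 : 1 ≤ Real.log m := by
    rw [Real.le_log_iff_exp_le hm0]
    have : (3 : ℝ) ≤ m := by exact_mod_cast hm
    linarith [Real.exp_one_lt_d9]
  have h4 := Real.log_two_gt_d9
  push_cast at h2
  nlinarith

lemma doublings_le {m F k : ℕ} (hm : 0 < m) (hk : k = 0 ∨ 2 ^ k * m ≤ F) :
    (k : ℝ) ≤ 2 * max 0 (Real.log ((F : ℝ) / m)) := by
  have hm0 : (0 : ℝ) < m := by exact_mod_cast hm
  rcases hk with rfl | hk
  · simp
  have h1 : (2 : ℝ) ^ k ≤ F / m := by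
    rw [le_div_iff₀ hm0]
    exact_mod_cast hk
  have h2 := Real.log_le_log (by positivity) h1
  rw [Real.log_pow] at h2
  have h3 := Real.log_two_gt_d9
  have h4 := le_max_right 0 (Real.log ((F : ℝ) / m))
  nlinarith [k.cast_nonneg (α := ℝ)]

/-- All numbers that occur are bounded by a fixed power of the largest generator. -/
lemma lt_two_pow_size {m F k : ℕ} (hm : 3 ≤ m) (hF : F ≤ 2 * m ^ 3) (hk : k = 0 ∨ 2 ^ k * m ≤ F) :
    (32 * m) ^ 40 < 2 ^ (200 * Nat.size m) ∧ (9 + 2 * k) * (32 * m) < 2 ^ (200 * Nat.size m) ∧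
      2 ^ k * (2 * m) < 2 ^ (200 * Nat.size m) ∧ F + 2 * m < 2 ^ (200 * Nat.size m) := by
  have hmX : m < 2 ^ Nat.size m := Nat.lt_size_self m
  have hX : 4 ≤ 2 ^ Nat.size m := by
    have : 2 ≤ Nat.size m := by
      by_contra h
      have : 2 ^ Nat.size m ≤ 2 ^ 1 := Nat.pow_le_pow_right (by norm_num) (by omega)
      omega
    exact Nat.pow_le_pow_right (n := 2) (by norm_num) this
  rw [mul_comm 200, pow_mul]
  generalize 2 ^ Nat.size m = X at hmX hX
  have hpow : ∀ {i j : ℕ}, i ≤ j → X ^ i ≤ X ^ j := fun h => Nat.pow_le_pow_right (by omega) h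
  have hmul : ∀ {i : ℕ}, 4 * X ^ i ≤ X ^ (i + 1) := fun {i} => by
    rw [pow_succ']
    exact Nat.mul_le_mul_right _ hX
  have h1 := hmul (i := 1)
  have h2 := hmul (i := 2)
  have h3 := hmul (i := 3)
  have h4 := hmul (i := 4)
  have h5 := hmul (i := 5)
  have h6 := hmul (i := 6)
  have h7 := hmul (i := 7)
  simp only [Nat.reduceAdd, pow_one] at h1 h2 h3 h4 h5 h6 h7
  have hm3 : m ^ 3 ≤ X ^ 3 := Nat.pow_le_pow_left hmX.le 3
  have h12 := hpow (show 12 ≤ 200 by norm_num)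
  have h812 := hpow (show 8 ≤ 12 by norm_num)
  have hk2 : 2 ^ k * (2 * m) ≤ X ^ 5 := by
    rcases hk with rfl | hk
    · simp only [pow_zero, one_mul]; omega
    · have : 2 ^ k * (2 * m) = 2 * (2 ^ k * m) := by ring
      omega
  have hk3 : k ≤ X ^ 5 :=
    Nat.lt_two_pow_self.le.trans ((Nat.le_mul_of_pos_right _ (by omega)).trans hk2)
  refine ⟨?_, ?_, by omega, by omega⟩
  · calc (32 * m) ^ 40 ≤ (X ^ 4) ^ 40 := Nat.pow_le_pow_left (by omega) 40
      _ = X ^ 160 := by rw [← pow_mul]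
      _ < X ^ 200 := Nat.pow_lt_pow_right (by omega) (by norm_num)
  · calc (9 + 2 * k) * (32 * m) ≤ X ^ 7 * X ^ 4 := Nat.mul_le_mul (by omega) (by omega)
      _ = X ^ 11 := by rw [← pow_add]
      _ < X ^ 200 := Nat.pow_lt_pow_right (by omega) (by norm_num)

theorem mainTheorem4 :
    ∃ (P : WordRAM.Program) (c : ℕ) (C : ℝ),
      ∀ (n : ℕ) (a : Fin (n + 1) → ℕ), StrictMono a → Finset.univ.gcd a = 1 → (∀ i, a i ≠ 1) →
        ∃ F : ℕ, FrobeniusNumber F (Set.range a) ∧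
          (∃ (t : ℕ) (s : WordRAM.State),
            WordRAM.Exec (c * Nat.size (a (Fin.last n))) P (WordRAM.initState a) t s ∧
            s.reg 0 = F ∧
            (t : ℝ) ≤ C * ((a (Fin.last n) : ℝ) * Real.log (a (Fin.last n)) *
              (1 + max 0 (Real.log ((F : ℝ) / (a (Fin.last n) : ℝ)))))) ∧
          (a (Fin.last n) : ℝ) * Real.log (a (Fin.last n)) *
              (1 + max 0 (Real.log ((F : ℝ) / (a (Fin.last n) : ℝ)))) ≤
            C * ((a (Fin.last n) : ℝ) * Real.log (a (Fin.last n)) *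
              (1 + Real.log ((a (Fin.last n) : ℝ) / (n : ℝ)))) := by
  refine ⟨WordRAM.frobeniusProg, WordRAM.frobeniusProg.deg * 200, 8400000, fun n a ha hgcd h1 => ?_⟩
  obtain ⟨F, hF⟩ := exists_frobeniusNumber_range hgcd h1
  obtain ⟨hn, hm⟩ := one_le_and_three_le_last ha hgcd h1
  have hFn := frobeniusNumber_mul_sq_le ha hn hF
  have hnm : n ≤ a (Fin.last n) := ha.le_apply_last
  generalize hma : a (Fin.last n) = m at *
  have hFm : F ≤ 2 * m ^ 3 := (Nat.le_mul_of_pos_right F (by positivity)).trans hFn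
  obtain ⟨k, hk, hk', hk0⟩ := exists_doublings (show 0 < m by omega) F
  obtain ⟨v1, v2, v3, v4⟩ := lt_two_pow_size hm hFm hk0
  have hm0 : (0 : ℝ) < m := by exact_mod_cast (show 0 < m by omega)
  have hlog : 0 ≤ Real.log m := Real.log_nonneg (by exact_mod_cast (show 1 ≤ m by omega))
  have hmax := le_max_left 0 (Real.log ((F : ℝ) / m))
  refine ⟨F, hF, ?_, ?_⟩
  · obtain ⟨t, s, hs, ht, -, hs0⟩ := WordRAM.run_frobeniusProg ha hma hm
      (by rintro ⟨i, hi⟩; exact h1 i hi) hF hk hk' v1 v2 v3 v4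
      (WordRAM.bdd_initState ha (by omega) (by omega)
        (Nat.mul_pos (by norm_num) (Nat.size_pos.2 (by omega)))) _ (mul_assoc _ _ _).ge
    refine ⟨t, s, hs, hs0, ?_⟩
    have ht' : (t : ℝ) ≤ 600000 * (m * Nat.log 2 (32 * m) * (k + 1)) := by exact_mod_cast ht
    have hL := natLog_le_log hm
    have hk2 := doublings_le (show 0 < m by omega) hk0
    calc (t : ℝ) ≤ 600000 * (m * Nat.log 2 (32 * m) * (k + 1)) := ht'
      _ ≤ 600000 * (m * (7 * Real.log m) * (2 * (1 + max 0 (Real.log ((F : ℝ) / m))))) := by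
          gcongr
          linarith
      _ = _ := by ring
  · have h2 := log_frobeniusNumber_le hn hnm hFn
    have h3 := mul_le_mul_of_nonneg_left h2 (mul_nonneg hm0.le hlog)
    have h4 : 0 ≤ m * Real.log m * (1 + Real.log ((m : ℝ) / n)) :=
      mul_nonneg (mul_nonneg hm0.le hlog) (by linarith)
    linarith
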